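/- \textbf{Model.} In $\mathcal{CAMP}_{n,t}$ there are $n$ asynchronous sequential processes, each of which can send messages to every process (itself included) over reliable, asynchronous, not necessarily FIFO channels: no message is lost, created, corrupted or duplicated, and a message sent to a process that never crashes is eventually received. At most $t$ processes crash; a process that crashes in the middle of a step may have sent only a part of the messages of that step. A process that never crashes is \emph{correct}; it starts, and each of its threads takes infinitely many steps. \textbf{Tasks and algorithms.} A decision task for $n'$ processes is a relation $\Delta\subseteq\mathcal I\times\mathcal O$ between input and output vectors. An algorithm $A$ for processes $p_1,\dots,p_{n'}$ is given by initial states (depending on the input), deterministic transition functions $\delta_j$, where $\delta_j(s,\emptyset)$, resp. $\delta_j(s,m)$, runs $p_j$ from its initial state, resp. from the reception of $m$, until its next reception and returns the new state and the messages sent, and a partial function telling which value a state allows to decide; $p_j$ decides the value allowed by its first state that allows one. $A$ solves $\Delta$ in $\mathcal{CAMP}_{n',t}$ if in every execution with input vector $I\in\mathcal I$ every correct process decides and there is $O$ with $(I,O)\in\Delta$ and $O[j]=v$ whenever $p_j$ decides $v$. \textbf{Safe agreement.} The $n$ simulators $q_1,\dots,q_n$ use objects $SA[j,sn]$ ($1\le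 j\le n'$, $sn\ge 0$) over a totally ordered set of values. For each object $q_i$ keeps arrays $values_i$, $all\_views_i$, initially $\bot$. When \textsc{value}$(x,v)$ is received for the first time, $q_i$ sets $values_i[x]\gets v$ and broadcasts \textsc{value}$(x,v)$; when \textsc{view}$(x,w)$ is received for the first time, it sets $all\_views_i[x]\gets w$ and broadcasts \textsc{view}$(x,w)$; when \textsc{read}$(k,x)$ is received for the first time, it sends \textsc{answer}$(k,x,values_i[x])$ to $q_k$. Operation $\mathsf{propose}(v)$ by $q_i$: broadcast \textsc{value}$(i,v)$ and wait until it is received from more than $n/2$ simulators; broadcast \textsc{read}$(i,x)$ for all $x$; for $x=1,\dots,n$ in turn, wait until \textsc{answer}$(i,x,\bot)$, or \textsc{value}$(x,u)$ for some $u$, is received from more than $n/2$ simulators, and set $view[x]\gets u$ if the second holds, $view[x]\gets\bot$ otherwise; broadcast \textsc{view}$(i,view)$ and wait until it is received from more than $n/2$ simulators. Operation $\mathsf{decide}()$: wait until there is a non-empty set $\sigma$ of simulators such that for all $y\in\sigma$: $values_i[y]\ne\bot$, $all\_views_i[y]\neq\bot$, and $all\_views_i[y][z]\ne\bot$ implies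 $z\in\sigma$; take such a $\sigma$ of smallest size and return $\min\{values_i[y]:y\in\sigma\}$. \textbf{Simulation.} $q_i$ has an input vector $input_i[1..n']$, sequences $sent_i[j]$ and $received_i[j]$ ($1\le j\le n'$) of messages, initially empty, a first-in first-out mutual exclusion lock, and one thread per simulated process. A simulated message carries its sender and its rank among the messages of that sender to the same destination. The thread for $p_j$ executes $SA[j,0].\mathsf{propose}(input_i[j])$ while holding the lock, then $input_i[j]\gets SA[j,0].\mathsf{decide}()$, and applies $\delta_j(\cdot,\emptyset)$ to the initial state of $p_j$ with this input. Then, for $sn=1,2,\dots$: it waits until some message of $sent_i[j]$ is not in $received_i[j]$; it executes $SA[j,sn].\mathsf{propose}(m)$ with the oldest such message $m$ while holding the lock; it obtains a message from $SA[j,sn].\mathsf{decide}()$, appends it to $received_i[j]$, and applies $\delta_j$ to the current state of $p_j$ and this message. After each application of $\delta_j$ the messages sent to $p_x$ are appended to $sent_i[x]$ for every $x$ and, if no decision of $p_j$ has been recorded yet and the new state allows a decision $v$, then $q_i$ records $v$ as the decision of $p_j$. \textbf{Theorem.} Let $2t<n$ and $t<n'$, and let $A$ solve a decision task $\Delta\subseteq\mathcal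 I\times\mathcal O$ in $\mathcal{CAMP}_{n',t}$. Consider any execution of the simulation of $A$ in $\mathcal{CAMP}_{n,t}$ in which the inputs are such that every vector $I$ with $I[j]\in\{input_1[j],\dots,input_n[j]\}$ for all $j$ is in $\mathcal I$. Then: \begin{enumerate} \item There are such a vector $I$ and an execution $E$ of $A$ in $\mathcal{CAMP}_{n',t}$ with input vector $I$ such that: for every simulator $q_i$ (crashed or not), every $p_j$ and every time, the state of $p_j$ and the sequence of messages received by $p_j$ at $q_i$ are those of $p_j$ at some time of $E$; conversely, each pair (state of $p_j$, sequence of messages received by $p_j$) of $E$ occurs at some time at every correct simulator; the processes that crash in $E$ are exactly those whose simulation is blocked at some correct simulator (from some time on, the thread never completes its current access to a safe agreement object); every decision recorded for $p_j$ by any simulator is the decision of $p_j$ in $E$; and there is $O$ with $(I,O)\in\Delta$ such that $O[j]=v$ for every decision $v$ of $p_j$ recorded by a simulator. \item The crash of a simulator blocks at most one simulated process: there is a function $f$ from simulators to simulated processes such that every simulated process whose simulation is blocked at some correct simulator is $f(q)$ for some crashed simulator $q$. \item All simulators see the same message sequences: for every $j$ and $k$, any two simulators that simulate the $k$-th reception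 of $p_j$ obtain the same message. \item Each correct simulator records the decisions of at least $n'-t$ simulated processes. \end{enumerate} -/

import Mathlib

noncomputable section

open scoped Classical

namespace BG

/-! ### The crash-prone asynchronous message-passing model -/

/-- A message-passing protocol for `n` sequential processes.  Every transition returns the new
local state and, for each destination, the sequence of messages sent to it.
`start` is executed once, `recv` on each reception (local state, sender, content),
and `tick` is one step of one of the internal threads of the process. -/
structure Protocol (n : ℕ) (In M S Thr : Type*) where
  start : Fin n → In → S × (Fin n → List M)
  recv : Fin n → S → Fin n → M → S × (Fin n → List M)
  tick : Fin n → Thr → S → S × (Fin n → List M)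

/-- A global configuration.  `loc p = none` means that `p` has not started yet;
`chan p q` lists all messages sent so far by `p` to `q`, and `got p q` is the set of the positions
in that list that `q` has already received. -/
structure Config (n : ℕ) (M S : Type*) where
  loc : Fin n → Option S
  chan : Fin n → Fin n → List M
  got : Fin n → Fin n → Set ℕ
  crashed : Set (Fin n)

/-- The steps of a process; `recv q k` is the reception of the message number `k` sent by `q`. -/
inductive Event (n : ℕ) (Thr : Type*) where
  | start
  | recv (q : Fin n) (k : ℕ)
  | tick (θ : Thr)

def Config.initial (n : ℕ) (M S : Type*) : Config n M S where
  loc := fun _ => none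
  chan := fun _ _ => []
  got := fun _ _ => ∅
  crashed := ∅

/-- Result of the step `ev` of `p` in configuration `c`; `none` if the step is not possible.
Channels are not FIFO, and do not lose, create, corrupt or duplicate messages. -/
def Protocol.effect {n : ℕ} {In M S Thr : Type*} (P : Protocol n In M S Thr) (inp : Fin n → In)
    (c : Config n M S) (p : Fin n) : Event n Thr → Option (S × (Fin n → List M))
  | .start => if c.loc p = none then some (P.start p (inp p)) else none
  | .recv q k =>
      if k ∈ c.got q p then none
      else (c.loc p).bind fun s => (c.chan q p)[k]?.map fun m => P.recv p s q m
  | .tick θ => (c.loc p).map (P.tick p θ)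

/-- Append the messages `out` sent by `p` to its outgoing channels. -/
def Config.send {n : ℕ} {M S : Type*} (c : Config n M S) (p : Fin n) (out : Fin n → List M) :
    Config n M S :=
  { c with chan := fun a b => if a = p then c.chan a b ++ out b else c.chan a b }

/-- Record that `p` has received the message referred to by `ev`, if any. -/
def Config.mark {n : ℕ} {M S Thr : Type*} (c : Config n M S) (p : Fin n) :
    Event n Thr → Config n M S
  | .recv q k => { c with got := fun a b => if a = q ∧ b = p then insert k (c.got a b)
                                            else c.got a b }
  | _ => c

/-- One global step; the label is the complete process step that is executed, if any. -/
inductive Step {n : ℕ} {In M S Thr : Type*} (P : Protocol n In M S Thr) (inp : Fin n → In) :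
    Config n M S → Option (Fin n × Event n Thr) → Config n M S → Prop
  /-- nothing happens -/
  | idle (c : Config n M S) : Step P inp c none c
  /-- a non-crashed process executes a complete step -/
  | run (c : Config n M S) (p : Fin n) (ev : Event n Thr) (s : S) (out : Fin n → List M) :
      p ∉ c.crashed → P.effect inp c p ev = some (s, out) →
      Step P inp c (some (p, ev))
        { (c.send p out).mark p ev with loc := Function.update c.loc p (some s) }
  /-- a process crashes between two steps -/
  | crash (c : Config n M S) (p : Fin n) : p ∉ c.crashed →
      Step P inp c none { c with crashed := insert p c.crashed }
  /-- a process crashes in the middle of a step, having sent only a part of the messages -/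
  | crashInside (c : Config n M S) (p : Fin n) (ev : Event n Thr) (s : S)
      (out out' : Fin n → List M) :
      p ∉ c.crashed → P.effect inp c p ev = some (s, out) → (∀ q, out' q <+: out q) →
      Step P inp c none { c.send p out' with crashed := insert p c.crashed }

/-- A discrete-time trace: configurations, and complete process steps executed between them. -/
structure Trace (n : ℕ) (M S Thr : Type*) where
  cfg : ℕ → Config n M S
  act : ℕ → Option (Fin n × Event n Thr)

/-- `p` never crashes. -/
def Trace.Correct {n : ℕ} {M S Thr : Type*} (e : Trace n M S Thr) (p : Fin n) : Prop :=
  ∀ τ, p ∉ (e.cfg τ).crashed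

/-- `e` is an execution of `P` with inputs `inp` in the asynchronous message-passing model where
at most `t` of the `n` processes crash. -/
structure IsExecution {n : ℕ} {In M S Thr : Type*} (P : Protocol n In M S Thr) (inp : Fin n → In)
    (t : ℕ) (e : Trace n M S Thr) : Prop where
  init : e.cfg 0 = Config.initial n M S
  step : ∀ τ, Step P inp (e.cfg τ) (e.act τ) (e.cfg (τ + 1))
  resilient : {p | ¬ e.Correct p}.ncard ≤ t
  starts : ∀ p, e.Correct p → ∃ τ, (e.cfg τ).loc p ≠ none
  delivers : ∀ p, e.Correct p → ∀ q τ k, k < ((e.cfg τ).chan q p).length →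
    ∃ τ', k ∈ (e.cfg τ').got q p
  fair : ∀ p, e.Correct p → ∀ θ τ, ∃ τ', τ ≤ τ' ∧ e.act τ' = some (p, .tick θ)

/-- The sequence of messages (sender, rank among the messages from that sender to `p`, content)
received by `p` before time `τ`. -/
def Trace.received {n : ℕ} {M S Thr : Type*} (e : Trace n M S Thr) (p : Fin n) (τ : ℕ) :
    List (Fin n × ℕ × M) :=
  (List.range τ).filterMap fun u =>
    match e.act u with
    | some (p', .recv q k) =>
        if p' = p then ((e.cfg u).chan q p)[k]?.map fun m => (q, k, m) else none
    | _ => none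

/-! ### Decision tasks and algorithms -/

/-- A decision task: a binary relation from allowed input vectors into output vectors. -/
structure Task (n : ℕ) (In Out : Type*) where
  inputs : Set (Fin n → In)
  outputs : Set (Fin n → Out)
  rel : (Fin n → In) → (Fin n → Out) → Prop
  rel_mem : ∀ I O, rel I O → I ∈ inputs ∧ O ∈ outputs

/-- A deterministic message-passing algorithm.  `init j v` is the initial local state of `p_j` with
input `v`; `δ j s none` runs `p_j` from its initial state until its first reception, and
`δ j s (some (q, m))` runs it from the reception of `m` from `p_q` until its next reception.
`dec j s` is the value that the state `s` allows `p_j` to decide, if any. -/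
structure Algorithm (n : ℕ) (In Out M S : Type*) where
  init : Fin n → In → S
  δ : Fin n → S → Option (Fin n × M) → S × (Fin n → List M)
  dec : Fin n → S → Option Out

def Algorithm.toProtocol {n : ℕ} {In Out M S : Type*} (A : Algorithm n In Out M S) :
    Protocol n In M S Empty where
  start := fun j v => A.δ j (A.init j v) none
  recv := fun j s q m => A.δ j s (some (q, m))
  tick := fun _ θ _ => θ.elim

/-- In `e`, process `p` decides `v`: this is the value allowed by the first state of `p` that
allows a decision. -/
def Algorithm.Decides {n : ℕ} {In Out M S : Type*} (A : Algorithm n In Out M S)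
    (e : Trace n M S Empty) (p : Fin n) (v : Out) : Prop :=
  ∃ τ, ((e.cfg τ).loc p).bind (A.dec p) = some v ∧
    ∀ τ' < τ, ((e.cfg τ').loc p).bind (A.dec p) = none

/-- `A` solves the task `T` in the presence of at most `t` crashes. -/
def Algorithm.Solves {n : ℕ} {In Out M S : Type*} (A : Algorithm n In Out M S)
    (T : Task n In Out) (t : ℕ) : Prop :=
  ∀ I ∈ T.inputs, ∀ e, IsExecution A.toProtocol I t e →
    (∀ p, e.Correct p → ∃ v, A.Decides e p v) ∧
    ∃ O, T.rel I O ∧ ∀ p v, A.Decides e p v → O p = v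

/-! ### Safe agreement: messages and server side -/

/-- Messages of a safe agreement object shared by `n` simulators; `V` is the type of the
values that can be proposed, and `none` stands for the default value `⊥`. -/
inductive SAMsg (n : ℕ) (V : Type*) where
  | value (x : Fin n) (v : V)
  | read (j x : Fin n)
  | answer (j x : Fin n) (w : Option V)
  | view (x : Fin n) (w : Fin n → Option V)

/-- Local data of a simulator for one safe agreement object: the messages received so far (with
their senders), and the arrays `values` and `all_views`. -/
structure SAState (n : ℕ) (V : Type*) where
  log : Set (Fin n × SAMsg n V)
  values : Fin n → Option V
  allViews : Fin n → Option (Fin n → Option V)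

def SAState.initial (n : ℕ) (V : Type*) : SAState n V where
  log := ∅
  values := fun _ => none
  allViews := fun _ => none

/-- Reception of the message `m` from `src`.  A message already received (from any simulator)
is only recorded. -/
def SAState.recv {n : ℕ} {V : Type*} (s : SAState n V) (src : Fin n) (m : SAMsg n V) :
    SAState n V × (Fin n → List (SAMsg n V)) :=
  let s' : SAState n V := { s with log := insert (src, m) s.log }
  if ∃ q, (q, m) ∈ s.log then (s', fun _ => [])
  else match m with
    | .value x v =>
        ({ s' with values := Function.update s.values x (some v) }, fun _ => [.value x v])
    | .read j x => (s', fun q => if q = j then [.answer j x (s.values x)] else [])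
    | .answer _ _ _ => (s', fun _ => [])
    | .view x w =>
        ({ s' with allViews := Function.update s.allViews x (some w) }, fun _ => [.view x w])

/-- The message `m` was received from strictly more than `n / 2` different simulators. -/
def SAState.Majority {n : ℕ} {V : Type*} (s : SAState n V) (m : SAMsg n V) : Prop :=
  n < 2 * {q : Fin n | (q, m) ∈ s.log}.ncard

/-- `σ` is a non-empty set of simulators whose values and views are known, and which contains
all the simulators whose values appear in these views. -/
def SAState.Closed {n : ℕ} {V : Type*} (s : SAState n V) (σ : Finset (Fin n)) : Prop :=
  σ.Nonempty ∧ ∀ y ∈ σ, s.values y ≠ none ∧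
    ∃ w, s.allViews y = some w ∧ ∀ z, w z ≠ none → z ∈ σ

/-- `decide()` can return `r`: the smallest of the values proposed by the members of a closed set
of smallest size. -/
def SAState.Returns {n : ℕ} {V : Type*} [LinearOrder V] (s : SAState n V) (r : V) : Prop :=
  ∃ σ, s.Closed σ ∧ (∀ σ', s.Closed σ' → σ.card ≤ σ'.card) ∧
    IsLeast {v | ∃ y ∈ σ, s.values y = some v} r

/-- The value returned by `decide()`, or `none` while it has to wait. -/
def SAState.result {n : ℕ} {V : Type*} [LinearOrder V] (s : SAState n V) : Option V :=
  if h : ∃ r, s.Returns r then some h.choose else none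

/-! ### The simulation algorithm -/

/-- A simulated message to a given destination: sender, rank among the messages sent by that sender
to that destination, content.  The first two components identify the message. -/
abbrev SimMsg (n' : ℕ) (M : Type*) := Fin n' × ℕ × M

/-- Values proposed to the safe agreement objects: inputs or simulated messages. -/
inductive SAVal (n' : ℕ) (In M : Type*) where
  | input (v : In)
  | msg (m : SimMsg n' M)

/-- Program counter of the thread of a simulator that simulates `p_j`, where `SA` is the current
safe agreement object `SA[j, sn]`. -/
inductive PC (n : ℕ) (V : Type*) where
  /-- initially -/
  | begin
  /-- waiting for a message that can be received by `p_j` -/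
  | waitMsg
  /-- `mutex_in` invoked, in order to execute `SA.propose(v)` -/
  | lock (v : V)
  /-- in `SA.propose(v)`: the value was broadcast, waiting for a majority of copies -/
  | waitValue (v : V)
  /-- in `SA.propose`: building the view, entries `< k` are done -/
  | reading (k : ℕ) (w : Fin n → Option V)
  /-- in `SA.propose`: the view was broadcast, waiting for a majority of copies -/
  | waitView (w : Fin n → Option V)
  /-- in `SA.decide()` -/
  | deciding

/-- Local state of a simulator.  The safe agreement object `SA[j, sn]` is identified by `(j, sn)`.
`queue` is the queue of the starvation-free (first-in first-out) lock; its head owns the lock.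
`received j` lists the messages received by `p_j`, in order; `state j = none` as long as `p_j` has
not executed its first statements. -/
structure SimState (n n' : ℕ) (In Out M S : Type*) where
  input : Fin n' → In
  sa : Fin n' × ℕ → SAState n (SAVal n' In M)
  queue : List (Fin n')
  pc : Fin n' → PC n (SAVal n' In M)
  sn : Fin n' → ℕ
  sent : Fin n' → List (SimMsg n' M)
  received : Fin n' → List (SimMsg n' M)
  state : Fin n' → Option S
  decided : Fin n' → Option Out

/-- Messages exchanged by the simulators: messages of the safe agreement objects `SA[j, sn]`. -/
abbrev NetMsg (n n' : ℕ) (In M : Type*) := (Fin n' × ℕ) × SAMsg n (SAVal n' In M)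

section Simulator

variable {n n' : ℕ} {In Out M S : Type*}

def SimState.initial (input : Fin n' → In) : SimState n n' In Out M S where
  input := input
  sa := fun _ => SAState.initial n _
  queue := []
  pc := fun _ => .begin
  sn := fun _ => 0
  sent := fun _ => []
  received := fun _ => []
  state := fun _ => none
  decided := fun _ => none

/-- Change of the program counter of the thread `j`. -/
def SimState.goto (s : SimState n n' In Out M S) (j : Fin n') (pc : PC n (SAVal n' In M)) :
    SimState n n' In Out M S :=
  { s with pc := Function.update s.pc j pc }

/-- The thread `j` invokes `mutex_in` in order to propose `v`. -/
def SimState.mutexIn (s : SimState n n' In Out M S) (j : Fin n') (v : SAVal n' In M) :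
    SimState n n' In Out M S :=
  { s.goto j (.lock v) with queue := s.queue ++ [j] }

/-- Oldest message in `sent[j] \ received[j]`. -/
def SimState.oldest (s : SimState n n' In Out M S) (j : Fin n') : Option (SimMsg n' M) :=
  (s.sent j).find? fun m => decide (m ∉ s.received j)

/-- The result `r = (new state, messages)` of `δ_j` is recorded: the messages, with their
identities, are added at the end of the sequences `sent[x]`, and `p_j` decides if it has not decided
yet and its new state allows it to do so.  The thread then waits for the next message. -/
def SimState.advance (A : Algorithm n' In Out M S) (s : SimState n n' In Out M S) (j : Fin n')
    (r : S × (Fin n' → List M)) : SimState n n' In Out M S :=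
  { s.goto j .waitMsg with
    state := Function.update s.state j (some r.1)
    sent := fun x => s.sent x ++
      (r.2 x).mapIdx fun k m => (j, (s.sent x).countP (fun a => decide (a.1 = j)) + k, m)
    decided := Function.update s.decided j ((s.decided j).or (A.dec j r.1))
    sn := Function.update s.sn j (s.sn j + 1) }

/-- The thread `j` obtains the value `v` from `SA[j, sn].decide()`: the input of `p_j` from
`SA[j, 0]`, the next message received by `p_j` from `SA[j, sn]` with `sn ≥ 1`. -/
def SimState.obtain (A : Algorithm n' In Out M S) (s : SimState n n' In Out M S) (j : Fin n') :
    SAVal n' In M → SimState n n' In Out M S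
  | .input v =>
      { s with input := Function.update s.input j v }.advance A j (A.δ j (A.init j v) none)
  | .msg m =>
      match s.state j with
      | some st =>
          { s with received := Function.update s.received j (s.received j ++ [m]) }.advance A j
            (A.δ j st (some (m.1, m.2.2)))
      | none => s

/-- One step of the thread of the simulator `i` that simulates `p_j`. -/
def threadStep [LinearOrder (SAVal n' In M)] (A : Algorithm n' In Out M S) (i : Fin n)
    (j : Fin n') (s : SimState n n' In Out M S) :
    SimState n n' In Out M S × (Fin n → List (NetMsg n n' In M)) :=
  let o : Fin n' × ℕ := (j, s.sn j)
  let silent : Fin n → List (NetMsg n n' In M) := fun _ => []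
  match s.pc j with
  | .begin => (s.mutexIn j (.input (s.input j)), silent)
  | .waitMsg =>
      match s.oldest j with
      | some m => (s.mutexIn j (.msg m), silent)
      | none => (s, silent)
  | .lock v =>
      if s.queue.head? = some j then (s.goto j (.waitValue v), fun _ => [(o, .value i v)])
      else (s, silent)
  | .waitValue v =>
      if (s.sa o).Majority (.value i v) then
        (s.goto j (.reading 0 fun _ => none),
          fun _ => (List.finRange n).map fun x => (o, .read i x))
      else (s, silent)
  | .reading k w =>
      if hk : k < n then
        if h : ∃ v, (s.sa o).Majority (.value ⟨k, hk⟩ v) then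
          (s.goto j (.reading (k + 1) (Function.update w ⟨k, hk⟩ (some h.choose))), silent)
        else if (s.sa o).Majority (.answer i ⟨k, hk⟩ none) then
          (s.goto j (.reading (k + 1) (Function.update w ⟨k, hk⟩ none)), silent)
        else (s, silent)
      else (s.goto j (.waitView w), fun _ => [(o, .view i w)])
  | .waitView w =>
      if (s.sa o).Majority (.view i w) then
        ({ s.goto j .deciding with queue := s.queue.tail }, silent)
      else (s, silent)
  | .deciding =>
      match (s.sa o).result with
      | some v => (s.obtain A j v, silent)
      | none => (s, silent)

/-- The simulation of the algorithm `A` of `n'` processes by `n` simulators.  The input of a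
simulator is a vector of inputs for the simulated processes; it has one thread for each of them. -/
def simulation (n : ℕ) [LinearOrder (SAVal n' In M)] (A : Algorithm n' In Out M S) :
    Protocol n (Fin n' → In) (NetMsg n n' In M) (SimState n n' In Out M S) (Fin n') where
  start := fun _ input => (SimState.initial input, fun _ => [])
  recv := fun _ s src m =>
    let r := (s.sa m.1).recv src m.2
    ({ s with sa := Function.update s.sa m.1 r.1 }, fun q => (r.2 q).map fun a => (m.1, a))
  tick := fun i j s => threadStep A i j s

/-- Executions of the simulators. -/
abbrev SimTrace (n n' : ℕ) (In Out M S : Type*) :=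
  Trace n (NetMsg n n' In M) (SimState n n' In Out M S) (Fin n')

/-- `s` is the local state of the simulator `i` at some time of `e`. -/
def Reaches (e : SimTrace n n' In Out M S) (i : Fin n) (s : SimState n n' In Out M S) : Prop :=
  ∃ τ, (e.cfg τ).loc i = some s

/-- The simulation of `p_j` is blocked at the simulator `i`: from some time on, the thread never
again completes its current access to a safe agreement object. -/
def Blocked (e : SimTrace n n' In Out M S) (i : Fin n) (j : Fin n') : Prop :=
  ∃ τ₀, ∀ τ ≥ τ₀, ∀ s, (e.cfg τ).loc i = some s →
    match s.pc j with
    | .waitMsg => False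
    | _ => True

/-- The simulator `i` computes the decision `v` of the simulated process `p_j`. -/
def Computes (e : SimTrace n n' In Out M S) (i : Fin n) (j : Fin n') (v : Out) : Prop :=
  ∃ s, Reaches e i s ∧ s.decided j = some v

/-- The execution `e` of the simulators, with inputs `inp`, simulates the execution `e'` of `A` with
inputs `I`, in which at most `t` processes crash. -/
structure Simulates (A : Algorithm n' In Out M S) (t : ℕ) (inp : Fin n → Fin n' → In)
    (e : SimTrace n n' In Out M S) (I : Fin n' → In) (e' : Trace n' M S Empty) : Prop where
  /-- the input of each simulated process was proposed by a simulator -/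
  input : ∀ j, ∃ i, I j = inp i j
  /-- `e'` is an execution of `A` -/
  execution : IsExecution A.toProtocol I t e'
  /-- what a simulator simulates is what happens in `e'` -/
  sound : ∀ i s, Reaches e i s → ∀ j, ∃ τ,
    (e'.cfg τ).loc j = s.state j ∧ e'.received j τ = s.received j
  /-- what happens in `e'` is simulated by each correct simulator -/
  complete : ∀ i, e.Correct i → ∀ j τ, ∃ s, Reaches e i s ∧
    s.state j = (e'.cfg τ).loc j ∧ s.received j = e'.received j τ
  /-- the simulated processes that crash are those whose simulation is blocked -/
  crash : ∀ j, ¬ e'.Correct j ↔ ∃ i, e.Correct i ∧ Blocked e i j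
  /-- decisions computed by the simulators are decisions of `e'` -/
  decision : ∀ i j v, Computes e i j v → A.Decides e' j v

end Simulator

end BG

end

noncomputable section

open scoped Classical

namespace BG

/-! ### General facts on executions -/

/-! The proof has three layers.

Safety of one object. For a fixed object a simulator proposes at most one value and broadcasts at
most one view, since its program counter only moves forward (`Proposed.unique`,
`ProposedView.unique`). Suppose the view of `y` misses `x`. The majority that answered `⊥` to `y`
meets the majority that forwarded the value of `x`, so a majority held the value of `y` strictly
before any majority held the value of `x` (`majority_before`). Two views that miss each other would
yield an infinite descent in time, so one of the two proposers sees the other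
(`ProposedView.related`). Hence two closed sets, even at different simulators and times, intersect
in a closed set; all smallest closed sets are equal, and so are the returned minima (`closed_inter`,
`returns_unique`).

Liveness. Everything logged by a simulator has been forwarded by it, so whatever reaches one correct
simulator eventually comes from all correct ones, which form a majority. Therefore the owner of the
lock at a correct simulator always finishes `propose` (`propose_terminates`). Then `decide` can only
fail to return when some proposer crashed while its thread for that process was at the head of the
lock queue: otherwise the simulators whose values reach the waiting one form a closed set. A crashed
state is frozen and its queue has a single head, so a crash blocks at most one process
(`Blocked.crashedIn`, `CrashedIn.unique`).

Simulation. Once each object has a unique agreed value, the local history of a simulated process is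
a function of the number of its transitions, independent of the simulator (`matches_simulated`).
Taking for each process the largest number of transitions performed anywhere (`count`) gives a
global configuration that changes by at most one transition at a time; this is the simulated
execution. Correct simulators catch up with every transition (`complete_sn`), and crashes of the
blocked processes are inserted after their counters have stabilised.

Delivery rests on proposing the oldest pending message. If a message to an unblocked process were
never received, then after some time every proposal would come from a list fixed at that time, while
infinitely many distinct messages would be received from it (`eventually_received`). With at most
`t` blocked processes the constructed trace is an execution of the algorithm, and the assumption
that the algorithm solves the task gives the decisions. -/

theorem getElem?_of_prefix {α : Type*} {l l' : List α} (h : l <+: l') {k : ℕ} {a : α}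
    (ha : l[k]? = some a) : l'[k]? = some a := by
  obtain ⟨r, rfl⟩ := h
  obtain ⟨hk, -⟩ := List.getElem?_eq_some_iff.1 ha
  rw [List.getElem?_append_left hk, ha]

section Model

variable {n t : ℕ} {In M S Thr : Type*} {P : Protocol n In M S Thr} {inp : Fin n → In}
  {c c' : Config n M S} {lab : Option (Fin n × Event n Thr)}

theorem Step.crashed_subset (h : Step P inp c lab c') : c.crashed ⊆ c'.crashed := by
  cases h with
  | idle => exact subset_rfl
  | run p ev s out h1 h2 => cases ev <;> exact subset_rfl
  | crash p _ => exact Set.subset_insert _ _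
  | crashInside p => exact Set.subset_insert _ _

theorem Step.chan_prefix (h : Step P inp c lab c') (a b : Fin n) :
    c.chan a b <+: c'.chan a b := by
  cases h with
  | idle => exact List.prefix_rfl
  | run p ev s out h1 h2 =>
    cases ev <;> simp only [Config.mark, Config.send] <;> split_ifs <;> simp
  | crash p _ => exact List.prefix_rfl
  | crashInside p => simp only [Config.send]; split_ifs <;> simp

/-- Between two steps, the local state of `p` changes only if `p` executes a complete step. -/
theorem Step.loc_cases (h : Step P inp c lab c') (p : Fin n) :
    (c'.loc p = c.loc p) ∨
    ∃ ev s out, lab = some (p, ev) ∧ P.effect inp c p ev = some (s, out) ∧ c'.loc p = some s ∧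
      ∀ q, c'.chan p q = c.chan p q ++ out q := by
  cases h with
  | idle => exact .inl rfl
  | run q ev s out h1 h2 =>
    by_cases hp : p = q
    · subst hp
      refine .inr ⟨ev, s, out, rfl, h2, by simp, fun q => ?_⟩
      cases ev <;> simp [Config.mark, Config.send]
    · left; simp [hp]
  | crash q _ => exact .inl rfl
  | crashInside q => exact .inl rfl

/-- Each message of a channel was already there, or was sent by a step of the sender, which is
complete or crashes the sender. -/
theorem Step.chan_cases (h : Step P inp c lab c') {p q : Fin n} {m : M}
    (hm : m ∈ c'.chan p q) :
    m ∈ c.chan p q ∨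
    ∃ ev s out, p ∉ c.crashed ∧ P.effect inp c p ev = some (s, out) ∧ m ∈ out q ∧
      (p ∈ c'.crashed ∨ c'.loc p = some s) := by
  cases h with
  | idle => exact .inl hm
  | run a ev s out h1 h2 =>
    have : m ∈ (c.send a out).chan p q := by cases ev <;> exact hm
    simp only [Config.send] at this
    split_ifs at this with hp
    · subst hp
      rcases List.mem_append.1 this with h | h
      · exact .inl h
      · exact .inr ⟨ev, s, out, h1, h2, h, .inr (by simp)⟩
    · exact .inl this
  | crash a _ => exact .inl hm
  | crashInside a ev s out out' h1 h2 h3 =>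
    simp only [Config.send] at hm
    split_ifs at hm with hp
    · subst hp
      rcases List.mem_append.1 hm with h | h
      · exact .inl h
      · exact .inr ⟨ev, s, out, h1, h2, (h3 q).subset h, .inl (by simp)⟩
    · exact .inl hm

theorem Step.got_cases (h : Step P inp c lab c') {p q : Fin n} {k : ℕ} (hk : k ∈ c'.got q p) :
    k ∈ c.got q p ∨ lab = some (p, .recv q k) := by
  cases h with
  | idle => exact .inl hk
  | run a ev s out h1 h2 =>
    cases ev with
    | start => exact .inl hk
    | tick => exact .inl hk
    | recv b l =>
      simp only [Config.mark, Config.send] at hk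
      split_ifs at hk with hp
      · obtain ⟨rfl, rfl⟩ := hp
        rcases hk with rfl | hk
        · exact .inr rfl
        · exact .inl hk
      · exact .inl hk
  | crash a _ => exact .inl hk
  | crashInside a => exact .inl hk

/-- A labelled step is a complete step of a process. -/
theorem Step.of_label {p : Fin n} {ev : Event n Thr} (h : Step P inp c (some (p, ev)) c') :
    ∃ s out, p ∉ c.crashed ∧ P.effect inp c p ev = some (s, out) ∧ c'.loc p = some s := by
  cases h with
  | run _ _ s out h1 h2 => exact ⟨s, out, h1, h2, by simp⟩

theorem Step.loc_of_crashed (h : Step P inp c lab c') {p : Fin n} (hp : p ∈ c.crashed) :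
    c'.loc p = c.loc p := by
  rcases h.loc_cases p with h1 | ⟨ev, s, out, rfl, -⟩
  · exact h1
  · obtain ⟨_, _, h2, -⟩ := h.of_label
    exact absurd hp h2

variable {e : Trace n M S Thr}

theorem IsExecution.crashed_mono (he : IsExecution P inp t e) {τ τ' : ℕ} (h : τ ≤ τ') :
    (e.cfg τ).crashed ⊆ (e.cfg τ').crashed :=
  monotone_nat_of_le_succ (f := fun τ => (e.cfg τ).crashed)
    (fun τ => (he.step τ).crashed_subset) h

theorem IsExecution.chan_prefix (he : IsExecution P inp t e) {τ τ' : ℕ} (h : τ ≤ τ')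
    (a b : Fin n) : (e.cfg τ).chan a b <+: (e.cfg τ').chan a b := by
  induction h with
  | refl => exact List.prefix_rfl
  | step _ ih => exact ih.trans ((he.step _).chan_prefix a b)

/-- Each message of a channel was sent by a step of its sender. -/
theorem IsExecution.sent (he : IsExecution P inp t e) {τ : ℕ} {p q : Fin n} {m : M}
    (hm : m ∈ (e.cfg τ).chan p q) :
    ∃ u < τ, ∃ ev s out, p ∉ (e.cfg u).crashed ∧ P.effect inp (e.cfg u) p ev = some (s, out) ∧
      m ∈ out q ∧ (p ∈ (e.cfg (u + 1)).crashed ∨ (e.cfg (u + 1)).loc p = some s) := by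
  induction τ with
  | zero => simp [he.init, Config.initial] at hm
  | succ τ ih =>
    rcases (he.step τ).chan_cases hm with h | ⟨ev, s, out, h⟩
    · obtain ⟨u, hu, h⟩ := ih h
      exact ⟨u, by omega, h⟩
    · exact ⟨τ, by omega, ev, s, out, h⟩

/-- A message sent to a correct process is received by it at some time. -/
theorem IsExecution.delivered (he : IsExecution P inp t e) {p q : Fin n} (hp : e.Correct p)
    {τ : ℕ} {m : M} (hm : m ∈ (e.cfg τ).chan q p) :
    ∃ u s r, (e.cfg u).loc p = some s ∧ P.recv p s q m = r ∧ (e.cfg (u + 1)).loc p = some r.1 := by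
  obtain ⟨k, hk, hkm⟩ := List.mem_iff_getElem.1 hm
  obtain ⟨τ', h'⟩ := he.delivers p hp q τ k hk
  -- Positions enter `got` only through a reception step, and `got` is empty at time 0.
  have : ∃ u, e.act u = some (p, .recv q k) := by
    induction τ' with
    | zero => simp [he.init, Config.initial] at h'
    | succ τ' ih =>
      rcases (he.step τ').got_cases h' with h | h
      · exact ih h
      · exact ⟨τ', h⟩
  obtain ⟨u, hu⟩ := this
  have hst := he.step u
  rw [hu] at hst
  obtain ⟨s, out, -, h2, h3⟩ := hst.of_label
  simp only [Protocol.effect] at h2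
  split_ifs at h2
  simp only [Option.bind_eq_some_iff, Option.map_eq_some_iff] at h2
  obtain ⟨s', hs', m', hm', hr⟩ := h2
  -- Channels only grow at the end, so both contents of position `k` can be compared at the later of
  -- the two times.
  have : m' = m := by
    have h1 : ((e.cfg (max u τ)).chan q p)[k]? = some m' :=
      getElem?_of_prefix (he.chan_prefix (le_max_left u τ) q p) hm'
    have h2 : ((e.cfg (max u τ)).chan q p)[k]? = some m :=
      getElem?_of_prefix (he.chan_prefix (le_max_right u τ) q p) (by simp [hk, hkm])
    simpa [h1] using h2
  subst this
  exact ⟨u, s', _, hs', rfl, by rw [h3, hr]⟩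

/-- A correct process executes each of its threads after any time. -/
theorem IsExecution.ticked (he : IsExecution P inp t e) {p : Fin n} (hp : e.Correct p) (θ : Thr)
    (τ : ℕ) : ∃ u ≥ τ, ∃ s, (e.cfg u).loc p = some s ∧
      (e.cfg (u + 1)).loc p = some (P.tick p θ s).1 := by
  obtain ⟨u, hu, ha⟩ := he.fair p hp θ τ
  have hst := he.step u
  rw [ha] at hst
  obtain ⟨s, out, -, h2, h3⟩ := hst.of_label
  simp only [Protocol.effect, Option.map_eq_some_iff] at h2
  obtain ⟨s', hs', hr⟩ := h2
  exact ⟨u, hu, s', hs', by rw [h3, hr]⟩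

end Model

/-! ### Local steps of a simulator -/

section Local

variable {n n' : ℕ} {In Out M S : Type*}

variable {s s' : SimState n n' In Out M S}

/-- Progress of a thread within its current access to a safe agreement object. -/
def PC.rank {V : Type*} : PC n V → ℕ
  | .begin => 0
  | .waitMsg => 0
  | .lock _ => 1
  | .waitValue _ => 2
  -- The cap makes every finished reading phase (`k ≥ n`) have rank exactly `3 + n`: two such states
  -- with equal `sn` must then be the same, which gives uniqueness of views.
  | .reading k _ => 3 + min k n
  | .waitView _ => 4 + n
  | .deciding => 5 + n

/-- From `s` to `s'`, the thread `j` can only go forward. -/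
def Prog (j : Fin n') (s s' : SimState n n' In Out M S) : Prop :=
  s.sn j < s'.sn j ∨ s.sn j = s'.sn j ∧
    (s'.pc j = s.pc j ∨ (s.pc j).rank < (s'.pc j).rank)

theorem Prog.refl (j : Fin n') (s : SimState n n' In Out M S) : Prog j s s :=
  .inr ⟨rfl, .inl rfl⟩

theorem Prog.trans {j : Fin n'} {s₁ s₂ s₃ : SimState n n' In Out M S} (h : Prog j s₁ s₂)
    (h' : Prog j s₂ s₃) : Prog j s₁ s₃ := by
  rcases h with h | ⟨h, h1⟩
  · rcases h' with h' | ⟨h', -⟩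
    · exact .inl (h.trans h')
    · exact .inl (h' ▸ h)
  · rcases h' with h' | ⟨h', h2⟩
    · exact .inl (h ▸ h')
    · refine .inr ⟨h.trans h', ?_⟩
      rcases h1 with h1 | h1 <;> rcases h2 with h2 | h2
      · exact .inl (h2.trans h1)
      · exact .inr (h1 ▸ h2)
      · exact .inr (h2 ▸ h1)
      · exact .inr (h1.trans h2)

theorem Prog.sn_le {j : Fin n'} (h : Prog j s s') : s.sn j ≤ s'.sn j := by
  rcases h with h | ⟨h, -⟩ <;> omega

/-- The queue of the lock contains the threads that are in `propose` or are waiting for the lock,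
and its head is the only one that can be in `propose`. -/
structure QueueInv (s : SimState n n' In Out M S) : Prop where
  nodup : s.queue.Nodup
  mem : ∀ j, j ∈ s.queue ↔ 1 ≤ (s.pc j).rank ∧ (s.pc j).rank ≤ 4 + n
  head : ∀ j, 2 ≤ (s.pc j).rank → (s.pc j).rank ≤ 4 + n → s.queue.head? = some j

/-- Covers the moves inside `propose`: only the owner of the lock makes them, and the queue is
unchanged. -/
theorem QueueInv.goto (h : QueueInv s) {j : Fin n'} {p : PC n (SAVal n' In M)}
    (hj : s.queue.head? = some j) (h1 : 1 ≤ p.rank) (h2 : p.rank ≤ 4 + n) :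
    QueueInv (s.goto j p) := by
  refine ⟨h.nodup, fun a => ?_, fun a h3 h4 => ?_⟩
  · by_cases ha : a = j
    · subst ha
      simp only [SimState.goto, Function.update_self, h1, h2, and_self, iff_true]
      exact List.mem_of_head? hj
    · simpa [SimState.goto, ha] using h.mem a
  · by_cases ha : a = j
    · subst ha; exact hj
    · simp only [SimState.goto, ne_eq, ha, not_false_eq_true, Function.update_of_ne] at h3 h4
      exact h.head a h3 h4

/-- A thread of rank 0 is not queued, so appending it creates no duplicate; an existing head stays
the head. -/
theorem QueueInv.mutexIn (h : QueueInv s) {j : Fin n'} (v : SAVal n' In M)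
    (hj : (s.pc j).rank = 0) : QueueInv (s.mutexIn j v) := by
  have hj' : j ∉ s.queue := fun h' => by have := (h.mem j).1 h'; omega
  refine ⟨?_, fun a => ?_, fun a h3 h4 => ?_⟩
  · simp only [SimState.mutexIn]
    rw [List.nodup_append]
    refine ⟨h.nodup, by simp, ?_⟩
    intro a ha b hb
    obtain rfl : b = j := by simpa using hb
    rintro rfl; exact hj' ha
  · by_cases ha : a = j
    · subst ha; simp [SimState.mutexIn, SimState.goto, PC.rank]; omega
    · simpa [SimState.mutexIn, SimState.goto, ha] using h.mem a
  · by_cases ha : a = j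
    · subst ha; simp [SimState.mutexIn, SimState.goto, PC.rank] at h3
    · simp only [SimState.mutexIn, SimState.goto, ne_eq, ha, not_false_eq_true,
        Function.update_of_ne] at h3 h4 ⊢
      have := h.head a h3 h4
      simp [List.head?_append, this]

/-! ### Server side of a safe agreement object: arrays, logs and majorities. -/

section SA

variable {V : Type*} (a : SAState n V) (src : Fin n) (m : SAMsg n V)

theorem SAState.recv_log : (a.recv src m).1.log = insert (src, m) a.log := by
  simp only [SAState.recv]
  split_ifs <;> cases m <;> rfl

theorem SAState.recv_values (x : Fin n) :
    (a.recv src m).1.values x = a.values x ∨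
      ∃ v, m = .value x v ∧ (a.recv src m).1.values x = some v := by
  simp only [SAState.recv]
  split_ifs
  · exact .inl rfl
  · cases m with
    | value y v =>
      by_cases h : x = y
      · subst h; exact .inr ⟨v, rfl, by simp⟩
      · left; simp [h]
    | read | answer | view => exact .inl rfl

theorem SAState.recv_allViews (x : Fin n) :
    (a.recv src m).1.allViews x = a.allViews x ∨
      ∃ w, m = .view x w ∧ (a.recv src m).1.allViews x = some w := by
  simp only [SAState.recv]
  split_ifs
  · exact .inl rfl
  · cases m with
    | view y v =>
      by_cases h : x = y
      · subst h; exact .inr ⟨v, rfl, by simp⟩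
      · left; simp [h]
    | read | answer | value => exact .inl rfl

/-- The arrays `values` and `allViews` agree with the messages received. -/
structure SAState.Inv (a : SAState n V) : Prop where
  values : ∀ x v, a.values x = some v → ∃ q, (q, .value x v) ∈ a.log
  values_ne : ∀ q x v, (q, .value x v) ∈ a.log → a.values x ≠ none
  views : ∀ x w, a.allViews x = some w → ∃ q, (q, .view x w) ∈ a.log
  views_ne : ∀ q x w, (q, .view x w) ∈ a.log → a.allViews x ≠ none

theorem SAState.Inv.initial : (SAState.initial n V).Inv := by
  constructor <;> simp [SAState.initial]

variable {a} in
theorem SAState.Inv.recv (h : a.Inv) : (a.recv src m).1.Inv := by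
  constructor
  · intro x v hv
    rw [SAState.recv_log]
    rcases a.recv_values src m x with h1 | ⟨u, rfl, h1⟩
    · obtain ⟨q, hq⟩ := h.values x v (h1 ▸ hv)
      exact ⟨q, .inr hq⟩
    · obtain rfl : u = v := by simpa [h1] using hv
      exact ⟨src, .inl rfl⟩
  · intro q x v hq
    rcases a.recv_values src m x with h1 | ⟨u, rfl, h1⟩
    · rw [SAState.recv_log] at hq
      rcases hq with hq | hq
      · obtain ⟨rfl, rfl⟩ := Prod.mk.inj hq
        -- A duplicate changes no array, but its first copy has already filled the entry; a first
        -- copy fills it now.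
        by_cases h2 : ∃ q, (q, .value x v) ∈ a.log
        · obtain ⟨q, hq⟩ := h2
          rw [h1]; exact h.values_ne q x v hq
        · simp [SAState.recv, h2]
      · rw [h1]; exact h.values_ne q x v hq
    · simp [h1]
  · intro x v hv
    rw [SAState.recv_log]
    rcases a.recv_allViews src m x with h1 | ⟨u, rfl, h1⟩
    · obtain ⟨q, hq⟩ := h.views x v (h1 ▸ hv)
      exact ⟨q, .inr hq⟩
    · obtain rfl : u = v := by simpa [h1] using hv
      exact ⟨src, .inl rfl⟩
  · intro q x v hq
    rcases a.recv_allViews src m x with h1 | ⟨u, rfl, h1⟩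
    · rw [SAState.recv_log] at hq
      rcases hq with hq | hq
      · obtain ⟨rfl, rfl⟩ := Prod.mk.inj hq
        by_cases h2 : ∃ q, (q, .view x v) ∈ a.log
        · obtain ⟨q, hq⟩ := h2
          rw [h1]; exact h.views_ne q x v hq
        · simp [SAState.recv, h2]
      · rw [h1]; exact h.views_ne q x v hq
    · simp [h1]

theorem SAState.Majority.mono {a b : SAState n V} (h : a.log ⊆ b.log) {m : SAMsg n V}
    (hm : a.Majority m) : b.Majority m := by
  unfold SAState.Majority at *
  have : {q | (q, m) ∈ a.log}.ncard ≤ {q | (q, m) ∈ b.log}.ncard :=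
    Set.ncard_le_ncard (fun q hq => h hq) (Set.toFinite _)
  omega

theorem SAState.Majority.exists_mem {a : SAState n V} {m : SAMsg n V}
    (hm : a.Majority m) : ∃ q, (q, m) ∈ a.log := by
  by_contra! h
  have : {q | (q, m) ∈ a.log} = ∅ := by ext q; simp [h q]
  simp [SAState.Majority, this] at hm

/-- Two majorities have a common member. -/
theorem SAState.Majority.exists_common {a b : SAState n V} {m m' : SAMsg n V}
    (hm : a.Majority m) (hm' : b.Majority m') : ∃ q, (q, m) ∈ a.log ∧ (q, m') ∈ b.log := by
  by_contra! h
  have hd : Disjoint {q | (q, m) ∈ a.log} {q | (q, m') ∈ b.log} :=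
    Set.disjoint_left.2 fun q h1 h2 => h q h1 h2
  have h1 := Set.ncard_union_eq hd (Set.toFinite _) (Set.toFinite _)
  have h2 := Set.ncard_le_card ({q | (q, m) ∈ a.log} ∪ {q | (q, m') ∈ b.log})
  rw [Nat.card_fin] at h2
  unfold SAState.Majority at *
  omega

end SA

/-- Local steps of the simulator `i` that has started, with the messages that they send;
`C src` is the set of the messages sent to `i` by `src`. -/
inductive LStep [LinearOrder (SAVal n' In M)] (A : Algorithm n' In Out M S) (i : Fin n)
    (C : Fin n → Set (NetMsg n n' In M)) (s : SimState n n' In Out M S) :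
    SimState n n' In Out M S → (Fin n → List (NetMsg n n' In M)) → Prop
  | recv (src : Fin n) (o : Fin n' × ℕ) (m : SAMsg n (SAVal n' In M)) :
      (o, m) ∈ C src →
      LStep A i C s { s with sa := Function.update s.sa o ((s.sa o).recv src m).1 }
        (fun q => (((s.sa o).recv src m).2 q).map fun a => (o, a))
  | stay : LStep A i C s s (fun _ => [])
  | enterInput (j : Fin n') : s.pc j = .begin →
      LStep A i C s (s.mutexIn j (.input (s.input j))) (fun _ => [])
  | enterMsg (j : Fin n') (m : SimMsg n' M) : s.pc j = .waitMsg → s.oldest j = some m →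
      LStep A i C s (s.mutexIn j (.msg m)) (fun _ => [])
  | lock (j : Fin n') (v : SAVal n' In M) : s.pc j = .lock v → s.queue.head? = some j →
      LStep A i C s (s.goto j (.waitValue v)) (fun _ => [((j, s.sn j), .value i v)])
  | waitValue (j : Fin n') (v : SAVal n' In M) : s.pc j = .waitValue v →
      (s.sa (j, s.sn j)).Majority (.value i v) →
      LStep A i C s (s.goto j (.reading 0 fun _ => none))
        (fun _ => (List.finRange n).map fun x => ((j, s.sn j), .read i x))
  | readSome (j : Fin n') (k : ℕ) (w : Fin n → Option (SAVal n' In M)) (hk : k < n)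
      (v : SAVal n' In M) : s.pc j = .reading k w →
      (s.sa (j, s.sn j)).Majority (.value ⟨k, hk⟩ v) →
      LStep A i C s (s.goto j (.reading (k + 1) (Function.update w ⟨k, hk⟩ (some v)))) (fun _ => [])
  | readNone (j : Fin n') (k : ℕ) (w : Fin n → Option (SAVal n' In M)) (hk : k < n) :
      s.pc j = .reading k w → (s.sa (j, s.sn j)).Majority (.answer i ⟨k, hk⟩ none) →
      LStep A i C s (s.goto j (.reading (k + 1) (Function.update w ⟨k, hk⟩ none))) (fun _ => [])
  | readDone (j : Fin n') (k : ℕ) (w : Fin n → Option (SAVal n' In M)) (hk : ¬ k < n) :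
      s.pc j = .reading k w →
      LStep A i C s (s.goto j (.waitView w)) (fun _ => [((j, s.sn j), .view i w)])
  | waitView (j : Fin n') (w : Fin n → Option (SAVal n' In M)) : s.pc j = .waitView w →
      (s.sa (j, s.sn j)).Majority (.view i w) →
      LStep A i C s { s.goto j .deciding with queue := s.queue.tail } (fun _ => [])
  | obtainInput (j : Fin n') (v : In) : s.pc j = .deciding →
      (s.sa (j, s.sn j)).result = some (.input v) →
      LStep A i C s (s.obtain A j (.input v)) (fun _ => [])
  | obtainMsg (j : Fin n') (m : SimMsg n' M) (st : S) : s.pc j = .deciding →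
      (s.sa (j, s.sn j)).result = some (.msg m) → s.state j = some st →
      LStep A i C s (s.obtain A j (.msg m)) (fun _ => [])

variable [LinearOrder (SAVal n' In M)] {A : Algorithm n' In Out M S} {i : Fin n}
  {C : Fin n → Set (NetMsg n n' In M)} {out : Fin n → List (NetMsg n n' In M)}

/-- Replaces the nested case distinctions of the program by a relation in which every constructor
carries the guard that enabled it. -/
theorem lstep_threadStep (A : Algorithm n' In Out M S) (i : Fin n) (j : Fin n')
    (C : Fin n → Set (NetMsg n n' In M)) (s : SimState n n' In Out M S) :
    LStep A i C s (threadStep A i j s).1 (threadStep A i j s).2 := by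
  cases hpc : s.pc j with
  | begin => simp only [threadStep, hpc]; exact .enterInput j hpc
  | waitMsg =>
    cases ho : s.oldest j with
    | none => simp only [threadStep, hpc, ho]; exact .stay
    | some m => simp only [threadStep, hpc, ho]; exact .enterMsg j m hpc ho
  | lock v =>
    simp only [threadStep, hpc]
    split_ifs with h
    · exact .lock j v hpc h
    · exact .stay
  | waitValue v =>
    simp only [threadStep, hpc]
    split_ifs with h
    · exact .waitValue j v hpc h
    · exact .stay
  | reading k w =>
    simp only [threadStep, hpc]
    split_ifs with hk h1 h2
    · exact .readSome j k w hk _ hpc h1.choose_spec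
    · exact .readNone j k w hk hpc h2
    · exact .stay
    · exact .readDone j k w hk hpc
  | waitView w =>
    simp only [threadStep, hpc]
    split_ifs with h
    · exact .waitView j w hpc h
    · exact .stay
  | deciding =>
    cases hr : (s.sa (j, s.sn j)).result with
    | none => simp only [threadStep, hpc, hr]; exact .stay
    | some v =>
      simp only [threadStep, hpc, hr]
      cases v with
      | input v => exact .obtainInput j v hpc hr
      | msg m =>
        cases hs : s.state j with
        -- This case does not arise in executions, since a message is agreed only for `sn > 0`, when
        -- the state is defined; the local relation need not know it.
        | none => simp only [SimState.obtain, hs]; exact .stay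
        | some st => exact .obtainMsg j m st hpc hr hs

/-- Every move of the program counter raises its rank, except the end of `decide`, which resets it
but increments `sn`. -/
theorem LStep.prog (h : LStep A i C s s' out) (a : Fin n') : Prog a s s' := by
  cases h with
  | recv | stay => exact Prog.refl _ _
  | enterInput j hj | enterMsg j _ hj =>
    refine .inr ⟨rfl, ?_⟩
    by_cases ha : a = j
    · subst ha; right; simp [SimState.mutexIn, SimState.goto, hj, PC.rank]
    · left; simp [SimState.mutexIn, SimState.goto, ha]
  | lock j _ hj | waitValue j _ hj | waitView j _ hj | readSome j _ _ _ _ hj | readNone j _ _ _ hj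
  | readDone j _ _ _ hj =>
    refine .inr ⟨rfl, ?_⟩
    by_cases ha : a = j
    · subst ha; right; simp [SimState.goto, hj, PC.rank] <;> omega
    · left; simp [SimState.goto, ha]
  | obtainInput j v hj =>
    by_cases ha : a = j
    · subst ha; left; simp [SimState.obtain, SimState.advance]
    · right; simp [SimState.obtain, SimState.advance, SimState.goto, ha]
  | obtainMsg j m st hj _ hs =>
    by_cases ha : a = j
    · subst ha; left; simp [SimState.obtain, SimState.advance, hs]
    · right; simp [SimState.obtain, SimState.advance, SimState.goto, ha, hs]

theorem LStep.sn_le_succ (h : LStep A i C s s' out) (a : Fin n') : s'.sn a ≤ s.sn a + 1 := by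
  cases h with
  | recv | stay | enterInput | enterMsg | lock | waitValue | waitView | readSome | readNone
  | readDone => exact Nat.le_succ _
  | obtainInput j v hj =>
    by_cases ha : a = j
    · subst ha; simp [SimState.obtain, SimState.advance]
    · simp [SimState.obtain, SimState.advance, SimState.goto, ha]
  | obtainMsg j m st hj _ hs =>
    by_cases ha : a = j
    · subst ha; simp [SimState.obtain, SimState.advance, hs]
    · simp [SimState.obtain, SimState.advance, SimState.goto, ha, hs]

theorem LStep.sent_prefix (h : LStep A i C s s' out) (a : Fin n') : s.sent a <+: s'.sent a := by
  cases h with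
  | recv | stay | enterInput | enterMsg | lock | waitValue | waitView | readSome | readNone
  | readDone => exact List.prefix_rfl
  | obtainInput j v hj => simp [SimState.obtain, SimState.advance]
  | obtainMsg j m st hj _ hs => simp [SimState.obtain, SimState.advance, hs]

/-- A local step does not change the data of the safe agreement objects, or is a reception. -/
theorem LStep.sa_cases (h : LStep A i C s s' out) :
    s'.sa = s.sa ∨ ∃ src o m, (o, m) ∈ C src ∧
      s'.sa = Function.update s.sa o ((s.sa o).recv src m).1 ∧
      out = fun q => (((s.sa o).recv src m).2 q).map fun a => (o, a) := by
  cases h with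
  | recv src o m hC => exact .inr ⟨src, o, m, hC, rfl, rfl⟩
  | stay | enterInput | enterMsg | lock | waitValue | waitView | readSome | readNone
  | readDone => exact .inl rfl
  | obtainInput j v hj => left; simp [SimState.obtain, SimState.advance, SimState.goto]
  | obtainMsg j m st hj _ hs => left; simp [SimState.obtain, SimState.advance, SimState.goto, hs]

theorem LStep.log_subset (h : LStep A i C s s' out) (o : Fin n' × ℕ) :
    (s.sa o).log ⊆ (s'.sa o).log := by
  rcases h.sa_cases with h | ⟨src, o', m, -, h, -⟩
  · rw [h]
  · rw [h]
    by_cases ho : o = o'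
    · subst ho; simp [SAState.recv_log]
    · simp [ho]

theorem LStep.saInv (h : LStep A i C s s' out) (hs : ∀ o, (s.sa o).Inv) (o : Fin n' × ℕ) :
    (s'.sa o).Inv := by
  rcases h.sa_cases with h | ⟨src, o', m, -, h, -⟩
  · rw [h]; exact hs o
  · rw [h]
    by_cases ho : o = o'
    · subst ho; simpa using (hs o).recv src m
    · simpa [ho] using hs o

/-- The delicate case is the release of the lock, where the head leaves the queue as its thread
enters `deciding`. -/
theorem LStep.queueInv (h : LStep A i C s s' out) (hq : QueueInv s) : QueueInv s' := by
  cases h with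
  | recv => exact ⟨hq.nodup, hq.mem, hq.head⟩
  | stay => exact hq
  | enterInput j hj | enterMsg j _ hj => exact hq.mutexIn _ (by simp [hj, PC.rank])
  | lock j _ hj hh =>
    exact hq.goto hh (by simp [PC.rank]) (by simp [PC.rank]; try omega)
  | waitValue j _ hj | readSome j _ _ _ _ hj | readNone j _ _ _ hj
  | readDone j _ _ _ hj =>
    exact hq.goto (hq.head j (by simp [hj, PC.rank]; try omega) (by simp [hj, PC.rank]; try omega))
      (by simp [PC.rank]; try omega) (by simp [PC.rank]; try omega)
  | waitView j _ hj =>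
    have hh := hq.head j (by simp [hj, PC.rank]; omega) (by simp [hj, PC.rank])
    obtain ⟨l, hl⟩ : ∃ l, s.queue = j :: l := by
      cases hl : s.queue with
      | nil => simp [hl] at hh
      | cons a l => exact ⟨l, by simpa [hl] using hh⟩
    have hn := hq.nodup
    rw [hl, List.nodup_cons] at hn
    refine ⟨by simpa [hl] using hn.2, fun a => ?_, fun a h3 h4 => ?_⟩
    · by_cases ha : a = j
      · subst ha; simp [SimState.goto, PC.rank, hl, hn.1]
      · have := hq.mem a
        simpa [SimState.goto, ha, hl] using this
    · by_cases ha : a = j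
      · subst ha; simp [SimState.goto, PC.rank] at h4
      · simp only [SimState.goto, ne_eq, ha, not_false_eq_true,
          Function.update_of_ne] at h3 h4 ⊢
        -- Any other thread inside `propose` would also have been the head, so after the release
        -- there is none.
        have := hq.head a h3 h4
        rw [hh] at this
        exact absurd (Option.some.inj this).symm ha
  | obtainInput j v hj =>
    refine ⟨hq.nodup, fun a => ?_, fun a h3 h4 => ?_⟩
    · by_cases ha : a = j
      · subst ha
        have := hq.mem a
        simp [hj, PC.rank] at this
        simp [SimState.obtain, SimState.advance, SimState.goto, PC.rank, this]
      · have := hq.mem a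
        simpa [SimState.obtain, SimState.advance, SimState.goto, ha] using this
    · by_cases ha : a = j
      · subst ha; simp [SimState.obtain, SimState.advance, SimState.goto, PC.rank] at h3
      · simp only [SimState.obtain, SimState.advance, SimState.goto, ne_eq, ha, not_false_eq_true,
          Function.update_of_ne] at h3 h4 ⊢
        exact hq.head a h3 h4
  | obtainMsg j m st hj _ hs =>
    refine ⟨by simpa [SimState.obtain, SimState.advance, SimState.goto, hs] using hq.nodup,
      fun a => ?_, fun a h3 h4 => ?_⟩
    · by_cases ha : a = j
      · subst ha
        have := hq.mem a
        simp [hj, PC.rank] at this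
        simp [SimState.obtain, SimState.advance, SimState.goto, PC.rank, this, hs]
      · have := hq.mem a
        simpa [SimState.obtain, SimState.advance, SimState.goto, ha, hs] using this
    · by_cases ha : a = j
      · subst ha; simp [SimState.obtain, SimState.advance, SimState.goto, PC.rank, hs] at h3
      · simp only [SimState.obtain, SimState.advance, SimState.goto, ne_eq, ha, not_false_eq_true,
          Function.update_of_ne, hs] at h3 h4 ⊢
        exact hq.head a h3 h4

end Local

/-! ### Invariants of a single thread, and where outgoing messages come from. -/

section LocalInvariants

variable {n n' : ℕ} {In Out M S : Type*}

/-- Invariants of the thread `j` of the simulator `i` with input vector `inp`. -/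
structure ThreadInv (inp : Fin n' → In) (i : Fin n) (s : SimState n n' In Out M S)
    (j : Fin n') : Prop where
  begin : s.pc j = .begin → s.sn j = 0
  waitMsg : s.pc j = .waitMsg → 0 < s.sn j
  input : s.sn j = 0 → s.input j = inp j
  state : s.sn j = 0 ↔ s.state j = none
  lock : ∀ v, s.pc j = .lock v → (s.sn j = 0 ∧ v = .input (inp j)) ∨
    (0 < s.sn j ∧ ∃ m, v = .msg m ∧ s.oldest j = some m)
  reading : ∀ k w, s.pc j = .reading k w → ∀ x : Fin n, x.val < k →
    (∀ v, w x = some v → (s.sa (j, s.sn j)).Majority (.value x v)) ∧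
    (w x = none → (s.sa (j, s.sn j)).Majority (.answer i x none))
  passed : ∀ k, (k < s.sn j ∨ k = s.sn j ∧ 3 ≤ (s.pc j).rank) →
    ∃ v, (s.sa (j, k)).Majority (.value i v)

theorem ThreadInv.initial (input : Fin n' → In) (i : Fin n) (j : Fin n') :
    ThreadInv input i (SimState.initial input : SimState n n' In Out M S) j := by
  constructor <;> simp [SimState.initial, PC.rank]

/-- `find?` scans from the front, so later additions to `sent` do not alter the first hit. This
keeps the proposed message the oldest one while the thread waits for the lock and other threads
append messages. -/
theorem SimState.oldest_of_prefix (s : SimState n n' In Out M S) {s' : SimState n n' In Out M S}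
    {j : Fin n'} {m : SimMsg n' M} (hsent : s.sent j <+: s'.sent j)
    (hrec : s'.received j = s.received j) (h : s.oldest j = some m) : s'.oldest j = some m := by
  obtain ⟨l, hl⟩ := hsent
  simp only [SimState.oldest] at h ⊢
  rw [← hl, hrec, List.find?_append, h, Option.some_or]

/-- Invariants are preserved by changes that do not concern the thread. -/
theorem ThreadInv.of_eq {input : Fin n' → In} {i : Fin n} {s s' : SimState n n' In Out M S}
    {j : Fin n'} (h : ThreadInv input i s j) (hpc : s'.pc j = s.pc j) (hsn : s'.sn j = s.sn j)
    (hin : s'.input j = s.input j) (hst : s'.state j = s.state j)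
    (hrec : s'.received j = s.received j) (hsent : s.sent j <+: s'.sent j)
    (hsa : ∀ o, (s.sa o).log ⊆ (s'.sa o).log) : ThreadInv input i s' j := by
  constructor
  · rw [hpc, hsn]; exact h.begin
  · rw [hpc, hsn]; exact h.waitMsg
  · rw [hin, hsn]; exact h.input
  · rw [hst, hsn]; exact h.state
  · rw [hpc, hsn]
    intro v hv
    rcases h.lock v hv with h1 | ⟨h1, m, h2, h3⟩
    · exact .inl h1
    · exact .inr ⟨h1, m, h2, s.oldest_of_prefix hsent hrec h3⟩
  · rw [hpc, hsn]
    intro k w hw x hx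
    obtain ⟨h1, h2⟩ := h.reading k w hw x hx
    exact ⟨fun v hv => (h1 v hv).mono (hsa _), fun hv => (h2 hv).mono (hsa _)⟩
  · rw [hpc, hsn]
    intro k hk
    obtain ⟨v, hv⟩ := h.passed k hk
    exact ⟨v, hv.mono (hsa _)⟩

theorem SimState.mem_of_oldest {s : SimState n n' In Out M S} {j : Fin n'} {m : SimMsg n' M}
    (h : s.oldest j = some m) :
    m ∈ s.sent j ∧ m ∉ s.received j := by
  unfold SimState.oldest at h
  have h1 := List.find?_some h
  exact ⟨List.mem_of_find?_eq_some h, by simpa using h1⟩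

variable [LinearOrder (SAVal n' In M)] {A : Algorithm n' In Out M S} {i : Fin n}
  {C : Fin n → Set (NetMsg n n' In M)} {s s' : SimState n n' In Out M S}
  {out : Fin n → List (NetMsg n n' In M)}

/-- Threads other than the moving one are covered by `ThreadInv.of_eq`; for the moving one, each
clause is the guard that it has just passed. -/
theorem LStep.threadInv {input : Fin n' → In} (h : LStep A i C s s' out)
    (ht : ∀ j, ThreadInv input i s j) (a : Fin n') : ThreadInv input i s' a := by
  have hsent := h.sent_prefix a
  have hlog := h.log_subset
  cases h with
  | recv => exact (ht a).of_eq rfl rfl rfl rfl rfl hsent hlog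
  | stay => exact ht a
  | enterInput j hj =>
    by_cases ha : a = j
    · subst ha
      have h0 := (ht a).begin hj
      constructor <;> simp [SimState.mutexIn, SimState.goto, PC.rank, h0, (ht a).input h0,
        (ht a).state.1 h0]
    · exact (ht a).of_eq (by simp [SimState.mutexIn, SimState.goto, ha]) rfl rfl rfl rfl hsent hlog
  | enterMsg j m hj hm =>
    by_cases ha : a = j
    · subst ha
      have h0 := (ht a).waitMsg hj
      have h1 := (ht a).passed
      constructor
      · simp [SimState.mutexIn, SimState.goto]
      · simp [SimState.mutexIn, SimState.goto]
      · exact (ht a).input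
      · exact (ht a).state
      · intro v hv
        simp only [SimState.mutexIn, SimState.goto, Function.update_self, PC.lock.injEq] at hv
        exact .inr ⟨h0, m, hv.symm, hm⟩
      · simp [SimState.mutexIn, SimState.goto]
      · intro k hk
        refine h1 k (hk.imp_right fun h => ?_)
        simp [SimState.mutexIn, SimState.goto, PC.rank] at h
    · exact (ht a).of_eq (by simp [SimState.mutexIn, SimState.goto, ha]) rfl rfl rfl rfl hsent hlog
  | lock j v hj =>
    by_cases ha : a = j
    · subst ha
      have h1 := (ht a).passed
      constructor
      · simp [SimState.goto]
      · simp [SimState.goto]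
      · exact (ht a).input
      · exact (ht a).state
      · simp [SimState.goto]
      · simp [SimState.goto]
      · intro k hk
        refine h1 k (hk.imp_right fun h => ?_)
        simp [SimState.goto, PC.rank] at h
    · exact (ht a).of_eq (by simp [SimState.goto, ha]) rfl rfl rfl rfl hsent hlog
  | waitValue j v hj hm =>
    by_cases ha : a = j
    · subst ha
      have h1 := (ht a).passed
      constructor
      · simp [SimState.goto]
      · simp [SimState.goto]
      · exact (ht a).input
      · exact (ht a).state
      · simp [SimState.goto]
      · intro k w hw x hx
        simp only [SimState.goto, Function.update_self, PC.reading.injEq] at hw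
        omega
      · rintro k (hk | ⟨rfl, -⟩)
        · exact h1 k (.inl hk)
        · exact ⟨v, hm⟩
    · exact (ht a).of_eq (by simp [SimState.goto, ha]) rfl rfl rfl rfl hsent hlog
  | readSome j k w hk v hj hm =>
    by_cases ha : a = j
    · subst ha
      have h1 := (ht a).passed
      constructor
      · simp [SimState.goto]
      · simp [SimState.goto]
      · exact (ht a).input
      · exact (ht a).state
      · simp [SimState.goto]
      · intro k' w' hw x hx
        simp only [SimState.goto, Function.update_self, PC.reading.injEq] at hw
        obtain ⟨rfl, rfl⟩ := hw
        by_cases hxk : x = ⟨k, hk⟩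
        · subst hxk
          simp only [Function.update_self, Option.some.injEq, reduceCtorEq, false_implies, and_true]
          rintro _ rfl
          exact hm
        · have : x.val < k := by
            have : x.val ≠ k := fun h => hxk (Fin.ext h)
            omega
          simpa [hxk, SimState.goto] using (ht a).reading k w hj x this
      · rintro k' (hk' | ⟨rfl, -⟩)
        · exact h1 k' (.inl hk')
        · exact h1 _ (.inr ⟨rfl, by simp [hj, PC.rank]⟩)
    · exact (ht a).of_eq (by simp [SimState.goto, ha]) rfl rfl rfl rfl hsent hlog
  | readNone j k w hk hj hm =>
    by_cases ha : a = j
    · subst ha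
      have h1 := (ht a).passed
      constructor
      · simp [SimState.goto]
      · simp [SimState.goto]
      · exact (ht a).input
      · exact (ht a).state
      · simp [SimState.goto]
      · intro k' w' hw x hx
        simp only [SimState.goto, Function.update_self, PC.reading.injEq] at hw
        obtain ⟨rfl, rfl⟩ := hw
        by_cases hxk : x = ⟨k, hk⟩
        · subst hxk
          simp only [Function.update_self, reduceCtorEq, false_implies, implies_true, true_and,
            forall_const]
          exact hm
        · have : x.val < k := by
            have : x.val ≠ k := fun h => hxk (Fin.ext h)
            omega
          simpa [hxk, SimState.goto] using (ht a).reading k w hj x this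
      · rintro k' (hk' | ⟨rfl, -⟩)
        · exact h1 k' (.inl hk')
        · exact h1 _ (.inr ⟨rfl, by simp [hj, PC.rank]⟩)
    · exact (ht a).of_eq (by simp [SimState.goto, ha]) rfl rfl rfl rfl hsent hlog
  | readDone j _ _ _ hj | waitView j _ hj =>
    by_cases ha : a = j
    · subst ha
      have h1 := (ht a).passed
      constructor
      · simp [SimState.goto]
      · simp [SimState.goto]
      · exact (ht a).input
      · exact (ht a).state
      · simp [SimState.goto]
      · simp [SimState.goto]
      · rintro k' (hk' | ⟨rfl, -⟩)
        · exact h1 k' (.inl hk')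
        · exact h1 _ (.inr ⟨rfl, by simp [hj, PC.rank]; try omega⟩)
    · exact (ht a).of_eq (by simp [SimState.goto, ha]) rfl rfl rfl rfl hsent hlog
  | obtainInput j v hj =>
    by_cases ha : a = j
    · subst ha
      have h1 := (ht a).passed
      constructor
      · simp [SimState.obtain, SimState.advance, SimState.goto]
      · simp [SimState.obtain, SimState.advance, SimState.goto]
      · simp [SimState.obtain, SimState.advance, SimState.goto]
      · simp [SimState.obtain, SimState.advance, SimState.goto]
      · simp [SimState.obtain, SimState.advance, SimState.goto]
      · simp [SimState.obtain, SimState.advance, SimState.goto]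
      · intro k hk
        simp only [SimState.obtain, SimState.advance, SimState.goto, Function.update_self,
          PC.rank] at hk ⊢
        -- The object just completed becomes an earlier one; its clause held already, because
        -- `deciding` has rank at least 3.
        rcases Nat.lt_succ_iff_lt_or_eq.1 (show k < s.sn a + 1 by omega) with hk | rfl
        · exact h1 k (.inl hk)
        · exact h1 _ (.inr ⟨rfl, by simp [hj, PC.rank]; omega⟩)
    · refine (ht a).of_eq ?_ ?_ ?_ ?_ rfl hsent hlog <;>
        simp [SimState.obtain, SimState.advance, SimState.goto, ha]
  | obtainMsg j m st hj _ hs =>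
    by_cases ha : a = j
    · subst ha
      have h1 := (ht a).passed
      constructor
      · simp [SimState.obtain, SimState.advance, SimState.goto, hs]
      · simp [SimState.obtain, SimState.advance, SimState.goto, hs]
      · simp [SimState.obtain, SimState.advance, SimState.goto, hs]
      · simp [SimState.obtain, SimState.advance, SimState.goto, hs]
      · simp [SimState.obtain, SimState.advance, SimState.goto, hs]
      · simp [SimState.obtain, SimState.advance, SimState.goto, hs]
      · intro k hk
        simp only [SimState.obtain, SimState.advance, SimState.goto, Function.update_self,
          PC.rank, hs] at hk ⊢
        rcases Nat.lt_succ_iff_lt_or_eq.1 (show k < s.sn a + 1 by omega) with hk | rfl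
        · exact h1 k (.inl hk)
        · exact h1 _ (.inr ⟨rfl, by simp [hj, PC.rank]; omega⟩)
    · refine (ht a).of_eq ?_ ?_ ?_ ?_ ?_ hsent hlog <;>
        simp [SimState.obtain, SimState.advance, SimState.goto, ha, hs]

/-! Messages sent by a local step -/

/-- A value message is either initiated by the owner of the lock or forwarded. In the second case
the forwarder has logged it by the end of the same step, which `value_known` relies on. -/
theorem LStep.out_value (h : LStep A i C s s' out) {o : Fin n' × ℕ} {p x : Fin n}
    {v : SAVal n' In M} (hm : (o, .value x v) ∈ out p) :
    (x = i ∧ s.sn o.1 = o.2 ∧ s.pc o.1 = .lock v ∧ s.queue.head? = some o.1) ∨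
    ∃ src, (o, .value x v) ∈ C src ∧ (src, .value x v) ∈ (s'.sa o).log := by
  cases h with
  | stay | enterInput | enterMsg | readSome | readNone | waitView | obtainInput | obtainMsg =>
    simp at hm
  | waitValue | readDone => simp at hm
  | lock j u hj hq =>
    simp only [List.mem_singleton, Prod.mk.injEq, SAMsg.value.injEq] at hm
    obtain ⟨rfl, rfl, rfl⟩ := hm
    exact .inl ⟨rfl, rfl, hj, hq⟩
  | recv src o' m hC =>
    right
    simp only [List.mem_map, Prod.mk.injEq] at hm
    obtain ⟨a, ha, rfl, rfl⟩ := hm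
    simp only [SAState.recv] at ha
    split_ifs at ha
    · simp at ha
    · cases m <;> simp at ha
      · obtain ⟨rfl, rfl⟩ := ha
        exact ⟨src, hC, by simp [SAState.recv_log]⟩

theorem LStep.out_view (h : LStep A i C s s' out) {o : Fin n' × ℕ} {p x : Fin n}
    {w : Fin n → Option (SAVal n' In M)} (hm : (o, .view x w) ∈ out p) :
    (x = i ∧ s.sn o.1 = o.2 ∧ ∃ k, ¬ k < n ∧ s.pc o.1 = .reading k w) ∨
    ∃ src, (o, .view x w) ∈ C src := by
  cases h with
  | stay | enterInput | enterMsg | readSome | readNone | waitView | obtainInput | obtainMsg =>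
    simp at hm
  | waitValue | lock => simp at hm
  | readDone j k u hk hj =>
    simp only [List.mem_singleton, Prod.mk.injEq, SAMsg.view.injEq] at hm
    obtain ⟨rfl, rfl, rfl⟩ := hm
    exact .inl ⟨rfl, rfl, k, hk, hj⟩
  | recv src o' m hC =>
    right
    simp only [List.mem_map, Prod.mk.injEq] at hm
    obtain ⟨a, ha, rfl, rfl⟩ := hm
    simp only [SAState.recv] at ha
    split_ifs at ha
    · simp at ha
    · cases m <;> simp at ha
      obtain ⟨rfl, rfl⟩ := ha
      exact ⟨src, hC⟩

/-- Reads are never forwarded, so their sender is the reader itself, which has just obtained a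
majority of copies of its own value. -/
theorem LStep.out_read (h : LStep A i C s s' out) {o : Fin n' × ℕ} {p x y : Fin n}
    (hm : (o, .read y x) ∈ out p) :
    y = i ∧ ∃ v, (s.sa o).Majority (.value i v) := by
  cases h with
  | stay | enterInput | enterMsg | readSome | readNone | waitView | obtainInput | obtainMsg =>
    simp at hm
  | readDone | lock => simp at hm
  | waitValue j v hj hq =>
    simp only [List.mem_map, List.mem_finRange, Prod.mk.injEq, SAMsg.read.injEq, true_and] at hm
    obtain ⟨_, rfl, rfl, rfl⟩ := hm
    exact ⟨rfl, v, hq⟩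
  | recv src o' m hC =>
    simp only [List.mem_map, Prod.mk.injEq] at hm
    obtain ⟨a, ha, rfl, rfl⟩ := hm
    simp only [SAState.recv] at ha
    split_ifs at ha
    · simp at ha
    · cases m <;> simp at ha

theorem LStep.out_answer (h : LStep A i C s s' out) {o : Fin n' × ℕ} {p x y : Fin n}
    {w : Option (SAVal n' In M)} (hm : (o, .answer y x w) ∈ out p) :
    (s.sa o).values x = w ∧ ∃ src, (o, .read y x) ∈ C src := by
  cases h with
  | stay | enterInput | enterMsg | readSome | readNone | waitView | obtainInput | obtainMsg =>
    simp at hm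
  | readDone | lock | waitValue => simp at hm
  | recv src o' m hC =>
    simp only [List.mem_map, Prod.mk.injEq] at hm
    obtain ⟨a, ha, rfl, rfl⟩ := hm
    simp only [SAState.recv] at ha
    split_ifs at ha
    · simp at ha
    · cases m <;> simp at ha
      obtain ⟨rfl, rfl, rfl, rfl⟩ := ha
      exact ⟨rfl, src, hC⟩

end LocalInvariants

/-! ### Obligations to forward, answer and broadcast. -/

section LocalOut

variable {n n' : ℕ} {In Out M S : Type*}
variable [LinearOrder (SAVal n' In M)] {A : Algorithm n' In Out M S} {i : Fin n}
  {C : Fin n → Set (NetMsg n n' In M)} {s s' : SimState n n' In Out M S}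
  {out : Fin n → List (NetMsg n n' In M)}

theorem LStep.log_cases (h : LStep A i C s s' out) {o : Fin n' × ℕ} {q : Fin n}
    {m : SAMsg n (SAVal n' In M)} (hm : (q, m) ∈ (s'.sa o).log) :
    (q, m) ∈ (s.sa o).log ∨ (o, m) ∈ C q ∧
      out = fun p => (((s.sa o).recv q m).2 p).map fun a => (o, a) := by
  rcases h.sa_cases with h | ⟨src, o', m', hC, h, hout⟩
  · exact .inl (h ▸ hm)
  · rw [h] at hm
    by_cases ho : o = o'
    · subst ho
      simp only [Function.update_self, SAState.recv_log, Set.mem_insert_iff, Prod.mk.injEq] at hm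
      rcases hm with ⟨rfl, rfl⟩ | hm
      · exact .inr ⟨hC, hout⟩
      · exact .inl hm
    · simp only [ne_eq, ho, not_false_eq_true, Function.update_of_ne] at hm
      exact .inl hm

/-- The first logged copy is forwarded to everyone in the very step that logs it; for later copies
the first one was already in the log. -/
theorem LStep.forward_value (h : LStep A i C s s' out) {o : Fin n' × ℕ} {q x : Fin n}
    {v : SAVal n' In M} (hm : (q, .value x v) ∈ (s'.sa o).log) :
    (∃ q', (q', .value x v) ∈ (s.sa o).log) ∨ ∀ p, (o, .value x v) ∈ out p := by
  rcases h.log_cases hm with h1 | ⟨-, h1⟩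
  · exact .inl ⟨q, h1⟩
  · by_cases hl : ∃ q', (q', .value x v) ∈ (s.sa o).log
    · exact .inl hl
    · right; intro p; simp [h1, SAState.recv, hl]

theorem LStep.forward_view (h : LStep A i C s s' out) {o : Fin n' × ℕ} {q x : Fin n}
    {w : Fin n → Option (SAVal n' In M)} (hm : (q, .view x w) ∈ (s'.sa o).log) :
    (∃ q', (q', .view x w) ∈ (s.sa o).log) ∨ ∀ p, (o, .view x w) ∈ out p := by
  rcases h.log_cases hm with h1 | ⟨-, h1⟩
  · exact .inl ⟨q, h1⟩
  · by_cases hl : ∃ q', (q', .view x w) ∈ (s.sa o).log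
    · exact .inl hl
    · right; intro p; simp [h1, SAState.recv, hl]

theorem LStep.answer_read (h : LStep A i C s s' out) {o : Fin n' × ℕ} {q x y : Fin n}
    (hm : (q, .read y x) ∈ (s'.sa o).log) :
    (∃ q', (q', .read y x) ∈ (s.sa o).log) ∨ (o, .answer y x ((s.sa o).values x)) ∈ out y := by
  rcases h.log_cases hm with h1 | ⟨-, h1⟩
  · exact .inl ⟨q, h1⟩
  · by_cases hl : ∃ q', (q', .read y x) ∈ (s.sa o).log
    · exact .inl hl
    · right; simp [h1, SAState.recv, hl]

/-- The induction step for `broadcast_value`: the phase is either inherited or entered now, and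
entering it sends the message to all. The next lemmas do the same for reads and views. -/
theorem LStep.send_value (h : LStep A i C s s' out) {j : Fin n'} {v : SAVal n' In M}
    (hj : s'.pc j = .waitValue v) :
    (s.pc j = .waitValue v ∧ s'.sn j = s.sn j) ∨ ∀ p, ((j, s'.sn j), .value i v) ∈ out p := by
  cases h with
  | recv | stay => exact .inl ⟨hj, rfl⟩
  | enterInput a ha | enterMsg a _ ha =>
    by_cases hja : j = a
    · subst hja; simp [SimState.mutexIn, SimState.goto] at hj
    · left; simpa [SimState.mutexIn, SimState.goto, hja] using hj
  | lock a u ha =>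
    by_cases hja : j = a
    · subst hja
      right; intro p
      simp only [SimState.goto, Function.update_self, PC.waitValue.injEq] at hj
      simp [SimState.goto, hj]
    · left; simpa [SimState.goto, hja] using hj
  | waitValue a u ha | readSome a _ _ _ _ ha | readNone a _ _ _ ha | readDone a _ _ _ ha
  | waitView a _ ha =>
    by_cases hja : j = a
    · subst hja; simp [SimState.goto] at hj
    · left; simpa [SimState.goto, hja] using hj
  | obtainInput a v ha =>
    by_cases hja : j = a
    · subst hja; simp [SimState.obtain, SimState.advance, SimState.goto] at hj
    · left; simpa [SimState.obtain, SimState.advance, SimState.goto, hja] using hj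
  | obtainMsg a m st ha _ hs =>
    by_cases hja : j = a
    · subst hja; simp [SimState.obtain, SimState.advance, SimState.goto, hs] at hj
    · left; simpa [SimState.obtain, SimState.advance, SimState.goto, hja, hs] using hj

theorem LStep.send_read (h : LStep A i C s s' out) {j : Fin n'} {k : ℕ}
    {w : Fin n → Option (SAVal n' In M)} (hj : s'.pc j = .reading k w) :
    ((∃ k' w', s.pc j = .reading k' w') ∧ s'.sn j = s.sn j) ∨
      ∀ x p, ((j, s'.sn j), .read i x) ∈ out p := by
  cases h with
  | recv | stay => exact .inl ⟨⟨k, w, hj⟩, rfl⟩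
  | enterInput a ha | enterMsg a _ ha =>
    by_cases hja : j = a
    · subst hja; simp [SimState.mutexIn, SimState.goto] at hj
    · left; simp only [SimState.mutexIn, SimState.goto, ne_eq, hja, not_false_eq_true,
        Function.update_of_ne] at hj ⊢
      exact ⟨⟨k, w, hj⟩, trivial⟩
  | waitValue a u ha =>
    by_cases hja : j = a
    · subst hja
      right; intro x p
      simp [SimState.goto]
    · left; simp only [SimState.goto, ne_eq, hja, not_false_eq_true,
        Function.update_of_ne] at hj ⊢
      exact ⟨⟨k, w, hj⟩, trivial⟩
  | readSome a _ _ _ _ ha | readNone a _ _ _ ha =>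
    by_cases hja : j = a
    · subst hja; exact .inl ⟨⟨_, _, ha⟩, rfl⟩
    · left; simp only [SimState.goto, ne_eq, hja, not_false_eq_true,
        Function.update_of_ne] at hj ⊢
      exact ⟨⟨k, w, hj⟩, trivial⟩
  | lock a u ha | readDone a _ _ _ ha | waitView a _ ha =>
    by_cases hja : j = a
    · subst hja; simp [SimState.goto] at hj
    · left; simp only [SimState.goto, ne_eq, hja, not_false_eq_true,
        Function.update_of_ne] at hj ⊢
      exact ⟨⟨k, w, hj⟩, trivial⟩
  | obtainInput a v ha =>
    by_cases hja : j = a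
    · subst hja; simp [SimState.obtain, SimState.advance, SimState.goto] at hj
    · left; simp only [SimState.obtain, SimState.advance, SimState.goto, ne_eq, hja,
        not_false_eq_true, Function.update_of_ne] at hj ⊢
      exact ⟨⟨k, w, hj⟩, trivial⟩
  | obtainMsg a m st ha _ hs =>
    by_cases hja : j = a
    · subst hja; simp [SimState.obtain, SimState.advance, SimState.goto, hs] at hj
    · left; simp only [SimState.obtain, SimState.advance, SimState.goto, ne_eq, hja, hs,
        not_false_eq_true, Function.update_of_ne] at hj ⊢
      exact ⟨⟨k, w, hj⟩, trivial⟩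

theorem LStep.send_waitView (h : LStep A i C s s' out) {j : Fin n'}
    {w : Fin n → Option (SAVal n' In M)} (hj : s'.pc j = .waitView w) :
    (s.pc j = .waitView w ∧ s'.sn j = s.sn j) ∨ ∀ p, ((j, s'.sn j), .view i w) ∈ out p := by
  cases h with
  | recv | stay => exact .inl ⟨hj, rfl⟩
  | enterInput a ha | enterMsg a _ ha =>
    by_cases hja : j = a
    · subst hja; simp [SimState.mutexIn, SimState.goto] at hj
    · left; simpa [SimState.mutexIn, SimState.goto, hja] using hj
  | readDone a _ u _ ha =>
    by_cases hja : j = a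
    · subst hja
      right; intro p
      simp only [SimState.goto, Function.update_self, PC.waitView.injEq] at hj
      simp [SimState.goto, hj]
    · left; simpa [SimState.goto, hja] using hj
  | waitValue a u ha | readSome a _ _ _ _ ha | readNone a _ _ _ ha | lock a _ ha
  | waitView a _ ha =>
    by_cases hja : j = a
    · subst hja; simp [SimState.goto] at hj
    · left; simpa [SimState.goto, hja] using hj
  | obtainInput a v ha =>
    by_cases hja : j = a
    · subst hja; simp [SimState.obtain, SimState.advance, SimState.goto] at hj
    · left; simpa [SimState.obtain, SimState.advance, SimState.goto, hja] using hj
  | obtainMsg a m st ha _ hs =>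
    by_cases hja : j = a
    · subst hja; simp [SimState.obtain, SimState.advance, SimState.goto, hs] at hj
    · left; simpa [SimState.obtain, SimState.advance, SimState.goto, hja, hs] using hj

/-- In the state `s` the view for the object `o` has been broadcast. -/
def Viewed (s : SimState n n' In Out M S) (o : Fin n' × ℕ) : Prop :=
  o.2 < s.sn o.1 ∨ o.2 = s.sn o.1 ∧ 4 + n ≤ (s.pc o.1).rank

theorem LStep.send_view (h : LStep A i C s s' out) {o : Fin n' × ℕ} (hj : Viewed s' o) :
    Viewed s o ∨ ∃ w, ∀ p, (o, .view i w) ∈ out p := by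
  obtain ⟨j, k⟩ := o
  simp only [Viewed] at hj ⊢
  cases h with
  | recv | stay => exact .inl hj
  | enterInput a ha | enterMsg a _ ha =>
    left
    by_cases hja : j = a
    · subst hja
      simp only [SimState.mutexIn, SimState.goto, Function.update_self, PC.rank] at hj
      omega
    · simpa [SimState.mutexIn, SimState.goto, hja] using hj
  | readDone a _ u _ ha =>
    by_cases hja : j = a
    · subst hja
      rcases hj with hj | ⟨rfl, hj⟩
      · exact .inl (.inl hj)
      · right; exact ⟨u, fun p => by simp [SimState.goto]⟩
    · left; simpa [SimState.goto, hja] using hj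
  | waitValue a u ha | readSome a _ _ _ _ ha | readNone a _ _ _ ha | lock a _ ha
  | waitView a _ ha =>
    left
    by_cases hja : j = a
    · subst hja
      simp only [SimState.goto, Function.update_self, PC.rank, ha] at hj ⊢
      omega
    · simpa [SimState.goto, hja] using hj
  | obtainInput a v ha =>
    left
    by_cases hja : j = a
    · subst hja
      simp only [SimState.obtain, SimState.advance, SimState.goto, Function.update_self, PC.rank,
        ha] at hj ⊢
      omega
    · simpa [SimState.obtain, SimState.advance, SimState.goto, hja] using hj
  | obtainMsg a m st ha _ hs =>
    left
    by_cases hja : j = a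
    · subst hja
      simp only [SimState.obtain, SimState.advance, SimState.goto, Function.update_self, PC.rank,
        ha, hs] at hj ⊢
      omega
    · simpa [SimState.obtain, SimState.advance, SimState.goto, hja, hs] using hj

end LocalOut

/-! ### Executions of the simulation -/

/-- The messages sent to `i` by each process. -/
def Config.inbox {n : ℕ} {M S : Type*} (c : Config n M S) (i : Fin n) : Fin n → Set M :=
  fun src => {m | m ∈ c.chan src i}

/-- What a simulator knows in state `s` is known in state `s'`. -/
structure Later {n n' : ℕ} {In Out M S : Type*} (s s' : SimState n n' In Out M S) : Prop where
  prog : ∀ j, Prog j s s'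
  sent : ∀ x, s.sent x <+: s'.sent x
  log : ∀ o, (s.sa o).log ⊆ (s'.sa o).log

theorem Later.refl {n n' : ℕ} {In Out M S : Type*} (s : SimState n n' In Out M S) : Later s s :=
  ⟨fun j => Prog.refl j s, fun _ => List.prefix_rfl, fun _ => subset_rfl⟩

section Exec

variable {n n' t : ℕ} {In Out M S : Type*} [LinearOrder (SAVal n' In M)]
  {A : Algorithm n' In Out M S} {inp : Fin n → Fin n' → In} {e : SimTrace n n' In Out M S}
  {i : Fin n} {τ τ' : ℕ} {s s' : SimState n n' In Out M S}

/-- Passes from global protocol steps to the local relation: apart from the start, every possible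
step of a simulator is an `LStep`. -/
theorem effect_cases {c : Config n (NetMsg n n' In M) (SimState n n' In Out M S)} {p : Fin n}
    {ev : Event n (Fin n')} {out : Fin n → List (NetMsg n n' In M)}
    (h : (simulation n A).effect inp c p ev = some (s', out)) :
    (c.loc p = none ∧ s' = SimState.initial (inp p) ∧ out = fun _ => []) ∨
      ∃ s, c.loc p = some s ∧ LStep A p (c.inbox p) s s' out := by
  cases ev with
  | start =>
    simp only [Protocol.effect] at h
    split_ifs at h with h1
    simp only [simulation, Option.some.injEq, Prod.mk.injEq] at h
    exact .inl ⟨h1, h.1.symm, h.2.symm⟩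
  | recv q k =>
    simp only [Protocol.effect] at h
    split_ifs at h with h1
    simp only [Option.bind_eq_some_iff, Option.map_eq_some_iff] at h
    obtain ⟨s, hs, m, hm, h⟩ := h
    right
    refine ⟨s, hs, ?_⟩
    simp only [simulation, Prod.mk.injEq] at h
    obtain ⟨rfl, rfl⟩ := h
    exact .recv q m.1 m.2 (List.mem_of_getElem? hm)
  | tick θ =>
    simp only [Protocol.effect, Option.map_eq_some_iff] at h
    obtain ⟨s, hs, h⟩ := h
    right
    refine ⟨s, hs, ?_⟩
    have := lstep_threadStep A p θ (c.inbox p) s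
    simp only [simulation] at h
    rwa [h] at this

theorem loc_step (he : IsExecution (simulation n A) inp t e) (τ : ℕ) (i : Fin n) :
    (e.cfg (τ + 1)).loc i = (e.cfg τ).loc i ∨
    ((e.cfg τ).loc i = none ∧ (e.cfg (τ + 1)).loc i = some (SimState.initial (inp i))) ∨
    ∃ s s' out, (e.cfg τ).loc i = some s ∧ (e.cfg (τ + 1)).loc i = some s' ∧
      LStep A i ((e.cfg τ).inbox i) s s' out ∧
      ∀ p, (e.cfg (τ + 1)).chan i p = (e.cfg τ).chan i p ++ out p := by
  rcases (he.step τ).loc_cases i with h | ⟨ev, s', out, -, h1, h2, h3⟩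
  · exact .inl h
  · rcases effect_cases h1 with ⟨h4, rfl, rfl⟩ | ⟨s, hs, h4⟩
    · exact .inr (.inl ⟨h4, h2⟩)
    · exact .inr (.inr ⟨s, s', out, hs, h2, h4, h3⟩)

/-- Each message was sent by a local step of a simulator. -/
theorem sent_lstep (he : IsExecution (simulation n A) inp t e) {q p : Fin n}
    {m : NetMsg n n' In M} (hm : m ∈ (e.cfg τ).chan q p) :
    ∃ u < τ, ∃ s s' out, q ∉ (e.cfg u).crashed ∧ (e.cfg u).loc q = some s ∧
      LStep A q ((e.cfg u).inbox q) s s' out ∧ m ∈ out p ∧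
      (q ∈ (e.cfg (u + 1)).crashed ∨ (e.cfg (u + 1)).loc q = some s') := by
  obtain ⟨u, hu, ev, s', out, h1, h2, h3, h4⟩ := he.sent hm
  rcases effect_cases h2 with ⟨-, -, rfl⟩ | ⟨s, hs, h5⟩
  · simp at h3
  · exact ⟨u, hu, s, s', out, h1, hs, h5, h3, h4⟩

theorem later_of_le (he : IsExecution (simulation n A) inp t e) (h : τ ≤ τ')
    (hs : (e.cfg τ).loc i = some s) : ∃ s', (e.cfg τ').loc i = some s' ∧ Later s s' := by
  induction h with
  | refl => exact ⟨s, hs, .refl s⟩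
  | @step u _ ih =>
    obtain ⟨s₁, h1, h2⟩ := ih
    rcases loc_step he u i with h | ⟨h, -⟩ | ⟨a, b, out, h3, h4, h5, -⟩
    · exact ⟨s₁, h.trans h1, h2⟩
    · rw [h] at h1; simp at h1
    · obtain rfl : a = s₁ := by simpa [h3] using h1
      exact ⟨b, h4, fun j => (h2.prog j).trans (h5.prog j),
        fun x => (h2.sent x).trans (h5.sent_prefix x),
        fun o => (h2.log o).trans (h5.log_subset o)⟩

theorem later_of_le' (he : IsExecution (simulation n A) inp t e) (h : τ ≤ τ')
    (hs : (e.cfg τ).loc i = some s) (hs' : (e.cfg τ').loc i = some s') : Later s s' := by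
  obtain ⟨s₁, h1, h2⟩ := later_of_le he h hs
  obtain rfl : s₁ = s' := by simpa [h1] using hs'
  exact h2

/-- Invariants of the local states and of the messages sent. -/
theorem local_inv (he : IsExecution (simulation n A) inp t e) (i : Fin n)
    (Φ : SimState n n' In Out M S → (Fin n → Set (NetMsg n n' In M)) →
      (Fin n → Set (NetMsg n n' In M)) → Prop)
    (h0 : ∀ C D, Φ (SimState.initial (inp i)) C D)
    (hstep : ∀ s s' C C' D D' out, Φ s C D → LStep A i C s s' out → (∀ p, C p ⊆ C' p) →
      (∀ p, D p ⊆ D' p) → (∀ p, ∀ m ∈ out p, m ∈ D' p) → Φ s' C' D') :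
    ∀ {τ s}, (e.cfg τ).loc i = some s →
      Φ s ((e.cfg τ).inbox i) (fun p => {m | m ∈ (e.cfg τ).chan i p}) := by
  intro τ
  induction τ with
  | zero => intro s hs; simp [he.init, Config.initial] at hs
  | succ τ ih =>
    intro s' hs'
    have hC : ∀ p, (e.cfg τ).inbox i p ⊆ (e.cfg (τ + 1)).inbox i p :=
      fun p m hm => ((he.step τ).chan_prefix p i).subset hm
    have hD : ∀ p, {m | m ∈ (e.cfg τ).chan i p} ⊆ {m | m ∈ (e.cfg (τ + 1)).chan i p} :=
      fun p m hm => ((he.step τ).chan_prefix i p).subset hm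
    rcases loc_step he τ i with h | ⟨-, h⟩ | ⟨a, b, out, h3, h4, h5, h6⟩
    -- When the local state is unchanged only the channels may have grown, which a `stay` step
    -- accounts for.
    · exact hstep s' s' _ _ _ _ _ (ih (h ▸ hs')) .stay hC hD (by simp)
    · obtain rfl : SimState.initial (inp i) = s' := by simpa [h] using hs'
      exact h0 _ _
    · obtain rfl : b = s' := by simpa [h4] using hs'
      refine hstep a b _ _ _ _ out (ih h3) h5 hC hD fun p m hm => ?_
      simp [h6 p, hm]

theorem saInv (he : IsExecution (simulation n A) inp t e) (hs : (e.cfg τ).loc i = some s)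
    (o : Fin n' × ℕ) : (s.sa o).Inv :=
  local_inv he i (fun s _ _ => ∀ o, (s.sa o).Inv) (fun _ _ _ => SAState.Inv.initial)
    (fun _ _ _ _ _ _ _ h hl _ _ _ => hl.saInv h) hs o

theorem queueInv (he : IsExecution (simulation n A) inp t e) (hs : (e.cfg τ).loc i = some s) :
    QueueInv s :=
  local_inv he i (fun s _ _ => QueueInv s)
    (fun _ _ => by constructor <;> simp [SimState.initial, PC.rank])
    (fun _ _ _ _ _ _ _ h hl _ _ _ => hl.queueInv h) hs

theorem threadInv (he : IsExecution (simulation n A) inp t e) (hs : (e.cfg τ).loc i = some s)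
    (j : Fin n') : ThreadInv (inp i) i s j :=
  local_inv he i (fun s _ _ => ∀ j, ThreadInv (inp i) i s j)
    (fun _ _ j => ThreadInv.initial _ _ j)
    (fun _ _ _ _ _ _ _ h hl _ _ _ => hl.threadInv h) hs j

theorem mem_chan_of_log (he : IsExecution (simulation n A) inp t e)
    (hs : (e.cfg τ).loc i = some s) {o : Fin n' × ℕ} {q : Fin n} {m : SAMsg n (SAVal n' In M)}
    (hm : (q, m) ∈ (s.sa o).log) : (o, m) ∈ (e.cfg τ).chan q i := by
  refine local_inv he i (fun s C _ => ∀ o q m, (q, m) ∈ (s.sa o).log → (o, m) ∈ C q) ?_ ?_ hs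
    o q m hm
  · intro C D o q m h; simp [SimState.initial, SAState.initial] at h
  · intro s s' C C' D D' out h hl hC _ _ o q m hm
    rcases hl.log_cases hm with h1 | ⟨h1, -⟩
    · exact hC _ (h o q m h1)
    · exact hC _ h1

/-- The reliable broadcast property: whoever has logged a value has already put it in all its
outgoing channels, even if it crashes later. -/
theorem forwarded_value (he : IsExecution (simulation n A) inp t e)
    (hs : (e.cfg τ).loc i = some s) {o : Fin n' × ℕ} {q x : Fin n} {v : SAVal n' In M}
    (hm : (q, .value x v) ∈ (s.sa o).log) (p : Fin n) :
    (o, .value x v) ∈ (e.cfg τ).chan i p := by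
  refine local_inv he i (fun s _ D => ∀ q, (q, .value x v) ∈ (s.sa o).log →
    ∀ p, (o, .value x v) ∈ D p) ?_ ?_ hs q hm p
  · intro C D q h; simp [SimState.initial, SAState.initial] at h
  · intro s s' C C' D D' out h hl _ hD hout q hm p
    rcases hl.forward_value hm with ⟨q', h1⟩ | h1
    · exact hD _ (h q' h1 p)
    · exact hout _ _ (h1 p)

theorem forwarded_view (he : IsExecution (simulation n A) inp t e)
    (hs : (e.cfg τ).loc i = some s) {o : Fin n' × ℕ} {q x : Fin n}
    {w : Fin n → Option (SAVal n' In M)}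
    (hm : (q, .view x w) ∈ (s.sa o).log) (p : Fin n) :
    (o, .view x w) ∈ (e.cfg τ).chan i p := by
  refine local_inv he i (fun s _ D => ∀ q, (q, .view x w) ∈ (s.sa o).log →
    ∀ p, (o, .view x w) ∈ D p) ?_ ?_ hs q hm p
  · intro C D q h; simp [SimState.initial, SAState.initial] at h
  · intro s s' C C' D D' out h hl _ hD hout q hm p
    rcases hl.forward_view hm with ⟨q', h1⟩ | h1
    · exact hD _ (h q' h1 p)
    · exact hout _ _ (h1 p)

/-- The answer reports the array entry at the first reception of the read; if it is not `⊥`, a value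
message for `x` was logged before. -/
theorem answered_read (he : IsExecution (simulation n A) inp t e)
    (hs : (e.cfg τ).loc i = some s) {o : Fin n' × ℕ} {q x y : Fin n}
    (hm : (q, .read y x) ∈ (s.sa o).log) :
    (o, .answer y x none) ∈ (e.cfg τ).chan i y ∨ ∃ q v, (q, .value x v) ∈ (s.sa o).log := by
  refine (local_inv he i (fun s _ D => (∀ o, (s.sa o).Inv) ∧ ∀ q, (q, .read y x) ∈ (s.sa o).log →
    (o, .answer y x none) ∈ D y ∨ ∃ q v, (q, .value x v) ∈ (s.sa o).log) ?_ ?_ hs).2 q hm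
  · refine fun C D => ⟨fun _ => SAState.Inv.initial, fun q h => ?_⟩
    simp [SimState.initial, SAState.initial] at h
  · intro s s' C C' D D' out h hl _ hD hout
    refine ⟨hl.saInv h.1, fun q hm => ?_⟩
    rcases hl.answer_read hm with ⟨q', h1⟩ | h1
    · rcases h.2 q' h1 with h1 | ⟨q, v, h1⟩
      · exact .inl (hD _ h1)
      · exact .inr ⟨q, v, hl.log_subset o h1⟩
    · cases hv : (s.sa o).values x with
      | none => exact .inl (hout _ _ (hv ▸ h1))
      | some v =>
        obtain ⟨q, hq⟩ := (h.1 o).values x v hv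
        exact .inr ⟨q, v, hl.log_subset o hq⟩

theorem broadcast_value (he : IsExecution (simulation n A) inp t e)
    (hs : (e.cfg τ).loc i = some s) {j : Fin n'} {v : SAVal n' In M}
    (hj : s.pc j = .waitValue v) (p : Fin n) :
    ((j, s.sn j), .value i v) ∈ (e.cfg τ).chan i p := by
  refine local_inv he i (fun s _ D => s.pc j = .waitValue v →
    ∀ p, ((j, s.sn j), .value i v) ∈ D p) ?_ ?_ hs hj p
  · intro C D h; simp [SimState.initial] at h
  · intro s s' C C' D D' out h hl _ hD hout hj p
    rcases hl.send_value hj with ⟨h1, h2⟩ | h1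
    · rw [h2]; exact hD _ (h h1 p)
    · exact hout _ _ (h1 p)

theorem broadcast_read (he : IsExecution (simulation n A) inp t e)
    (hs : (e.cfg τ).loc i = some s) {j : Fin n'} {k : ℕ} {w : Fin n → Option (SAVal n' In M)}
    (hj : s.pc j = .reading k w) (x p : Fin n) :
    ((j, s.sn j), .read i x) ∈ (e.cfg τ).chan i p := by
  refine local_inv he i (fun s _ D => ∀ k w, s.pc j = .reading k w →
    ∀ x p, ((j, s.sn j), .read i x) ∈ D p) ?_ ?_ hs k w hj x p
  · intro C D k w h; simp [SimState.initial] at h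
  · intro s s' C C' D D' out h hl _ hD hout k w hj x p
    rcases hl.send_read hj with ⟨⟨k', w', h1⟩, h2⟩ | h1
    · rw [h2]; exact hD _ (h k' w' h1 x p)
    · exact hout _ _ (h1 x p)

theorem broadcast_waitView (he : IsExecution (simulation n A) inp t e)
    (hs : (e.cfg τ).loc i = some s) {j : Fin n'} {w : Fin n → Option (SAVal n' In M)}
    (hj : s.pc j = .waitView w) (p : Fin n) :
    ((j, s.sn j), .view i w) ∈ (e.cfg τ).chan i p := by
  refine local_inv he i (fun s _ D => s.pc j = .waitView w →
    ∀ p, ((j, s.sn j), .view i w) ∈ D p) ?_ ?_ hs hj p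
  · intro C D h; simp [SimState.initial] at h
  · intro s s' C C' D D' out h hl _ hD hout hj p
    rcases hl.send_waitView hj with ⟨h1, h2⟩ | h1
    · rw [h2]; exact hD _ (h h1 p)
    · exact hout _ _ (h1 p)

theorem broadcast_view (he : IsExecution (simulation n A) inp t e)
    (hs : (e.cfg τ).loc i = some s) {o : Fin n' × ℕ} (ho : Viewed s o) :
    ∃ w, ∀ p, (o, .view i w) ∈ (e.cfg τ).chan i p := by
  refine local_inv he i (fun s _ D => Viewed s o → ∃ w, ∀ p, (o, .view i w) ∈ D p) ?_ ?_ hs ho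
  · intro C D h; simp [SimState.initial, Viewed, PC.rank] at h
  · intro s s' C C' D D' out h hl _ hD hout ho
    rcases hl.send_view ho with h1 | ⟨w, h1⟩
    · obtain ⟨w, h1⟩ := h h1
      exact ⟨w, fun p => hD _ (h1 p)⟩
    · exact ⟨w, fun p => hout _ _ (h1 p)⟩

end Exec

/-! ### Safe agreement: agreement and validity -/

section Agreement

variable {n n' t : ℕ} {In Out M S : Type*}

/-- Before time `τ`, the simulator `x` was about to propose `v` to the object `o`. -/
def Proposed (e : SimTrace n n' In Out M S) (o : Fin n' × ℕ) (x : Fin n) (v : SAVal n' In M)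
    (τ : ℕ) : Prop :=
  ∃ u < τ, ∃ s, (e.cfg u).loc x = some s ∧ s.sn o.1 = o.2 ∧ s.pc o.1 = .lock v ∧
    s.queue.head? = some o.1

/-- Before time `τ`, the simulator `x` was about to broadcast the view `w` for the object `o`. -/
def ProposedView (e : SimTrace n n' In Out M S) (o : Fin n' × ℕ) (x : Fin n)
    (w : Fin n → Option (SAVal n' In M)) (τ : ℕ) : Prop :=
  ∃ u < τ, ∃ s k, (e.cfg u).loc x = some s ∧ s.sn o.1 = o.2 ∧ ¬ k < n ∧ s.pc o.1 = .reading k w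

variable [LinearOrder (SAVal n' In M)]
  {A : Algorithm n' In Out M S} {inp : Fin n → Fin n' → In} {e : SimTrace n n' In Out M S}
  {i : Fin n} {τ τ' : ℕ} {s s' : SimState n n' In Out M S} {o : Fin n' × ℕ} {x y p q : Fin n}
  {v v' : SAVal n' In M} {w w' : Fin n → Option (SAVal n' In M)}

/-- A forwarded copy comes from a strictly earlier one, so strong induction on time ends at the
proposer. The same argument traces views. -/
theorem value_origin (he : IsExecution (simulation n A) inp t e)
    (hm : (o, .value x v) ∈ (e.cfg τ).chan q p) : Proposed e o x v τ := by
  induction τ using Nat.strong_induction_on generalizing q p with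
  | _ τ ih =>
    obtain ⟨u, hu, s, s', out, -, hs, hl, hout, -⟩ := sent_lstep he hm
    rcases hl.out_value hout with ⟨rfl, h⟩ | ⟨src, h, -⟩
    · exact ⟨u, hu, s, hs, h⟩
    · obtain ⟨u', hu', h⟩ := ih u hu h
      exact ⟨u', by omega, h⟩

theorem view_origin (he : IsExecution (simulation n A) inp t e)
    (hm : (o, .view x w) ∈ (e.cfg τ).chan q p) : ProposedView e o x w τ := by
  induction τ using Nat.strong_induction_on generalizing q p with
  | _ τ ih =>
    obtain ⟨u, hu, s, s', out, -, hs, hl, hout, -⟩ := sent_lstep he hm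
    rcases hl.out_view hout with ⟨rfl, h1, k, h2, h3⟩ | ⟨src, h⟩
    · exact ⟨u, hu, s, k, hs, h1, h2, h3⟩
    · obtain ⟨u', hu', h⟩ := ih u hu h
      exact ⟨u', by omega, h⟩

/-- At both times the thread is in the same access and has rank 1; a thread that only moves forward
has then not moved at all, so its proposed value is the same. -/
theorem Proposed.unique (he : IsExecution (simulation n A) inp t e) (h : Proposed e o x v τ)
    (h' : Proposed e o x v' τ') : v = v' := by
  obtain ⟨u, -, s, hs, h1, h2, -⟩ := h
  obtain ⟨u', -, s', hs', h1', h2', -⟩ := h'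
  rcases le_total u u' with hu | hu
  · rcases (later_of_le' he hu hs hs').prog o.1 with h | ⟨-, h | h⟩
    · omega
    · rw [h2, h2'] at h; exact (PC.lock.inj h).symm
    · simp [h2, h2', PC.rank] at h
  · rcases (later_of_le' he hu hs' hs).prog o.1 with h | ⟨-, h | h⟩
    · omega
    · rw [h2, h2'] at h; exact PC.lock.inj h
    · simp [h2, h2', PC.rank] at h

theorem ProposedView.unique (he : IsExecution (simulation n A) inp t e)
    (h : ProposedView e o x w τ) (h' : ProposedView e o x w' τ') : w = w' := by
  obtain ⟨u, -, s, k, hs, h1, hk, h2⟩ := h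
  obtain ⟨u', -, s', k', hs', h1', hk', h2'⟩ := h'
  rcases le_total u u' with hu | hu
  · rcases (later_of_le' he hu hs hs').prog o.1 with h | ⟨-, h | h⟩
    · omega
    · rw [h2, h2'] at h; exact (PC.reading.inj h).2.symm
    · simp only [h2, h2', PC.rank] at h; omega
  · rcases (later_of_le' he hu hs' hs).prog o.1 with h | ⟨-, h | h⟩
    · omega
    · rw [h2, h2'] at h; exact (PC.reading.inj h).2
    · simp only [h2, h2', PC.rank] at h; omega

theorem proposed_of_log (he : IsExecution (simulation n A) inp t e)
    (hs : (e.cfg τ).loc i = some s) (h : (q, .value x v) ∈ (s.sa o).log) : Proposed e o x v τ :=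
  value_origin he (mem_chan_of_log he hs h)

theorem proposed_of_values (he : IsExecution (simulation n A) inp t e)
    (hs : (e.cfg τ).loc i = some s) (h : (s.sa o).values x = some v) : Proposed e o x v τ := by
  obtain ⟨q, hq⟩ := (saInv he hs o).values x v h
  exact proposed_of_log he hs hq

theorem proposedView_of_views (he : IsExecution (simulation n A) inp t e)
    (hs : (e.cfg τ).loc i = some s) (h : (s.sa o).allViews x = some w) :
    ProposedView e o x w τ := by
  obtain ⟨q, hq⟩ := (saInv he hs o).views x w h
  exact view_origin he (mem_chan_of_log he hs hq)

theorem read_origin (he : IsExecution (simulation n A) inp t e)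
    (hm : (o, .read y x) ∈ (e.cfg τ).chan q p) :
    ∃ u < τ, ∃ s v, (e.cfg u).loc y = some s ∧ (s.sa o).Majority (.value y v) := by
  obtain ⟨u, hu, s, s', out, -, hs, hl, hout, -⟩ := sent_lstep he hm
  obtain ⟨rfl, v, hv⟩ := hl.out_read hout
  exact ⟨u, hu, s, v, hs, hv⟩

/-- That `q` had not yet crashed when answering is recorded because `majority_before` must exclude
that `q` crashed while forwarding a value without logging it. -/
theorem answer_origin (he : IsExecution (simulation n A) inp t e) {r : Option (SAVal n' In M)}
    (hm : (o, .answer y x r) ∈ (e.cfg τ).chan q p) :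
    ∃ u < τ, ∃ s, q ∉ (e.cfg u).crashed ∧ (e.cfg u).loc q = some s ∧ (s.sa o).values x = r ∧
      ∃ src, (o, .read y x) ∈ (e.cfg u).chan src q := by
  obtain ⟨u, hu, s, s', out, hc, hs, hl, hout, -⟩ := sent_lstep he hm
  obtain ⟨h1, src, h2⟩ := hl.out_answer hout
  exact ⟨u, hu, s, hc, hs, h1, src, h2⟩

/-- A simulator that has not crashed knows the values that it has forwarded. -/
theorem value_known (he : IsExecution (simulation n A) inp t e)
    (hm : (o, .value x v) ∈ (e.cfg τ).chan q p) (hq : q ∉ (e.cfg τ).crashed) :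
    q = x ∨ ∃ s src, (e.cfg τ).loc q = some s ∧ (src, .value x v) ∈ (s.sa o).log := by
  obtain ⟨u, hu, s, s', out, -, hs, hl, hout, hcr⟩ := sent_lstep he hm
  rcases hl.out_value hout with ⟨rfl, -⟩ | ⟨src, -, h⟩
  · exact .inl rfl
  · rcases hcr with hcr | hcr
    · exact absurd (he.crashed_mono hu hcr) hq
    · obtain ⟨s₁, h1, h2⟩ := later_of_le he hu hcr
      exact .inr ⟨s₁, src, h1, h2.log o h⟩

/-- If `y` does not see the value of `x`, then a majority had received the value of `y` before a
majority received the value of `x`. -/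
theorem majority_before (he : IsExecution (simulation n A) inp t e)
    (hs : (e.cfg τ).loc x = some s) (hx : (s.sa o).Majority (.value x v))
    (hs' : (e.cfg τ').loc y = some s') (hy : (s'.sa o).Majority (.answer y x none)) :
    ∃ u < τ, ∃ s v, (e.cfg u).loc y = some s ∧ (s.sa o).Majority (.value y v) := by
  -- This `q` forwarded the value of `x` and also answered `⊥` about `x`.
  obtain ⟨q, h1, h2⟩ := hx.exists_common hy
  obtain ⟨u, -, s₁, hcr, hs₁, hv, src, hr⟩ := answer_origin he (mem_chan_of_log he hs' h2)
  obtain ⟨u', hu', s₂, v₂, hs₂, hm₂⟩ := read_origin he hr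
  refine ⟨u', ?_, s₂, v₂, hs₂, hm₂⟩
  -- Otherwise `q` would have answered after time `τ`, by which it had sent the value of `x`. It
  -- knew that value by then, whether as a forwarder or as `x` itself, so its answer could not be
  -- `⊥`.
  by_contra! hτ
  have hτu : τ ≤ u := by omega
  have hne : ∀ {τ₀ s₀}, τ₀ ≤ u → (e.cfg τ₀).loc q = some s₀ →
      (∃ src, (src, .value x v) ∈ (s₀.sa o).log) → False := by
    rintro τ₀ s₀ h0 hs₀ ⟨src, h⟩
    exact (saInv he hs₁ o).values_ne src x v ((later_of_le' he h0 hs₀ hs₁).log o h) hv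
  rcases value_known he (mem_chan_of_log he hs h1)
    (fun h => hcr (he.crashed_mono hτu h)) with rfl | ⟨s₀, src, hs₀, h⟩
  · exact hne hτu hs ⟨q, h1⟩
  · exact hne hτu hs₀ ⟨src, h⟩

/-- Of two simulators that broadcast views, one has seen the value of the other. -/
theorem ProposedView.related (he : IsExecution (simulation n A) inp t e)
    (h : ProposedView e o x w τ) (h' : ProposedView e o y w' τ') :
    w y ≠ none ∨ w' x ≠ none := by
  by_contra! hc
  obtain ⟨u, -, s, k, hs, h1, hk, h2⟩ := h
  obtain ⟨u', -, s', k', hs', h1', hk', h2'⟩ := h'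
  have hm : (s.sa o).Majority (.answer x y none) := by
    have := ((threadInv he hs o.1).reading k w h2 y (by omega)).2 hc.1
    rwa [h1] at this
  have hm' : (s'.sa o).Majority (.answer y x none) := by
    have := ((threadInv he hs' o.1).reading k' w' h2' x (by omega)).2 hc.2
    rwa [h1'] at this
  obtain ⟨v, hv⟩ := (threadInv he hs o.1).passed o.2 (.inr ⟨h1.symm, by simp [h2, PC.rank]⟩)
  -- Minimality of the first time at which `x` holds a majority for its value is contradicted: each
  -- missing entry leads to an earlier majority, first for `y` and then again for `x`.
  have hex : ∃ τ, ∃ s v, (e.cfg τ).loc x = some s ∧ (s.sa o).Majority (.value x v) :=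
    ⟨u, s, v, hs, hv⟩
  obtain ⟨s₁, v₁, hs₁, hm₁⟩ := Nat.find_spec hex
  obtain ⟨u₂, hu₂, s₂, v₂, hs₂, hm₂⟩ := majority_before he hs₁ hm₁ hs' hm'
  obtain ⟨u₃, hu₃, s₃, v₃, hs₃, hm₃⟩ := majority_before he hs₂ hm₂ hs hm
  exact Nat.find_min hex (hu₃.trans hu₂) ⟨s₃, v₃, hs₃, hm₃⟩

/-- The intersection of two closed sets, for any simulators and times, is closed. -/
theorem closed_inter (he : IsExecution (simulation n A) inp t e) {i₁ i₂ : Fin n} {τ₁ τ₂ : ℕ}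
    {s₁ s₂ : SimState n n' In Out M S} (h₁ : (e.cfg τ₁).loc i₁ = some s₁)
    (h₂ : (e.cfg τ₂).loc i₂ = some s₂) {σ₁ σ₂ : Finset (Fin n)} (hc₁ : (s₁.sa o).Closed σ₁)
    (hc₂ : (s₂.sa o).Closed σ₂) : (s₁.sa o).Closed (σ₁ ∩ σ₂) := by
  obtain ⟨⟨x, hx⟩, h1⟩ := hc₁
  obtain ⟨⟨y, hy⟩, h2⟩ := hc₂
  -- The view of `z` is the same at both simulators, hence it is also contained in `σ₂`.
  have hsub : ∀ z ∈ σ₁ ∩ σ₂, ∀ w, (s₁.sa o).allViews z = some w → ∀ a, w a ≠ none → a ∈ σ₂ := by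
    intro z hz w hw
    obtain ⟨-, w', hw', h⟩ := h2 z (Finset.mem_inter.1 hz).2
    rwa [(proposedView_of_views he h₁ hw).unique he (proposedView_of_views he h₂ hw')]
  refine ⟨?_, fun z hz => ?_⟩
  -- Take a member of each set: one of them sees the other, and closure then puts the seen one in
  -- both sets.
  · obtain ⟨-, w, hw, hwx⟩ := h1 x hx
    obtain ⟨-, w', hw', hwy⟩ := h2 y hy
    rcases (proposedView_of_views he h₁ hw).related he (proposedView_of_views he h₂ hw') with h | h
    · exact ⟨y, Finset.mem_inter.2 ⟨hwx y h, hy⟩⟩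
    · exact ⟨x, Finset.mem_inter.2 ⟨hx, hwy x h⟩⟩
  · obtain ⟨h3, w, hw, h⟩ := h1 z (Finset.mem_inter.1 hz).1
    exact ⟨h3, w, hw, fun a ha => Finset.mem_inter.2 ⟨h a ha, hsub z hz w hw a ha⟩⟩

/-- By minimality of its size, each closed set equals its intersection with the other, so the two
coincide; their members have unique values, and both results are the minimum of the same set of
values. -/
theorem returns_unique (he : IsExecution (simulation n A) inp t e) {i₁ i₂ : Fin n} {τ₁ τ₂ : ℕ}
    {s₁ s₂ : SimState n n' In Out M S} (h₁ : (e.cfg τ₁).loc i₁ = some s₁)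
    (h₂ : (e.cfg τ₂).loc i₂ = some s₂) (hr₁ : (s₁.sa o).Returns v) (hr₂ : (s₂.sa o).Returns v') :
    v = v' := by
  obtain ⟨σ₁, hc₁, hmin₁, hl₁⟩ := hr₁
  obtain ⟨σ₂, hc₂, hmin₂, hl₂⟩ := hr₂
  have e1 : σ₁ ∩ σ₂ = σ₁ :=
    Finset.eq_of_subset_of_card_le Finset.inter_subset_left
      (hmin₁ _ (closed_inter he h₁ h₂ hc₁ hc₂))
  have e2 : σ₂ ∩ σ₁ = σ₂ :=
    Finset.eq_of_subset_of_card_le Finset.inter_subset_left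
      (hmin₂ _ (closed_inter he h₂ h₁ hc₂ hc₁))
  obtain rfl : σ₁ = σ₂ := by rw [← e1, Finset.inter_comm, e2]
  have hv : ∀ y ∈ σ₁, (s₁.sa o).values y = (s₂.sa o).values y := by
    intro y hy
    obtain ⟨a, ha⟩ := Option.ne_none_iff_exists'.1 (hc₁.2 y hy).1
    obtain ⟨b, hb⟩ := Option.ne_none_iff_exists'.1 (hc₂.2 y hy).1
    rw [ha, hb, (proposed_of_values he h₁ ha).unique he (proposed_of_values he h₂ hb)]
  have : {v | ∃ y ∈ σ₁, (s₁.sa o).values y = some v} =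
      {v | ∃ y ∈ σ₁, (s₂.sa o).values y = some v} := by
    ext a
    refine exists_congr fun y => and_congr_right fun hy => by rw [hv y hy]
  rw [this] at hl₁
  exact hl₁.unique hl₂

theorem SAState.returns_of_result {V : Type*} [LinearOrder V] {a : SAState n V} {r : V}
    (h : a.result = some r) : a.Returns r := by
  unfold SAState.result at h
  split_ifs at h with h1
  rw [← Option.some.inj h]
  exact h1.choose_spec

/-- There are finitely many sets of simulators and each carries finitely many values, so a smallest
closed set and its least value exist. -/
theorem SAState.result_ne_none {V : Type*} [LinearOrder V] {a : SAState n V}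
    {σ : Finset (Fin n)} (h : a.Closed σ) : a.result ≠ none := by
  obtain ⟨σ', h1, h2⟩ := Finset.exists_min_image (Finset.univ.filter a.Closed) Finset.card
    ⟨σ, by simpa using h⟩
  simp only [Finset.mem_filter, Finset.mem_univ, true_and] at h1 h2
  obtain ⟨y, hy⟩ := h1.1
  have hfin : {v | ∃ y ∈ σ', a.values y = some v}.Finite := by
    have : {v | ∃ y ∈ σ', a.values y = some v} ⊆
        ((σ'.image a.values).eraseNone : Finset V) := by
      rintro v ⟨y, hy, hv⟩
      simpa using ⟨y, hy, hv⟩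
    exact (Finset.finite_toSet _).subset this
  obtain ⟨v, hv⟩ := Option.ne_none_iff_exists'.1 (h1.2 y hy).1
  obtain ⟨r, hr1, hr2⟩ := Set.exists_min_image _ id hfin ⟨v, y, hy, hv⟩
  have : ∃ r, a.Returns r := ⟨r, σ', h1, h2, hr1, fun b hb => hr2 b hb⟩
  simp [SAState.result, this]

theorem SAState.closed_of_result {V : Type*} [LinearOrder V] {a : SAState n V} {r : V}
    (h : a.result = some r) : ∃ σ, a.Closed σ :=
  let ⟨σ, h, _⟩ := SAState.returns_of_result h
  ⟨σ, h⟩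

theorem result_unique (he : IsExecution (simulation n A) inp t e) {i₁ i₂ : Fin n} {τ₁ τ₂ : ℕ}
    {s₁ s₂ : SimState n n' In Out M S} (h₁ : (e.cfg τ₁).loc i₁ = some s₁)
    (h₂ : (e.cfg τ₂).loc i₂ = some s₂) (hr₁ : (s₁.sa o).result = some v)
    (hr₂ : (s₂.sa o).result = some v') : v = v' :=
  returns_unique he h₁ h₂ (SAState.returns_of_result hr₁) (SAState.returns_of_result hr₂)

theorem proposed_of_result (he : IsExecution (simulation n A) inp t e)
    (hs : (e.cfg τ).loc i = some s) (hr : (s.sa o).result = some v) :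
    ∃ x, Proposed e o x v τ := by
  obtain ⟨σ, -, -, ⟨y, -, hy⟩, -⟩ := SAState.returns_of_result hr
  exact ⟨y, proposed_of_values he hs hy⟩

end Agreement

/-! ### Liveness of the simulators -/

section LocalQueue

variable {n n' : ℕ} {In Out M S : Type*} [LinearOrder (SAVal n' In M)]
  {A : Algorithm n' In Out M S} {i : Fin n} {C : Fin n → Set (NetMsg n n' In M)}
  {s s' : SimState n n' In Out M S} {out : Fin n → List (NetMsg n n' In M)}

/-- Seen from the head of the queue, a step leaves the head alone and may lengthen the queue,
advances the head with the queue unchanged, or releases the lock. -/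
theorem LStep.queue_cases (h : LStep A i C s s' out) (hq : QueueInv s) {a : Fin n'}
    (ha : s.queue.head? = some a) :
    (s'.pc a = s.pc a ∧ s'.sn a = s.sn a ∧ ∃ l, s'.queue = s.queue ++ l) ∨
    (s'.sn a = s.sn a ∧
      ((s'.queue = s.queue ∧ (s.pc a).rank < (s'.pc a).rank) ∨
        s'.queue = s.queue.tail ∧ s'.pc a = .deciding)) := by
  have hmem := (hq.mem a).1 (List.mem_of_head? ha)
  cases h with
  | recv | stay => exact .inl ⟨rfl, rfl, [], by simp⟩
  | enterInput j hj | enterMsg j _ hj =>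
    left
    have hne : a ≠ j := by
      rintro rfl
      simp [hj, PC.rank] at hmem
    exact ⟨by simp [SimState.mutexIn, SimState.goto, hne], rfl, [j], rfl⟩
  | lock j _ hj | waitValue j _ hj | readSome j _ _ _ _ hj | readNone j _ _ _ hj
  | readDone j _ _ _ hj =>
    by_cases hne : a = j
    · subst hne
      right
      refine ⟨rfl, .inl ⟨rfl, ?_⟩⟩
      simp [SimState.goto, hj, PC.rank] <;> omega
    · left
      exact ⟨by simp [SimState.goto, hne], rfl, [], by simp [SimState.goto]⟩
  | waitView j _ hj =>
    have hh := hq.head j (by simp [hj, PC.rank]; omega) (by simp [hj, PC.rank])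
    obtain rfl : j = a := by simpa [hh] using ha
    exact .inr ⟨rfl, .inr ⟨rfl, by simp [SimState.goto]⟩⟩
  | obtainInput j v hj =>
    left
    have hne : a ≠ j := by
      rintro rfl
      simp [hj, PC.rank] at hmem
    simp [SimState.obtain, SimState.advance, SimState.goto, hne]
  | obtainMsg j m st hj _ hs =>
    left
    have hne : a ≠ j := by
      rintro rfl
      simp [hj, PC.rank] at hmem
    simp [SimState.obtain, SimState.advance, SimState.goto, hne, hs]

end LocalQueue

/-! ### Spreading of messages, termination of `propose` and conditional termination of `decide`. -/

section Liveness

open Filter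

variable {n n' t : ℕ} {In Out M S : Type*} [LinearOrder (SAVal n' In M)]
  {A : Algorithm n' In Out M S} {inp : Fin n → Fin n' → In} {e : SimTrace n n' In Out M S}
  {i : Fin n} {τ τ' : ℕ} {s s' : SimState n n' In Out M S} {o : Fin n' × ℕ} {j : Fin n'}
  {x y p q : Fin n}
  {v v' : SAVal n' In M} {w w' : Fin n → Option (SAVal n' In M)}

theorem eventually_log (he : IsExecution (simulation n A) inp t e) (hp : e.Correct p)
    {m : SAMsg n (SAVal n' In M)} (hm : (o, m) ∈ (e.cfg τ).chan q p) :
    ∀ᶠ u in atTop, ∀ s, (e.cfg u).loc p = some s → (q, m) ∈ (s.sa o).log := by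
  obtain ⟨u, s, r, -, rfl, h2⟩ := he.delivered hp hm
  filter_upwards [eventually_ge_atTop (u + 1)] with u' hu' s' hs'
  refine (later_of_le' he hu' h2 hs').log o ?_
  simp [simulation, SAState.recv_log]

theorem exists_loc (he : IsExecution (simulation n A) inp t e) (hi : e.Correct i) :
    ∀ᶠ u in atTop, ∃ s, (e.cfg u).loc i = some s := by
  obtain ⟨τ, h⟩ := he.starts i hi
  obtain ⟨s, hs⟩ := Option.ne_none_iff_exists'.1 h
  filter_upwards [eventually_ge_atTop τ] with u hu
  obtain ⟨s', hs', -⟩ := later_of_le he hu hs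
  exact ⟨s', hs'⟩

theorem exists_log (he : IsExecution (simulation n A) inp t e) (hp : e.Correct p)
    {m : SAMsg n (SAVal n' In M)} (hm : (o, m) ∈ (e.cfg τ).chan q p) :
    ∃ u s, (e.cfg u).loc p = some s ∧ (q, m) ∈ (s.sa o).log := by
  obtain ⟨u, h1, s, h2⟩ := ((eventually_log he hp hm).and (exists_loc he hp)).exists
  exact ⟨u, s, h2, h1 s h2⟩

/-- What is received from all correct simulators is received from a majority. -/
theorem eventually_majority (he : IsExecution (simulation n A) inp t e) (htn : 2 * t < n)
    {m : SAMsg n (SAVal n' In M)}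
    (h : ∀ q, e.Correct q → ∀ᶠ u in atTop, ∀ s, (e.cfg u).loc p = some s → (q, m) ∈ (s.sa o).log) :
    ∀ᶠ u in atTop, ∀ s, (e.cfg u).loc p = some s → (s.sa o).Majority m := by
  have h' : ∀ᶠ u in atTop, ∀ q, e.Correct q → ∀ s, (e.cfg u).loc p = some s →
      (q, m) ∈ (s.sa o).log := by
    refine eventually_all.2 fun q => ?_
    by_cases hq : e.Correct q
    · simpa [hq] using h q hq
    · simp [hq]
  filter_upwards [h'] with u hu s hs
  have h1 : {q | e.Correct q}.ncard ≤ {q | (q, m) ∈ (s.sa o).log}.ncard :=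
    Set.ncard_le_ncard (fun q hq => hu q hq s hs) (Set.toFinite _)
  have h2 := Set.ncard_add_ncard_compl {q | ¬ e.Correct q} (Set.toFinite _) (Set.toFinite _)
  have h3 : {q | ¬ e.Correct q}ᶜ = {q | e.Correct q} := by ext; simp
  rw [h3, Nat.card_fin] at h2
  have := he.resilient
  unfold SAState.Majority
  omega

/-- A value received by a simulator is eventually received from all correct simulators. -/
theorem spread_value (he : IsExecution (simulation n A) inp t e)
    (hs : (e.cfg τ).loc i = some s) (hv : (y, .value x v) ∈ (s.sa o).log) (hp : e.Correct p)
    (hq : e.Correct q) :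
    ∀ᶠ u in atTop, ∀ s, (e.cfg u).loc p = some s → (q, .value x v) ∈ (s.sa o).log := by
  obtain ⟨u, s', hs', h⟩ := exists_log he hq (forwarded_value he hs hv q)
  exact eventually_log he hp (forwarded_value he hs' h p)

theorem spread_view (he : IsExecution (simulation n A) inp t e)
    (hs : (e.cfg τ).loc i = some s) (hv : (y, .view x w) ∈ (s.sa o).log) (hp : e.Correct p)
    (hq : e.Correct q) :
    ∀ᶠ u in atTop, ∀ s, (e.cfg u).loc p = some s → (q, .view x w) ∈ (s.sa o).log := by
  obtain ⟨u, s', hs', h⟩ := exists_log he hq (forwarded_view he hs hv q)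
  exact eventually_log he hp (forwarded_view he hs' h p)

/-- If some correct simulator ever learns a value of `x`, all correct ones forward it; otherwise all
correct ones answer `⊥`. In both cases a majority is reached. -/
theorem eventually_read (he : IsExecution (simulation n A) inp t e) (htn : 2 * t < n)
    (hi : e.Correct i) (hr : ∀ p, (o, .read i x) ∈ (e.cfg τ).chan i p) :
    ∀ᶠ u in atTop, ∀ s, (e.cfg u).loc i = some s →
      (∃ v, (s.sa o).Majority (.value x v)) ∨ (s.sa o).Majority (.answer i x none) := by
  by_cases h : ∃ p, e.Correct p ∧ ∃ τ s q v, (e.cfg τ).loc p = some s ∧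
      (q, .value x v) ∈ (s.sa o).log
  · obtain ⟨p, hp, τ, s, q, v, hs, hv⟩ := h
    filter_upwards [eventually_majority he htn fun q hq => spread_value he hs hv hi hq] with u hu s hs
    exact .inl ⟨v, hu s hs⟩
  · have : ∀ q, e.Correct q → ∀ᶠ u in atTop, ∀ s, (e.cfg u).loc i = some s →
        (q, .answer i x none) ∈ (s.sa o).log := by
      intro q hq
      obtain ⟨u, s', hs', h1⟩ := exists_log he hq (hr q)
      rcases answered_read he hs' h1 with h2 | ⟨q', v, h2⟩
      · exact eventually_log he hi h2
      · exact absurd ⟨q, hq, u, s', q', v, hs', h2⟩ h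
    filter_upwards [eventually_majority he htn this] with u hu s hs
    exact .inr (hu s hs)

/-- As long as its head does not move, the queue can only grow. -/
theorem queue_grows (he : IsExecution (simulation n A) inp t e)
    (hs : (e.cfg τ).loc i = some s) (hj : s.queue.head? = some j) (h : τ ≤ τ')
    (hu : ∀ u, τ ≤ u → u ≤ τ' → ∀ s', (e.cfg u).loc i = some s' →
      s'.pc j = s.pc j ∧ s'.sn j = s.sn j) (hs' : (e.cfg τ').loc i = some s') :
    ∃ l, s'.queue = s.queue ++ l := by
  induction h generalizing s' with
  | refl =>
    obtain rfl : s = s' := by simpa [hs] using hs'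
    exact ⟨[], by simp⟩
  | @step u hle ih =>
    have hle' : τ ≤ u := hle
    obtain ⟨s₁, hs₁, -⟩ := later_of_le he hle' hs
    obtain ⟨l, hl⟩ := ih (fun u' h1 h2 => hu u' h1 (h2.trans (Nat.le_succ u))) hs₁
    rcases loc_step he u i with h | ⟨h, -⟩ | ⟨a, b, out, h3, h4, h5, -⟩
    · obtain rfl : s₁ = s' := by simpa [← h, hs'] using hs₁.symm
      exact ⟨l, hl⟩
    · simp [h] at hs₁
    · obtain rfl : a = s₁ := by simpa [h3] using hs₁
      obtain rfl : b = s' := by simpa [h4] using hs'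
      have h1 := hu u hle' (Nat.le_succ u) a h3
      have h2 := hu (u + 1) (by omega) le_rfl b h4
      have hh : a.queue.head? = some j := by simp [hl, List.head?_append, hj]
      rcases h5.queue_cases (queueInv he h3) hh with ⟨-, -, l', h⟩ | ⟨-, ⟨-, h⟩ | ⟨-, h⟩⟩
      · exact ⟨l ++ l', by rw [h, hl, List.append_assoc]⟩
      · rw [h1.1, h2.1] at h; exact absurd h (lt_irrefl _)
      · have := ((queueInv he h3).mem j).1 (List.mem_of_head? hh)
        rw [h1.1, ← h2.1, h] at this
        simp [PC.rank] at this

/-- The thread that owns the lock is not stuck. -/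
theorem head_moves (he : IsExecution (simulation n A) inp t e) (htn : 2 * t < n)
    (hi : e.Correct i) (hs : (e.cfg τ).loc i = some s) (hj : s.queue.head? = some j) :
    ∃ u ≥ τ, ∃ s', (e.cfg u).loc i = some s' ∧ ¬ (s'.pc j = s.pc j ∧ s'.sn j = s.sn j) := by
  by_contra! hc
  -- If the head never moved, the guard of its pending transition would eventually hold at all later
  -- times, and the next fair step of its thread would move it.
  have key : ∀ᶠ u in atTop, τ ≤ u → ∀ s', (e.cfg u).loc i = some s' →
      (threadStep A i j s').1.pc j ≠ s.pc j := by
    have hmem := ((queueInv he hs).mem j).1 (List.mem_of_head? hj)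
    cases hpc : s.pc j with
    | begin => simp [hpc, PC.rank] at hmem
    | waitMsg => simp [hpc, PC.rank] at hmem
    | deciding => simp [hpc, PC.rank] at hmem
    | lock v =>
      refine Eventually.of_forall fun u hu s' hs' => ?_
      obtain ⟨l, hl⟩ := queue_grows he hs hj hu (fun u' h1 _ s' => hc u' h1 s') hs'
      have h1 := (hc u hu s' hs').1
      have hh : s'.queue.head? = some j := by simp [hl, List.head?_append, hj]
      rw [hpc] at h1
      simp [threadStep, h1, hh, SimState.goto]
    | waitValue v =>
      have hb := broadcast_value he hs hpc
      have : ∀ q, e.Correct q → ∀ᶠ u in atTop, ∀ s', (e.cfg u).loc i = some s' →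
          (q, .value i v) ∈ (s'.sa (j, s.sn j)).log := by
        intro q hq
        obtain ⟨u, s', hs', h1⟩ := exists_log he hq (hb q)
        exact eventually_log he hi (forwarded_value he hs' h1 i)
      filter_upwards [eventually_majority he htn this] with u hm hu s' hs'
      have h1 := hc u hu s' hs'
      have h2 := hm s' hs'
      rw [hpc] at h1
      rw [← h1.2] at h2
      simp [threadStep, h1.1, h2, SimState.goto]
    | reading k w =>
      by_cases hk : k < n
      · have hb := broadcast_read he hs hpc ⟨k, hk⟩
        filter_upwards [eventually_read he htn hi hb] with u hm hu s' hs'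
        have h1 := hc u hu s' hs'
        have h2 := hm s' hs'
        rw [hpc] at h1
        rw [← h1.2] at h2
        by_cases h3 : ∃ v, (s'.sa (j, s'.sn j)).Majority (.value ⟨k, hk⟩ v)
        · simp [threadStep, h1.1, h3, hk, SimState.goto]
        · have h4 := h2.resolve_left h3
          simp [threadStep, h1.1, h3, h4, hk, SimState.goto]
      · refine Eventually.of_forall fun u hu s' hs' => ?_
        have h1 := (hc u hu s' hs').1
        rw [hpc] at h1
        simp [threadStep, h1, hk, SimState.goto]
    | waitView w =>
      have hb := broadcast_waitView he hs hpc
      have : ∀ q, e.Correct q → ∀ᶠ u in atTop, ∀ s', (e.cfg u).loc i = some s' →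
          (q, .view i w) ∈ (s'.sa (j, s.sn j)).log := by
        intro q hq
        obtain ⟨u, s', hs', h1⟩ := exists_log he hq (hb q)
        exact eventually_log he hi (forwarded_view he hs' h1 i)
      filter_upwards [eventually_majority he htn this] with u hm hu s' hs'
      have h1 := hc u hu s' hs'
      have h2 := hm s' hs'
      rw [hpc] at h1
      rw [← h1.2] at h2
      simp [threadStep, h1.1, h2, SimState.goto]
  obtain ⟨T, hT⟩ := eventually_atTop.1 key
  obtain ⟨u, hu, s₁, hs₁, hs₂⟩ := he.ticked hi j (max τ T)
  refine hT u (by omega) (by omega) s₁ hs₁ ?_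
  exact (hc (u + 1) (by omega) _ hs₂).1

/-- The thread that owns the lock makes progress in `propose`, and finally releases the lock. -/
theorem head_progress (he : IsExecution (simulation n A) inp t e) (htn : 2 * t < n)
    (hi : e.Correct i) (hs : (e.cfg τ).loc i = some s) (hj : s.queue.head? = some j) :
    ∃ u ≥ τ, ∃ s', (e.cfg u).loc i = some s' ∧ s'.sn j = s.sn j ∧
      ((∃ l, s'.queue = s.queue ++ l) ∧ (s.pc j).rank < (s'.pc j).rank ∨
        (∃ l, s'.queue = s.queue.tail ++ l) ∧ s'.pc j = .deciding) := by
  have hex : ∃ u, τ ≤ u ∧ ∃ s', (e.cfg u).loc i = some s' ∧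
      ¬ (s'.pc j = s.pc j ∧ s'.sn j = s.sn j) := by
    obtain ⟨u, h1, h2⟩ := head_moves he htn hi hs hj
    exact ⟨u, h1, h2⟩
  -- Taking the first time at which the head has moved isolates the step responsible; until then the
  -- queue has only been extended.
  obtain ⟨h1, s', hs', h2⟩ := Nat.find_spec hex
  have hmin := fun u (hu : u < Nat.find hex) => Nat.find_min hex hu
  generalize Nat.find hex = N at *
  have hlt : τ < N := by
    refine lt_of_le_of_ne h1 ?_
    rintro rfl
    obtain rfl : s = s' := by simpa [hs] using hs'
    simp at h2
  obtain ⟨u, rfl⟩ : ∃ u, N = u + 1 := ⟨N - 1, by omega⟩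
  have hle : τ ≤ u := by omega
  have hsame : ∀ u', τ ≤ u' → u' ≤ u → ∀ s', (e.cfg u').loc i = some s' →
      s'.pc j = s.pc j ∧ s'.sn j = s.sn j := by
    intro u' h3 h4 s₁ hs₁
    by_contra h5
    exact hmin u' (by omega) ⟨h3, s₁, hs₁, h5⟩
  obtain ⟨s₁, hs₁, -⟩ := later_of_le he hle hs
  obtain ⟨l, hl⟩ := queue_grows he hs hj hle hsame hs₁
  have h3 := hsame u hle le_rfl s₁ hs₁
  have hh : s₁.queue.head? = some j := by simp [hl, List.head?_append, hj]
  have hne : s.queue ≠ [] := by rintro h; simp [h] at hj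
  refine ⟨u + 1, h1, s', hs', ?_⟩
  rcases loc_step he u i with h | ⟨h, -⟩ | ⟨a, b, out, h4, h5, h6, -⟩
  · rw [h, hs₁] at hs'
    obtain rfl := Option.some.inj hs'
    exact absurd h3 h2
  · simp [h] at hs₁
  · obtain rfl : a = s₁ := by simpa [h4] using hs₁
    obtain rfl : b = s' := by simpa [h5] using hs'
    rcases h6.queue_cases (queueInv he h4) hh with ⟨h7, h8, -⟩ | ⟨h7, ⟨h8, h9⟩ | ⟨h8, h9⟩⟩
    · exact absurd ⟨h7.trans h3.1, h8.trans h3.2⟩ h2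
    · exact ⟨h7.trans h3.2, .inl ⟨⟨l, h8.trans hl⟩, h3.1 ▸ h9⟩⟩
    · exact ⟨h7.trans h3.2, .inr ⟨⟨l, by rw [h8, hl, List.tail_append_of_ne_nil hne]⟩, h9⟩⟩

/-- In a correct simulator, each thread that waits for the lock terminates its `propose`. -/
theorem propose_terminates (he : IsExecution (simulation n A) inp t e) (htn : 2 * t < n)
    (hi : e.Correct i) (hs : (e.cfg τ).loc i = some s) (hj : j ∈ s.queue) :
    ∃ u ≥ τ, ∃ s', (e.cfg u).loc i = some s' ∧
      (s.sn j < s'.sn j ∨ s.sn j = s'.sn j ∧ s'.pc j = .deciding) := by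
  -- Lexicographic measure: the position of `j` in the queue, then the rank left to the head before
  -- `deciding`. The weight `6 + n` exceeds every value of the second part, so a release lowers the
  -- sum whatever the rank of the new head.
  suffices H : ∀ N τ s a, (e.cfg τ).loc i = some s → j ∈ s.queue → s.queue.head? = some a →
      s.queue.idxOf j * (6 + n) + (5 + n - (s.pc a).rank) < N →
      ∃ u ≥ τ, ∃ s', (e.cfg u).loc i = some s' ∧
        (s.sn j < s'.sn j ∨ s.sn j = s'.sn j ∧ s'.pc j = .deciding) by
    obtain ⟨a, ha⟩ : ∃ a, s.queue.head? = some a := by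
      cases hl : s.queue with
      | nil => simp [hl] at hj
      | cons a l => exact ⟨a, rfl⟩
    exact H _ τ s a hs hj ha (Nat.lt_succ_self _)
  intro N
  induction N with
  | zero => intro _ _ _ _ _ _ h; omega
  | succ N ih =>
    intro τ s a hs hj ha hN
    obtain ⟨u, hu, s', hs', hsn, hcase⟩ := head_progress he htn hi hs ha
    have hmem := ((queueInv he hs).mem a).1 (List.mem_of_head? ha)
    have hprog := ((later_of_le' he hu hs hs').prog j).sn_le
    rcases hprog.lt_or_eq with hlt | heq
    · exact ⟨u, hu, s', hs', .inl hlt⟩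
    have hmem' := (queueInv he hs').mem
    suffices H : (a = j ∧ s'.pc j = .deciding) ∨ ∃ b, j ∈ s'.queue ∧ s'.queue.head? = some b ∧
        s'.queue.idxOf j * (6 + n) + (5 + n - (s'.pc b).rank) < N by
      rcases H with ⟨-, H⟩ | ⟨b, h1, h2, h3⟩
      · exact ⟨u, hu, s', hs', .inr ⟨heq, H⟩⟩
      · obtain ⟨u', hu', s₂, hs₂, h⟩ := ih u s' b hs' h1 h2 h3
        exact ⟨u', hu.le.trans hu', s₂, hs₂, by rwa [heq]⟩
    rcases hcase with ⟨⟨l, hl⟩, hr⟩ | ⟨⟨l, hl⟩, hr⟩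
    · right
      refine ⟨a, by simp [hl, hj], by simp [hl, List.head?_append, ha], ?_⟩
      have hma := (hmem' a).1 (by rw [hl]; simp [List.mem_of_head? ha])
      rw [hl, List.idxOf_append_of_mem hj]
      omega
    · by_cases haj : a = j
      · subst haj; exact .inl ⟨rfl, hr⟩
      · right
        obtain ⟨r, hqr⟩ : ∃ r, s.queue = a :: r := by
          cases hl : s.queue with
          | nil => simp [hl] at ha
          | cons b r => exact ⟨r, by simpa [hl] using ha⟩
        rw [hqr, List.tail_cons] at hl
        have hjr : j ∈ r := by
          rw [hqr, List.mem_cons] at hj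
          exact hj.resolve_left fun h => haj h.symm
        rw [hqr, List.idxOf_cons_ne _ haj] at hN
        obtain ⟨b, hb⟩ : ∃ b, s'.queue.head? = some b := by
          cases r with
          | nil => simp at hjr
          | cons b r => exact ⟨b, by simp [hl]⟩
        refine ⟨b, by simp [hl, hjr], hb, ?_⟩
        have hmb := (hmem' b).1 (List.mem_of_head? hb)
        rw [hl, List.idxOf_append_of_mem hjr]
        rw [Nat.succ_mul] at hN
        omega

/-- In a correct simulator, a thread that never waits for a message reaches `decide()`. -/
theorem reaches_deciding (he : IsExecution (simulation n A) inp t e) (htn : 2 * t < n)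
    (hi : e.Correct i) (hs : (e.cfg τ).loc i = some s)
    (hold : ∀ u ≥ τ, ∀ s', (e.cfg u).loc i = some s' → s'.sn j = s.sn j → s'.pc j = .waitMsg →
      s'.oldest j ≠ none) :
    ∃ u ≥ τ, ∃ s', (e.cfg u).loc i = some s' ∧
      (s.sn j < s'.sn j ∨ s.sn j = s'.sn j ∧ s'.pc j = .deciding) := by
  -- A thread of positive rank is either in the queue, where `propose_terminates` applies, or
  -- already in `deciding`; a thread of rank 0 gets a positive rank at its next step.
  have hpos : ∀ u s', τ ≤ u → (e.cfg u).loc i = some s' → 1 ≤ (s'.pc j).rank →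
      ∃ u ≥ τ, ∃ s', (e.cfg u).loc i = some s' ∧
        (s.sn j < s'.sn j ∨ s.sn j = s'.sn j ∧ s'.pc j = .deciding) := by
    intro u s' hu hs' hr
    have hle := ((later_of_le' he hu hs hs').prog j).sn_le
    by_cases hr' : (s'.pc j).rank ≤ 4 + n
    · obtain ⟨u', hu', s₁, hs₁, h⟩ :=
        propose_terminates he htn hi hs' (((queueInv he hs').mem j).2 ⟨hr, hr'⟩)
      refine ⟨u', hu.trans hu', s₁, hs₁, ?_⟩
      rcases h with h | ⟨h, h'⟩
      · exact .inl (hle.trans_lt h)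
      · rcases hle.lt_or_eq with h1 | h1
        · exact .inl (h ▸ h1)
        · exact .inr ⟨h1.trans h, h'⟩
    · refine ⟨u, hu, s', hs', ?_⟩
      have : s'.pc j = .deciding := by
        cases hpc : s'.pc j <;> simp only [hpc, PC.rank] at hr' <;> first | rfl | omega
      simp only [this, and_true]
      omega
  obtain ⟨u, hu, s₁, hs₁, hs₂⟩ := he.ticked hi j τ
  have hle := ((later_of_le' he hu hs hs₁).prog j).sn_le
  rcases hle.lt_or_eq with hlt | heq
  · exact ⟨u, hu, s₁, hs₁, .inl hlt⟩
  by_cases hr : 1 ≤ (s₁.pc j).rank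
  · exact hpos u s₁ hu hs₁ hr
  · refine hpos (u + 1) _ (by omega) hs₂ ?_
    simp only [simulation]
    cases hpc : s₁.pc j with
    | begin => simp [threadStep, hpc, SimState.mutexIn, SimState.goto, PC.rank]
    | waitMsg =>
      obtain ⟨m, hm⟩ := Option.ne_none_iff_exists'.1 (hold u hu s₁ hs₁ heq.symm hpc)
      simp [threadStep, hpc, hm, SimState.mutexIn, SimState.goto, PC.rank]
    | lock | waitValue | reading | waitView | deciding => simp [hpc, PC.rank] at hr

/-- A closed set of simulators is eventually known by all correct simulators. -/
theorem spread_closed (he : IsExecution (simulation n A) inp t e)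
    (hs : (e.cfg τ).loc i = some s) {σ : Finset (Fin n)} (hσ : (s.sa o).Closed σ)
    (hp : e.Correct p) :
    ∀ᶠ u in atTop, ∀ s, (e.cfg u).loc p = some s → (s.sa o).Closed σ := by
  have : ∀ᶠ u in atTop, ∀ y, y ∈ σ → ∀ s', (e.cfg u).loc p = some s' → (s'.sa o).values y ≠ none ∧
      ∃ w, (s'.sa o).allViews y = some w ∧ ∀ z, w z ≠ none → z ∈ σ := by
    refine eventually_all.2 fun y => ?_
    by_cases hy : y ∈ σ
    · obtain ⟨h1, w, hw, h2⟩ := hσ.2 y hy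
      obtain ⟨v, hv⟩ := Option.ne_none_iff_exists'.1 h1
      obtain ⟨a, ha⟩ := (saInv he hs o).values y v hv
      obtain ⟨b, hb⟩ := (saInv he hs o).views y w hw
      filter_upwards [spread_value he hs ha hp hp, spread_view he hs hb hp hp] with u h3 h4 _ s' hs'
      refine ⟨(saInv he hs' o).values_ne _ _ _ (h3 s' hs'), ?_⟩
      obtain ⟨w', hw'⟩ :=
        Option.ne_none_iff_exists'.1 ((saInv he hs' o).views_ne _ _ _ (h4 s' hs'))
      refine ⟨w', hw', ?_⟩
      -- Uniqueness of views makes the local copy equal to the one for which closure is known.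
      rwa [(proposedView_of_views he hs' hw').unique he (proposedView_of_views he hs hw)]
    · simp [hy]
  filter_upwards [this] with u hu s' hs'
  exact ⟨hσ.1, fun y hy => hu y hy s' hs'⟩

/-- The values proposed to `SA[j, 0]` are inputs, those proposed to `SA[j, sn]` for `sn > 0` are
the oldest messages sent to `p_j` and not yet received by it. -/
theorem Proposed.valid (he : IsExecution (simulation n A) inp t e) (h : Proposed e o x v τ) :
    (o.2 = 0 ∧ v = .input (inp x o.1)) ∨ (0 < o.2 ∧ ∃ m, v = .msg m ∧
      ∃ u < τ, ∃ s, (e.cfg u).loc x = some s ∧ s.sn o.1 = o.2 ∧ s.oldest o.1 = some m) := by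
  obtain ⟨u, hu, s, hs, h1, h2, -⟩ := h
  rcases (threadInv he hs o.1).lock v h2 with h3 | ⟨h3, m, h4, h5⟩
  · exact .inl ⟨h1 ▸ h3.1, h3.2⟩
  · exact .inr ⟨h1 ▸ h3, m, h4, u, hu, s, hs, h1, h5⟩

/-- In a correct simulator, `decide()` terminates if some simulator knows a closed set. -/
theorem decide_terminates (he : IsExecution (simulation n A) inp t e)
    (hi : e.Correct i) (hs : (e.cfg τ).loc i = some s) (hj : s.pc j = .deciding)
    {u₀ : ℕ} {s₀ : SimState n n' In Out M S} (hp : (e.cfg u₀).loc p = some s₀)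
    {σ : Finset (Fin n)} (hσ : (s₀.sa (j, s.sn j)).Closed σ) :
    ∃ u ≥ τ, ∃ s', (e.cfg u).loc i = some s' ∧ s.sn j < s'.sn j := by
  obtain ⟨T, hT⟩ := eventually_atTop.1 (spread_closed he hp hσ hi)
  obtain ⟨u, hu, s₁, hs₁, hs₂⟩ := he.ticked hi j (max τ T)
  have hu' : τ ≤ u := by omega
  rcases (later_of_le' he hu' hs hs₁).prog j with h | ⟨h, h'⟩
  · exact ⟨u, hu', s₁, hs₁, h⟩
  -- No program counter has a rank above that of `deciding`, so with the same `sn` the thread is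
  -- still there.
  have hpc : s₁.pc j = .deciding := by
    rcases h' with h' | h'
    · rw [h', hj]
    · cases hpc : s₁.pc j <;> simp [hj, hpc, PC.rank] at h' <;> omega
  refine ⟨u + 1, by omega, _, hs₂, ?_⟩
  obtain ⟨r, hr⟩ := Option.ne_none_iff_exists'.1
    (SAState.result_ne_none (hT u (by omega) s₁ hs₁))
  obtain ⟨x, hx⟩ := proposed_of_result he hs₁ hr
  rw [h] at hr
  simp only [simulation, threadStep, hpc, hr]
  rcases hx.valid he with ⟨h1, rfl⟩ | ⟨h1, m, rfl, -⟩
  · simp [SimState.obtain, SimState.advance, h]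
  · cases hst : s₁.state j with
    | none =>
      have := (threadInv he hs₁ j).state.2 hst
      simp only at h1
      omega
    | some st => simp [SimState.obtain, SimState.advance, h, hst]

end Liveness

/-! ### The simulated run -/

section SimRun

variable {n n' : ℕ} {In Out M S : Type*}

/-- Local history of a simulated process: its state, the messages that it has sent to each process,
the messages that it has received, and its decision. -/
structure History (n' : ℕ) (Out M S : Type*) where
  state : Option S
  outs : Fin n' → List M
  received : List (SimMsg n' M)
  decided : Option Out

/-- The history after a transition of `p_j` with result `r`. -/
def History.next (A : Algorithm n' In Out M S) (j : Fin n') (h : History n' Out M S)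
    (r : S × (Fin n' → List M)) (rec : List (SimMsg n' M)) : History n' Out M S where
  state := some r.1
  outs := fun x => h.outs x ++ r.2 x
  received := rec
  decided := h.decided.or (A.dec j r.1)

/-- The history of `p_j` after `k` transitions, if `d` is the sequence of its input and of the
messages that it receives. -/
def history (A : Algorithm n' In Out M S) (j : Fin n') (d : ℕ → Option (SAVal n' In M)) :
    ℕ → History n' Out M S
  | 0 => ⟨none, fun _ => [], [], none⟩
  | k + 1 =>
    let h := history A j d k
    match d k, h.state with
    | some (.input v), _ => h.next A j (A.δ j (A.init j v) none) h.received
    | some (.msg m), some st => h.next A j (A.δ j st (some (m.1, m.2.2))) (h.received ++ [m])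
    | _, _ => h

variable {A : Algorithm n' In Out M S} {j : Fin n'} {d : ℕ → Option (SAVal n' In M)} {k k' : ℕ}

theorem history_succ_input {v : In} (h : d k = some (.input v)) :
    history A j d (k + 1) = (history A j d k).next A j (A.δ j (A.init j v) none)
      (history A j d k).received := by
  simp [history, h]

theorem history_succ_msg {m : SimMsg n' M} {st : S} (h : d k = some (.msg m))
    (hst : (history A j d k).state = some st) :
    history A j d (k + 1) = (history A j d k).next A j (A.δ j st (some (m.1, m.2.2)))
      ((history A j d k).received ++ [m]) := by
  simp [history, h, hst]

theorem history_succ_cases :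
    history A j d (k + 1) = history A j d k ∨
    (∃ r, history A j d (k + 1) = (history A j d k).next A j r (history A j d k).received) ∨
    ∃ r m, d k = some (.msg m) ∧
      history A j d (k + 1) = (history A j d k).next A j r ((history A j d k).received ++ [m]) := by
  cases h : d k with
  | none => left; simp [history, h]
  | some v =>
    cases v with
    | input v => exact .inr (.inl ⟨_, history_succ_input h⟩)
    | msg m =>
      cases hst : (history A j d k).state with
      | none => left; simp [history, h, hst]
      | some st => exact .inr (.inr ⟨_, m, rfl, history_succ_msg h hst⟩)

theorem history_outs_prefix (h : k ≤ k') (x : Fin n') :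
    (history A j d k).outs x <+: (history A j d k').outs x := by
  induction h with
  | refl => exact List.prefix_rfl
  | @step l _ ih =>
    refine ih.trans ?_
    rcases history_succ_cases (A := A) (j := j) (d := d) (k := l) with h | ⟨r, h⟩ | ⟨r, m, -, h⟩ <;>
      simp [h, History.next]

theorem history_received_prefix (h : k ≤ k') :
    (history A j d k).received <+: (history A j d k').received := by
  induction h with
  | refl => exact List.prefix_rfl
  | @step l _ ih =>
    refine ih.trans ?_
    rcases history_succ_cases (A := A) (j := j) (d := d) (k := l) with h | ⟨r, h⟩ | ⟨r, m, -, h⟩ <;>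
      simp [h, History.next]

/-- The recorded decision is allowed by the first state that allows one. -/
theorem history_decided {v : Out} (h : (history A j d k).decided = some v) :
    ∃ k' ≤ k, (history A j d k').state.bind (A.dec j) = some v ∧
      ∀ l < k', (history A j d l).state.bind (A.dec j) = none := by
  -- The induction also has to carry the negative alternative, that no state so far allows a
  -- decision, in order to certify that a newly recorded decision is the first.
  suffices H : ∀ k, ((history A j d k).decided = none ∧
      ∀ l ≤ k, (history A j d l).state.bind (A.dec j) = none) ∨
      ∃ v, (history A j d k).decided = some v ∧
        ∃ k' ≤ k, (history A j d k').state.bind (A.dec j) = some v ∧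
          ∀ l < k', (history A j d l).state.bind (A.dec j) = none by
    rcases H k with ⟨h1, -⟩ | ⟨v', h1, h2⟩
    · simp [h1] at h
    · obtain rfl : v' = v := by simpa [h1] using h
      exact h2
  intro k
  induction k with
  | zero => left; simp [history]
  | succ k ih =>
    have key : (history A j d (k + 1)).decided = (history A j d k).decided ∧
        (history A j d (k + 1)).state = (history A j d k).state ∨
        (history A j d (k + 1)).decided =
          (history A j d k).decided.or ((history A j d (k + 1)).state.bind (A.dec j)) := by
      rcases history_succ_cases (A := A) (j := j) (d := d) (k := k) with h | ⟨r, h⟩ | ⟨r, m, -, h⟩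
      · left; simp [h]
      · right; simp [h, History.next]
      · right; simp [h, History.next]
    rcases ih with ⟨h1, h2⟩ | ⟨v, h1, k', hk', h2⟩
    · rcases key with ⟨h3, h4⟩ | h3
      · refine .inl ⟨h3.trans h1, fun l hl => ?_⟩
        rcases Nat.lt_or_ge k l with h | h
        · obtain rfl : l = k + 1 := by omega
          rw [h4]; exact h2 k le_rfl
        · exact h2 l h
      · rw [h1, Option.none_or] at h3
        cases hd : (history A j d (k + 1)).state.bind (A.dec j) with
        | none =>
          refine .inl ⟨h3.trans hd, fun l hl => ?_⟩
          rcases Nat.lt_or_ge k l with h | h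
          · obtain rfl : l = k + 1 := by omega
            exact hd
          · exact h2 l h
        | some v => exact .inr ⟨v, h3.trans hd, k + 1, le_rfl, hd, fun l hl => h2 l (by omega)⟩
    · refine .inr ⟨v, ?_, k', by omega, h2⟩
      rcases key with ⟨h3, -⟩ | h3 <;> simp [h3, h1]

/-- Recording uses `or`, so a state that allows a decision either adds one or finds an earlier one,
which is never erased. -/
theorem history_decided_ne_none (h : (history A j d k).state.bind (A.dec j) ≠ none) :
    (history A j d k).decided ≠ none := by
  induction k with
  | zero => simp [history] at h
  | succ k ih =>
    rcases history_succ_cases (A := A) (j := j) (d := d) (k := k) with h' | ⟨r, h'⟩ | ⟨r, m, -, h'⟩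
    · rw [h'] at h ⊢; exact ih h
    · rw [h'] at h ⊢
      simp only [History.next, Option.bind_some] at h ⊢
      simp [h]
    · rw [h'] at h ⊢
      simp only [History.next, Option.bind_some] at h ⊢
      simp [h]

end SimRun

/-! ### Global progress of each simulated process. -/

section Count

variable {n n' : ℕ} {In Out M S : Type*} {e : SimTrace n n' In Out M S} {i : Fin n} {τ : ℕ}
  {s : SimState n n' In Out M S} {j : Fin n'}

/-- Number of transitions of `p_j` that have been simulated by some simulator. -/
def count (e : SimTrace n n' In Out M S) (τ : ℕ) (j : Fin n') : ℕ :=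
  Finset.univ.sup fun i => ((e.cfg τ).loc i).elim 0 fun s => s.sn j

theorem sn_le_count (hs : (e.cfg τ).loc i = some s) (j : Fin n') : s.sn j ≤ count e τ j := by
  have := Finset.le_sup (f := fun i => ((e.cfg τ).loc i).elim 0 fun s => s.sn j)
    (Finset.mem_univ i)
  simp only [hs, Option.elim_some] at this
  exact this

theorem count_le_iff {b : ℕ} :
    count e τ j ≤ b ↔ ∀ i s, (e.cfg τ).loc i = some s → s.sn j ≤ b := by
  simp only [count, Finset.sup_le_iff, Finset.mem_univ, true_implies]
  refine forall_congr' fun i => ?_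
  cases h : (e.cfg τ).loc i <;> simp

theorem exists_of_lt_count {b : ℕ} (h : b < count e τ j) :
    ∃ i s, (e.cfg τ).loc i = some s ∧ b < s.sn j := by
  by_contra! hc
  exact absurd (count_le_iff.2 hc) (not_le.2 h)

end Count

/-! ### Agreed values, and the histories that they determine. -/

section Simulated

variable {n n' t : ℕ} {In Out M S : Type*} [LinearOrder (SAVal n' In M)]

/-- The value on which the simulators agree for the object `o`, if any. -/
def agreed (e : SimTrace n n' In Out M S) (o : Fin n' × ℕ) : Option (SAVal n' In M) :=
  if h : ∃ v i τ s, (e.cfg τ).loc i = some s ∧ (s.sa o).result = some v then some h.choose else none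

/-- The simulated history of `p_j` after `k` transitions. -/
def simulated (A : Algorithm n' In Out M S) (e : SimTrace n n' In Out M S) (j : Fin n') (k : ℕ) :
    History n' Out M S :=
  history A j (fun l => agreed e (j, l)) k

variable {A : Algorithm n' In Out M S} {inp : Fin n → Fin n' → In} {e : SimTrace n n' In Out M S}
  {i : Fin n} {τ τ' : ℕ} {s s' : SimState n n' In Out M S} {o : Fin n' × ℕ} {j : Fin n'} {k : ℕ}
  {v : SAVal n' In M} {C : Fin n → Set (NetMsg n n' In M)}
  {out : Fin n → List (NetMsg n n' In M)}

/-- The choice in `agreed` is harmless, because all simulators obtain the same result at all times.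
-/
theorem agreed_eq (he : IsExecution (simulation n A) inp t e) (hs : (e.cfg τ).loc i = some s)
    (hr : (s.sa o).result = some v) : agreed e o = some v := by
  have h : ∃ v i τ s, (e.cfg τ).loc i = some s ∧ (s.sa o).result = some v := ⟨v, i, τ, s, hs, hr⟩
  obtain ⟨i', τ', s', hs', hr'⟩ := h.choose_spec
  rw [agreed, dif_pos h, result_unique he hs' hs hr' hr]

theorem exists_of_agreed (h : agreed e o = some v) :
    ∃ i τ s, (e.cfg τ).loc i = some s ∧ (s.sa o).result = some v := by
  unfold agreed at h
  split_ifs at h with h1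
  rw [← Option.some.inj h]
  exact h1.choose_spec

/-- Only the end of `decide()` modifies what is simulated. -/
theorem LStep.sim_cases (h : LStep A i C s s' out) :
    (s'.state = s.state ∧ s'.received = s.received ∧ s'.decided = s.decided ∧ s'.sent = s.sent ∧
      s'.sn = s.sn) ∨
    (∃ j v, (s.sa (j, s.sn j)).result = some (.input v) ∧ s' = s.obtain A j (.input v)) ∨
    ∃ j m st, (s.sa (j, s.sn j)).result = some (.msg m) ∧ s.state j = some st ∧
      s' = s.obtain A j (.msg m) := by
  cases h with
  | recv | stay | enterInput | enterMsg | lock | waitValue | waitView | readSome | readNone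
  | readDone => exact .inl ⟨rfl, rfl, rfl, rfl, rfl⟩
  | obtainInput j v _ h => exact .inr (.inl ⟨j, v, h, rfl⟩)
  | obtainMsg j m st _ h hs => exact .inr (.inr ⟨j, m, st, h, hs, rfl⟩)

theorem LStep.waitMsg_of_sn_lt (h : LStep A i C s s' out) (hj : s.sn j < s'.sn j) :
    s'.pc j = .waitMsg := by
  rcases h.sim_cases with ⟨-, -, -, -, h⟩ | ⟨a, v, -, rfl⟩ | ⟨a, m, st, -, hst, rfl⟩
  · simp [h] at hj
  · by_cases ha : j = a
    · subst ha; simp [SimState.obtain, SimState.advance, SimState.goto]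
    · simp [SimState.obtain, SimState.advance, SimState.goto, ha] at hj
  · by_cases ha : j = a
    · subst ha; simp [SimState.obtain, SimState.advance, SimState.goto, hst]
    · simp [SimState.obtain, SimState.advance, SimState.goto, ha, hst] at hj

/-- The simulator state `s` agrees with the simulated histories. -/
structure Matches (A : Algorithm n' In Out M S) (e : SimTrace n n' In Out M S)
    (s : SimState n n' In Out M S) (j : Fin n') : Prop where
  state : s.state j = (simulated A e j (s.sn j)).state
  received : s.received j = (simulated A e j (s.sn j)).received
  decided : s.decided j = (simulated A e j (s.sn j)).decided
  sent : ∀ x, (s.sent x).filter (fun a => decide (a.1 = j)) =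
    ((simulated A e j (s.sn j)).outs x).mapIdx fun k m => (j, k, m)

/-- All added messages carry the same sender, so the filter keeps all of them or none. -/
theorem filter_mapIdx_tag {l : List (SimMsg n' M)} {ms : List M} {a : Fin n'} {c : ℕ} :
    (l ++ ms.mapIdx fun k m => (j, c + k, m)).filter (fun b => decide (b.1 = a)) =
      l.filter (fun b => decide (b.1 = a)) ++
        if a = j then ms.mapIdx fun k m => (j, c + k, m) else [] := by
  rw [List.filter_append]
  congr 1
  split_ifs with h
  · rw [List.filter_eq_self]
    intro b hb
    obtain ⟨k, hk, rfl⟩ := List.mem_mapIdx.1 hb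
    simp [h]
  · rw [List.filter_eq_nil_iff]
    intro b hb
    obtain ⟨k, hk, rfl⟩ := List.mem_mapIdx.1 hb
    simpa using fun h' => h h'.symm

/-- Stated for arbitrary `inp'` and `rec` so that it serves both the transition on the input and
those on messages. -/
theorem Matches.advance {a : Fin n'} (h : ∀ j, Matches A e s j) {r : S × (Fin n' → List M)}
    {rec : List (SimMsg n' M)} {inp' : Fin n' → In}
    (hn : simulated A e j (s.sn j + 1) = (simulated A e j (s.sn j)).next A j r rec) :
    Matches A e ({ s with
      input := inp'
      received := Function.update s.received j rec }.advance A j r) a := by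
  by_cases ha : a = j
  · subst ha
    refine ⟨?_, ?_, ?_, fun x => ?_⟩
    · simp [SimState.advance, hn, History.next]
    · simp [SimState.advance, hn, History.next, SimState.goto]
    · simp [SimState.advance, hn, History.next, (h a).decided]
    · simp only [SimState.advance, Function.update_self, hn, History.next]
      -- The `countP` offset is the number of messages already sent by this process to `x`, so the
      -- new ranks continue the old numbering.
      rw [filter_mapIdx_tag, if_pos rfl, (h a).sent x, List.countP_eq_length_filter, (h a).sent x,
        List.mapIdx_append]
      simp only [List.length_mapIdx, Nat.add_comm]
  · refine ⟨?_, ?_, ?_, fun x => ?_⟩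
    · simpa [SimState.advance, ha, SimState.goto] using (h a).state
    · simpa [SimState.advance, ha, SimState.goto] using (h a).received
    · simpa [SimState.advance, ha, SimState.goto] using (h a).decided
    · simp only [SimState.advance, ne_eq, ha, not_false_eq_true, Function.update_of_ne]
      rw [filter_mapIdx_tag, if_neg ha, (h a).sent x, List.append_nil]

/-- What a simulator stores about a process depends only on how many of its transitions it has
performed: each of them is driven by the agreed value of the corresponding object. The agreement of
all simulators on received messages follows. -/
theorem matches_simulated (he : IsExecution (simulation n A) inp t e)
    (hs : (e.cfg τ).loc i = some s) (j : Fin n') : Matches A e s j := by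
  induction τ generalizing s j with
  | zero => simp [he.init, Config.initial] at hs
  | succ τ ih =>
    rcases loc_step he τ i with h | ⟨-, h⟩ | ⟨a, b, out, h3, h4, h5, -⟩
    · exact ih (h ▸ hs) j
    · obtain rfl : SimState.initial (inp i) = s := by simpa [h] using hs
      constructor <;> simp [SimState.initial, simulated, history]
    · obtain rfl : b = s := by simpa [h4] using hs
      have ih := fun j => ih h3 j
      rcases h5.sim_cases with ⟨h6, h7, h8, h9, h10⟩ | ⟨j', v, hr, rfl⟩ | ⟨j', m, st, hr, hst, rfl⟩
      · obtain ⟨i1, i2, i3, i4⟩ := ih j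
        constructor
        · rw [h6, h10, i1]
        · rw [h7, h10, i2]
        · rw [h8, h10, i3]
        · rw [h9, h10]; exact i4
      · have hd := agreed_eq he h3 hr
        have := Matches.advance (a := j) (inp' := Function.update a.input j' v) ih
          (history_succ_input (A := A) (j := j') (d := fun l => agreed e (j', l)) hd)
        have h2 := (ih j').received
        simp only [simulated] at h2
        rw [← h2, Function.update_eq_self] at this
        exact this
      · have hd := agreed_eq he h3 hr
        have h1 := (ih j').state
        rw [hst] at h1
        have := Matches.advance (a := j) (inp' := a.input) ih
          (history_succ_msg (A := A) (j := j') (d := fun l => agreed e (j', l)) hd h1.symm)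
        have h2 := (ih j').received
        simp only [simulated] at h2
        rw [← h2] at this
        simp only [SimState.obtain, hst]
        exact this

/-- Simulators may interleave different senders differently in `sent`; since a message carries its
sender and rank, membership is decided by the history of the sender alone. -/
theorem mem_sent_iff (he : IsExecution (simulation n A) inp t e)
    (hs : (e.cfg τ).loc i = some s) {m : SimMsg n' M} :
    m ∈ s.sent j ↔ ((simulated A e m.1 (s.sn m.1)).outs j)[m.2.1]? = some m.2.2 := by
  have h := (matches_simulated he hs m.1).sent j
  have h1 : m ∈ s.sent j ↔ m ∈ (s.sent j).filter (fun a => decide (a.1 = m.1)) := by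
    simp
  rw [h1, h, List.mem_mapIdx]
  constructor
  · rintro ⟨k, hk, h2⟩
    rw [← h2]; simp [hk]
  · intro h2
    obtain ⟨hk, h2⟩ := List.getElem?_eq_some_iff.1 h2
    exact ⟨m.2.1, hk, by rw [h2]⟩

theorem count_mono (he : IsExecution (simulation n A) inp t e) (h : τ ≤ τ') (j : Fin n') :
    count e τ j ≤ count e τ' j := by
  refine count_le_iff.2 fun i s hs => ?_
  obtain ⟨s', hs', hl⟩ := later_of_le he h hs
  exact ((hl.prog j).sn_le).trans (sn_le_count hs' j)

theorem count_zero (he : IsExecution (simulation n A) inp t e) (j : Fin n') : count e 0 j = 0 := by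
  refine Nat.le_zero.1 (count_le_iff.2 fun i s hs => ?_)
  simp [he.init, Config.initial] at hs

/-- At each time at most one new transition is simulated. -/
theorem count_succ_cases (he : IsExecution (simulation n A) inp t e) (τ : ℕ) :
    (count e (τ + 1) = count e τ) ∨
    ∃ j i s v, (e.cfg τ).loc i = some s ∧ s.sn j = count e τ j ∧
      (s.sa (j, count e τ j)).result = some v ∧
      count e (τ + 1) = Function.update (count e τ) j (count e τ j + 1) := by
  by_cases hc : count e (τ + 1) = count e τ
  · exact .inl hc
  right
  obtain ⟨j, hj⟩ := Function.ne_iff.1 hc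
  have hlt : count e τ j < count e (τ + 1) j :=
    lt_of_le_of_ne (count_mono he (Nat.le_succ τ) j) (Ne.symm hj)
  obtain ⟨i, s', hs', hi⟩ := exists_of_lt_count hlt
  rcases (he.step τ).loc_cases i with h | ⟨ev, s₁, out, hlab, h1, h2, -⟩
  · exact absurd (sn_le_count (h ▸ hs') j) (not_le.2 hi)
  obtain rfl : s₁ = s' := by simpa [h2] using hs'
  rcases effect_cases h1 with ⟨-, rfl, -⟩ | ⟨s, hs, hl⟩
  · simp [SimState.initial] at hi
  have hle := sn_le_count hs
  -- Only the simulator that raised the maximum took a step, so the contributions of the others are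
  -- unchanged.
  have hother : ∀ i', i' ≠ i → (e.cfg (τ + 1)).loc i' = (e.cfg τ).loc i' := by
    intro i' hi'
    rcases (he.step τ).loc_cases i' with h | ⟨ev', _, _, hlab', -⟩
    · exact h
    · rw [hlab] at hlab'
      exact absurd (congrArg Prod.fst (Option.some.inj hlab')).symm hi'
  have hsn1 := hl.sn_le_succ j
  have hsn : s.sn j = count e τ j := by have := hle j; omega
  have hfin : ∀ r, (s.sa (j, s.sn j)).result = some r → (∀ a, a ≠ j → s₁.sn a = s.sn a) →
      ∃ j i s v, (e.cfg τ).loc i = some s ∧ s.sn j = count e τ j ∧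
      (s.sa (j, count e τ j)).result = some v ∧
      count e (τ + 1) = Function.update (count e τ) j (count e τ j + 1) := by
    intro r hr hoth
    refine ⟨j, i, s, r, hs, hsn, hsn ▸ hr, ?_⟩
    funext a
    by_cases ha : a = j
    · subst ha
      rw [Function.update_self]
      refine le_antisymm (count_le_iff.2 fun i' s' hs'' => ?_) hlt
      by_cases hi' : i' = i
      · subst hi'
        obtain rfl : s' = s₁ := by simpa [h2] using hs''.symm
        omega
      · rw [hother i' hi'] at hs''
        exact (sn_le_count hs'' a).trans (Nat.le_succ _)
    · rw [Function.update_of_ne ha]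
      refine le_antisymm (count_le_iff.2 fun i' s' hs'' => ?_) (count_mono he (Nat.le_succ τ) a)
      by_cases hi' : i' = i
      · subst hi'
        obtain rfl : s' = s₁ := by simpa [h2] using hs''.symm
        rw [hoth a ha]; exact hle a
      · rw [hother i' hi'] at hs''
        exact sn_le_count hs'' a
  rcases hl.sim_cases with ⟨-, -, -, -, h⟩ | ⟨b, v, hr, rfl⟩ | ⟨b, m, st, hr, hst, rfl⟩
  · rw [h] at hi; omega
  · have hb : b = j := by
      by_contra hb
      simp [SimState.obtain, SimState.advance, SimState.goto, Ne.symm hb] at hi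
      omega
    subst hb
    exact hfin _ hr fun a ha => by simp [SimState.obtain, SimState.advance, SimState.goto, ha]
  · have hb : b = j := by
      by_contra hb
      simp [SimState.obtain, SimState.advance, SimState.goto, Ne.symm hb, hst] at hi
      omega
    subst hb
    exact hfin _ hr fun a ha => by simp [SimState.obtain, SimState.advance, SimState.goto, ha, hst]

end Simulated

/-! ### Blocked processes, and progress of the simulation -/

section Progress

open Filter

variable {n n' t : ℕ} {In Out M S : Type*} {e : SimTrace n n' In Out M S} {i : Fin n}
  {s : SimState n n' In Out M S} {j : Fin n'}

theorem SimState.oldest_ne_none {m : SimMsg n' M} (h1 : m ∈ s.sent j) (h2 : m ∉ s.received j) :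
    s.oldest j ≠ none := by
  intro h
  rw [SimState.oldest, List.find?_eq_none] at h
  exact h m h1 (by simpa using h2)

theorem not_blocked (hb : ¬ Blocked e i j) (τ₀ : ℕ) :
    ∃ τ ≥ τ₀, ∃ s, (e.cfg τ).loc i = some s ∧ s.pc j = .waitMsg := by
  simp only [Blocked, not_exists, not_forall] at hb
  obtain ⟨τ, hτ, s, hs, h⟩ := hb τ₀
  refine ⟨τ, hτ, s, hs, ?_⟩
  cases hpc : s.pc j <;> simp_all

variable [LinearOrder (SAVal n' In M)]
  {A : Algorithm n' In Out M S} {inp : Fin n → Fin n' → In}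
  {τ τ' : ℕ} {s' : SimState n n' In Out M S} {o : Fin n' × ℕ} {k : ℕ}
  {x : Fin n} {v : SAVal n' In M}

theorem exists_correct (he : IsExecution (simulation n A) inp t e) (htn : 2 * t < n) :
    ∃ i, e.Correct i := by
  by_contra! h
  have h1 := he.resilient
  have h2 : {p | ¬ e.Correct p} = Set.univ := by ext p; simp [h p]
  rw [h2, Set.ncard_univ, Nat.card_fin] at h1
  omega

/-- The agreed values: an input of a simulator, then messages that were sent and not yet
received. -/
theorem result_valid (he : IsExecution (simulation n A) inp t e) (hs : (e.cfg τ).loc i = some s)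
    (hr : (s.sa (j, k)).result = some v) :
    (k = 0 ∧ ∃ x, v = .input (inp x j)) ∨ (0 < k ∧ ∃ m, v = .msg m ∧
      m ∉ (simulated A e j k).received ∧
      ((simulated A e m.1 (count e τ m.1)).outs j)[m.2.1]? = some m.2.2) := by
  obtain ⟨x, hx⟩ := proposed_of_result he hs hr
  rcases hx.valid he with ⟨h1, h2⟩ | ⟨h1, m, h2, u, hu, s', hs', hsn, hold⟩
  · exact .inl ⟨h1, x, h2⟩
  · obtain ⟨h3, h4⟩ := SimState.mem_of_oldest hold
    refine .inr ⟨h1, m, h2, ?_, ?_⟩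
    · rw [(matches_simulated he hs' j).received, hsn] at h4
      exact h4
    · refine getElem?_of_prefix (history_outs_prefix ?_ j) ((mem_sent_iff he hs').1 h3)
      exact (sn_le_count hs' _).trans (count_mono he hu.le _)

/-- Each transition simulated by some simulator is simulated by all correct simulators. -/
theorem complete_sn (he : IsExecution (simulation n A) inp t e) (htn : 2 * t < n)
    (hi : e.Correct i) (τ : ℕ) (j : Fin n') :
    ∃ u s, (e.cfg u).loc i = some s ∧ count e τ j ≤ s.sn j := by
  induction τ generalizing j with
  | zero =>
    obtain ⟨u, s, hs⟩ := (exists_loc he hi).exists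
    exact ⟨u, s, hs, by simp [count_zero he]⟩
  | succ τ ih =>
    rcases count_succ_cases he τ with h | ⟨a, i₀, s₀, v, hs₀, -, hr, h⟩
    · rw [h]; exact ih j
    rw [h]
    by_cases hja : j = a
    swap
    · rw [Function.update_of_ne hja]; exact ih j
    subst hja
    rw [Function.update_self]
    obtain ⟨u, s, hs, hle⟩ := ih j
    rcases hle.lt_or_eq with hlt | heq
    · exact ⟨u, s, hs, hlt⟩
    -- The value of this object was returned somewhere, so a closed set exists; once the thread
    -- cannot idle for want of a message, it reaches `decide`, which must return.
    have hdec : ∀ {u s}, (e.cfg u).loc i = some s → s.sn j = count e τ j →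
        (∀ u' ≥ u, ∀ s', (e.cfg u').loc i = some s' → s'.sn j = s.sn j → s'.pc j = .waitMsg →
          s'.oldest j ≠ none) →
        ∃ u s, (e.cfg u).loc i = some s ∧ count e τ j + 1 ≤ s.sn j := by
      intro u s hs hsn hold
      obtain ⟨u₁, -, s₁, hs₁, h1 | ⟨h1, h2⟩⟩ := reaches_deciding he htn hi hs hold
      · exact ⟨u₁, s₁, hs₁, by omega⟩
      · obtain ⟨σ, hσ⟩ := SAState.closed_of_result hr
        rw [← hsn, h1] at hσ
        obtain ⟨u₂, -, s₂, hs₂, h3⟩ := decide_terminates he hi hs₁ h2 hs₀ hσ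
        exact ⟨u₂, s₂, hs₂, by omega⟩
    rcases result_valid he hs₀ hr with ⟨h0, -⟩ | ⟨h0, m, rfl, hm1, hm2⟩
    · refine hdec hs heq.symm fun u' _ s' hs' hsn hpc => ?_
      have := (threadInv he hs' j).waitMsg hpc
      omega
    -- By induction simulator `i` has caught up with the sender of `m`, so `m` is in its `sent` list
    -- and not yet received: its thread always has something to propose.
    · obtain ⟨u₁, s₁, hs₁, hle₁⟩ := ih m.1
      obtain ⟨s₂, hs₂, hl₂⟩ := later_of_le he (le_max_left u u₁) hs
      have hl₁ := later_of_le' he (le_max_right u u₁) hs₁ hs₂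
      rcases (hl₂.prog j).sn_le.lt_or_eq with h1 | h1
      · exact ⟨_, s₂, hs₂, by omega⟩
      refine hdec hs₂ (by omega) fun u' hu' s' hs' hsn hpc => ?_
      refine SimState.oldest_ne_none (m := m) ?_ ?_
      · refine (mem_sent_iff he hs').2 (getElem?_of_prefix (history_outs_prefix ?_ j) hm2)
        exact hle₁.trans ((hl₁.prog _).sn_le.trans ((later_of_le' he hu' hs₂ hs').prog _).sn_le)
      · rw [(matches_simulated he hs' j).received, hsn, ← h1, ← heq]
        exact hm1

/-- A thread that terminates an access to a safe agreement object goes through `waitMsg`. -/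
theorem exists_waitMsg (he : IsExecution (simulation n A) inp t e) (h : τ ≤ τ')
    (hs : (e.cfg τ).loc i = some s) (hs' : (e.cfg τ').loc i = some s') (hsn : s.sn j < s'.sn j) :
    ∃ u ≥ τ, ∃ s₁, (e.cfg u).loc i = some s₁ ∧ s₁.pc j = .waitMsg := by
  induction h generalizing s' with
  | refl =>
    obtain rfl : s = s' := by simpa [hs] using hs'
    omega
  | @step u hle ih =>
    have hle' : τ ≤ u := hle
    obtain ⟨s₁, hs₁, -⟩ := later_of_le he hle' hs
    by_cases h1 : s.sn j < s₁.sn j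
    · exact ih hs₁ h1
    rcases loc_step he u i with h | ⟨h, -⟩ | ⟨a, b, out, h3, h4, h5, -⟩
    · rw [h] at hs'
      exact ih hs' hsn
    · simp [h] at hs₁
    · obtain rfl : a = s₁ := by simpa [h3] using hs₁
      obtain rfl : b = s' := by simpa [h4] using hs'
      exact ⟨u + 1, by omega, b, h4, h5.waitMsg_of_sn_lt (by omega)⟩

/-- At a correct simulator, the thread of a blocked process stays in the same access. -/
theorem Blocked.stuck (he : IsExecution (simulation n A) inp t e) (hi : e.Correct i)
    (hb : Blocked e i j) : ∃ T s, (e.cfg T).loc i = some s ∧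
      ∀ u ≥ T, ∀ s', (e.cfg u).loc i = some s' → s'.pc j ≠ .waitMsg ∧ s'.sn j = s.sn j := by
  obtain ⟨τ₀, h⟩ := hb
  have hpc : ∀ τ ≥ τ₀, ∀ s, (e.cfg τ).loc i = some s → s.pc j ≠ .waitMsg := by
    intro τ hτ s hs h'
    have := h τ hτ s hs
    simp [h'] at this
  obtain ⟨T, hT, s, hs⟩ := ((eventually_ge_atTop τ₀).and (exists_loc he hi)).exists
  refine ⟨T, s, hs, fun u hu s' hs' => ⟨hpc u (hT.trans hu) s' hs', ?_⟩⟩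
  by_contra hne
  have hle := ((later_of_le' he hu hs hs').prog j).sn_le
  obtain ⟨u₁, hu₁, s₁, hs₁, h1⟩ := exists_waitMsg (j := j) he hu hs hs' (by omega)
  exact hpc u₁ (hT.trans hu₁) s₁ hs₁ h1

theorem loc_of_crashed (he : IsExecution (simulation n A) inp t e) (h : τ ≤ τ')
    (hx : x ∈ (e.cfg τ).crashed) : (e.cfg τ').loc x = (e.cfg τ).loc x := by
  induction h with
  | refl => rfl
  | @step u hle ih =>
    exact ((he.step u).loc_of_crashed (he.crashed_mono (show τ ≤ u from hle) hx)).trans ih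

/-- When `x` crashed, its thread `j` was the owner of the lock. -/
def CrashedIn (e : SimTrace n n' In Out M S) (x : Fin n) (j : Fin n') : Prop :=
  ∃ τ s, x ∈ (e.cfg τ).crashed ∧ (e.cfg τ).loc x = some s ∧ s.queue.head? = some j

/-- The local state no longer changes after the crash, and a queue has only one head. -/
theorem CrashedIn.unique (he : IsExecution (simulation n A) inp t e) {j' : Fin n'}
    (h : CrashedIn e x j) (h' : CrashedIn e x j') : j = j' := by
  obtain ⟨τ, s, h1, h2, h3⟩ := h
  obtain ⟨τ', s', h1', h2', h3'⟩ := h'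
  have e1 := loc_of_crashed he (le_max_left τ τ') h1
  have e2 := loc_of_crashed he (le_max_right τ τ') h1'
  rw [e1, h2, h2'] at e2
  obtain rfl := Option.some.inj e2
  simpa [h3] using h3'

/-- A simulator that proposes a value, and does not crash in `propose`, broadcasts its view. -/
theorem Proposed.viewed (he : IsExecution (simulation n A) inp t e) (htn : 2 * t < n)
    (h : Proposed e o x v τ) (hx : ¬ CrashedIn e x o.1) :
    ∃ u s, (e.cfg u).loc x = some s ∧ Viewed s o := by
  obtain ⟨u, -, s, hs, h1, h2, h3⟩ := h
  by_cases hc : e.Correct x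
  · obtain ⟨u', -, s', hs', h4⟩ := propose_terminates he htn hc hs (List.mem_of_head? h3)
    refine ⟨u', s', hs', ?_⟩
    rcases h4 with h4 | ⟨h4, h5⟩
    · exact .inl (h1 ▸ h4)
    · exact .inr ⟨h1 ▸ h4, by simp [h5, PC.rank]⟩
  · obtain ⟨τc, hτc⟩ : ∃ τ, x ∈ (e.cfg τ).crashed := by simpa [Trace.Correct] using hc
    have hle := le_max_left u τc
    have hcr := he.crashed_mono (le_max_right u τc) hτc
    generalize max u τc = T at hle hcr
    obtain ⟨s', hs', hl⟩ := later_of_le he hle hs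
    refine ⟨T, s', hs', ?_⟩
    by_contra hv
    have hv' : ¬ (o.2 < s'.sn o.1) ∧ ¬ (o.2 = s'.sn o.1 ∧ 4 + n ≤ (s'.pc o.1).rank) :=
      not_or.1 hv
    refine hx ⟨T, s', hcr, hs', ?_⟩
    rcases hl.prog o.1 with h4 | ⟨h4, h5⟩
    · omega
    have hr : (s'.pc o.1).rank < 4 + n := by
      by_contra hr; exact hv'.2 ⟨by omega, by omega⟩
    -- If the program counter is still `lock`, it never changed in between, so the head of the queue
    -- was preserved. Otherwise the thread is inside `propose` and is the head by `QueueInv`.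
    rcases h5 with h5 | h5
    · have hsame : ∀ u', u ≤ u' → u' ≤ T → ∀ s₁, (e.cfg u').loc x = some s₁ →
          s₁.pc o.1 = s.pc o.1 ∧ s₁.sn o.1 = s.sn o.1 := by
        intro u' hu1 hu2 s₁ hs₁
        have p1 := (later_of_le' he hu1 hs hs₁).prog o.1
        have p2 := (later_of_le' he hu2 hs₁ hs').prog o.1
        have hsn : s₁.sn o.1 = s.sn o.1 := by have := p1.sn_le; have := p2.sn_le; omega
        refine ⟨?_, hsn⟩
        rcases p1 with p1 | ⟨-, p1 | p1⟩
        · omega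
        · exact p1
        · rcases p2 with p2 | ⟨-, p2 | p2⟩
          · omega
          · rw [← p2, h5]
          · rw [h5] at p2; omega
      obtain ⟨l, hl'⟩ := queue_grows he hs h3 hle hsame hs'
      simp [hl', List.head?_append, h3]
    · refine (queueInv he hs').head o.1 ?_ hr.le
      have h6 : (s.pc o.1).rank = 1 := by rw [h2]; rfl
      omega

/-- A process whose simulation is blocked at a correct simulator is blocked by a simulator that
crashed in `propose`. -/
theorem Blocked.crashedIn (he : IsExecution (simulation n A) inp t e) (htn : 2 * t < n)
    (hi : e.Correct i) (hb : Blocked e i j) : ∃ x, CrashedIn e x j := by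
  by_contra! hno
  obtain ⟨T, s, hs, hstuck⟩ := hb.stuck he hi
  obtain ⟨u, hu, s₁, hs₁, h1⟩ := reaches_deciding (j := j) he htn hi hs
    (fun u' hu' s' hs' _ hpc => absurd hpc (hstuck u' hu' s' hs').1)
  have hsn := (hstuck u hu s₁ hs₁).2
  have hpc : s₁.pc j = .deciding := by
    rcases h1 with h1 | h1
    · omega
    · exact h1.2
  suffices H : ∃ u s' σ, (e.cfg u).loc i = some s' ∧ (s'.sa (j, s₁.sn j)).Closed σ by
    obtain ⟨u₂, s₂, σ, hs₂, hσ⟩ := H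
    obtain ⟨u₃, hu₃, s₃, hs₃, h3⟩ := decide_terminates he hi hs₁ hpc hs₂ hσ
    have := (hstuck u₃ (by omega) s₃ hs₃).2
    omega
  generalize hk : s₁.sn j = k
  -- All simulators whose value for this object ever reaches `i`: this set turns out to be closed.
  let σ : Finset (Fin n) := Finset.univ.filter fun x =>
    ∃ u s q v, (e.cfg u).loc i = some s ∧ (q, .value x v) ∈ (s.sa (j, k)).log
  have hσ : ∀ {z}, z ∈ σ ↔
      ∃ u s q v, (e.cfg u).loc i = some s ∧ (q, .value z v) ∈ (s.sa (j, k)).log := by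
    intro z; simp [σ]
  have hne : i ∈ σ := by
    obtain ⟨v, hv⟩ := (threadInv he hs₁ j).passed k
      (.inr ⟨hk.symm, by simp [hpc, PC.rank]; omega⟩)
    obtain ⟨q, hq⟩ := hv.exists_mem
    exact hσ.2 ⟨u, s₁, q, v, hs₁, hq⟩
  have key : ∀ᶠ u in atTop, ∀ y, y ∈ σ → ∀ s', (e.cfg u).loc i = some s' →
      (s'.sa (j, k)).values y ≠ none ∧
      ∃ w, (s'.sa (j, k)).allViews y = some w ∧ ∀ z, w z ≠ none → z ∈ σ := by
    refine eventually_all.2 fun y => ?_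
    by_cases hy : y ∈ σ
    swap
    · simp [hy]
    -- A member proposed a value and did not crash as owner of the lock for this process, so it
    -- broadcast its view to all, including `i`.
    obtain ⟨u₂, s₂, q, v, hs₂, hq⟩ := hσ.1 hy
    obtain ⟨u₃, s₃, hs₃, h3⟩ := (proposed_of_log he hs₂ hq).viewed he htn (hno y)
    obtain ⟨w, hw⟩ := broadcast_view he hs₃ h3
    filter_upwards [eventually_log he hi (hw i), spread_value he hs₂ hq hi hi]
      with u₄ h4 h5 _ s₄ hs₄
    refine ⟨(saInv he hs₄ _).values_ne _ _ _ (h5 s₄ hs₄), ?_⟩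
    obtain ⟨w', hw'⟩ :=
      Option.ne_none_iff_exists'.1 ((saInv he hs₄ _).views_ne _ _ _ (h4 s₄ hs₄))
    obtain ⟨u₅, -, s₅, l, hs₅, hsn₅, hl, hpc₅⟩ := proposedView_of_views he hs₄ hw'
    refine ⟨w', hw', fun z hz => ?_⟩
    -- Every value in the view of `y` was received, hence forwarded to `i`, by `y` itself; so its
    -- proposer is in `σ`.
    obtain ⟨v', hv'⟩ := Option.ne_none_iff_exists'.1 hz
    have hm := ((threadInv he hs₅ j).reading l w' hpc₅ z (by omega)).1 v' hv'
    obtain ⟨q', hq'⟩ := hm.exists_mem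
    simp only at hsn₅
    rw [hsn₅] at hq'
    obtain ⟨u₆, s₆, hs₆, h6⟩ := exists_log he hi (forwarded_value he hs₅ hq' i)
    exact hσ.2 ⟨u₆, s₆, y, v', hs₆, h6⟩
  obtain ⟨u₂, h2, s₂, hs₂⟩ := (key.and (exists_loc he hi)).exists
  exact ⟨u₂, s₂, σ, hs₂, ⟨i, hne⟩, fun y hy => h2 y hy s₂ hs₂⟩

/-- Only finitely many transitions of a blocked process are simulated. -/
theorem Blocked.count_bounded (he : IsExecution (simulation n A) inp t e) (htn : 2 * t < n)
    (hi : e.Correct i) (hb : Blocked e i j) : ∃ b, ∀ τ, count e τ j ≤ b := by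
  obtain ⟨T, s, hs, hstuck⟩ := hb.stuck he hi
  refine ⟨s.sn j, fun τ => ?_⟩
  obtain ⟨u, s₁, hs₁, h1⟩ := complete_sn he htn hi τ j
  obtain ⟨s₂, hs₂, hl⟩ := later_of_le he (le_max_left u T) hs₁
  have h2 := (hstuck _ (le_max_right u T) s₂ hs₂).2
  have := (hl.prog j).sn_le
  omega

/-- Each message sent to a process that is not blocked is eventually received by it. -/
theorem eventually_received (he : IsExecution (simulation n A) inp t e) (htn : 2 * t < n)
    (hj : ∀ i, e.Correct i → ¬ Blocked e i j) {m : SimMsg n' M}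
    (hm : ((simulated A e m.1 (count e τ m.1)).outs j)[m.2.1]? = some m.2.2) :
    ∃ u, m ∈ (simulated A e j (count e u j)).received := by
  by_contra! hno
  have hrec : ∀ {u i s}, (e.cfg u).loc i = some s → m ∉ s.received j := by
    intro u i s hs h
    rw [(matches_simulated he hs j).received] at h
    exact hno u ((history_received_prefix (sn_le_count hs j)).subset h)
  -- From some time `T` on, every faulty simulator has crashed and every correct one has `m` in its
  -- `sent` list.
  have hT : ∀ᶠ T in atTop, ∀ z, (e.Correct z ∧ ∃ s, (e.cfg T).loc z = some s ∧ m ∈ s.sent j) ∨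
      z ∈ (e.cfg T).crashed := by
    refine eventually_all.2 fun z => ?_
    by_cases hz : e.Correct z
    · obtain ⟨u, s, hs, hsn⟩ := complete_sn he htn hz τ m.1
      filter_upwards [eventually_ge_atTop u] with T hT
      obtain ⟨s', hs', hl⟩ := later_of_le he hT hs
      refine .inl ⟨hz, s', hs', (mem_sent_iff he hs').2 ?_⟩
      exact getElem?_of_prefix (history_outs_prefix (hsn.trans (hl.prog _).sn_le) j) hm
    · obtain ⟨u, hu⟩ : ∃ τ, z ∈ (e.cfg τ).crashed := by simpa [Trace.Correct] using hz
      filter_upwards [eventually_ge_atTop u] with T hT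
      exact .inr (he.crashed_mono hT hu)
  obtain ⟨T, hT⟩ := hT.exists
  obtain ⟨i, hi⟩ := exists_correct he htn
  obtain ⟨s₀, hs₀, hm₀⟩ : ∃ s, (e.cfg T).loc i = some s ∧ m ∈ s.sent j := by
    rcases hT i with h | h
    · exact h.2
    · exact absurd h (hi T)
  -- Since `m` remains pending at `i`, the thread never lacks a message; not being blocked, it
  -- performs unboundedly many transitions.
  have hprog : ∀ k, ∃ u ≥ T, ∃ s, (e.cfg u).loc i = some s ∧ k ≤ s.sn j := by
    intro k
    induction k with
    | zero => exact ⟨T, le_rfl, s₀, hs₀, Nat.zero_le _⟩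
    | succ k ih =>
      obtain ⟨u, hu, s, hs, hk⟩ := ih
      obtain ⟨u₁, hu₁, s₁, hs₁, h1⟩ := reaches_deciding (j := j) he htn hi hs
        (fun u' hu' s' hs' _ _ => SimState.oldest_ne_none
          (((later_of_le' he (hu.le.trans hu') hs₀ hs').sent j).subset hm₀) (hrec hs'))
      rcases h1 with h1 | ⟨h1, h2⟩
      · exact ⟨u₁, hu.le.trans hu₁, s₁, hs₁, by omega⟩
      · obtain ⟨u₂, hu₂, s₂, hs₂, h3⟩ := not_blocked (hj i hi) u₁
        refine ⟨u₂, hu.le.trans (hu₁.le.trans hu₂), s₂, hs₂, ?_⟩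
        rcases (later_of_le' he hu₂ hs₁ hs₂).prog j with h4 | ⟨-, h4 | h4⟩
        · omega
        · rw [h3, h2] at h4; cases h4
        · simp [h3, PC.rank] at h4
  -- The strict inequality `count e T j < k` ensures that the `k`-th agreed message was proposed
  -- after time `T`, hence by a correct simulator.
  have hmsg : ∀ k, ∃ a : SimMsg n' M, count e T j < k →
      (∃ z s, (e.cfg T).loc z = some s ∧ a ∈ s.sent j) ∧
      a ∉ (simulated A e j k).received ∧ a ∈ (simulated A e j (k + 1)).received := by
    intro k
    by_cases hk : count e T j < k
    swap
    · exact ⟨m, fun h => absurd h hk⟩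
    obtain ⟨u, -, s, hs, hsn⟩ := hprog (k + 1)
    have hex : ∃ u, k < count e u j := ⟨u, hsn.trans (sn_le_count hs j)⟩
    obtain ⟨u, hu⟩ : ∃ u, Nat.find hex = u + 1 := by
      refine Nat.exists_eq_succ_of_ne_zero fun h => ?_
      have := Nat.find_spec hex
      rw [h, count_zero he] at this
      omega
    have h1 := Nat.find_spec hex
    rw [hu] at h1
    have h2 : count e u j ≤ k := not_lt.1 (Nat.find_min hex (by omega))
    rcases count_succ_cases he u with h | ⟨a, i₁, s₁, v, hs₁, hsn₁, hr, h⟩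
    · rw [h] at h1; omega
    obtain rfl : a = j := by
      by_contra hne
      rw [h, Function.update_of_ne (Ne.symm hne)] at h1
      omega
    rw [h, Function.update_self] at h1
    obtain rfl : k = count e u a := by omega
    obtain ⟨z, hz⟩ := proposed_of_result he hs₁ hr
    rcases hz.valid he with ⟨h0, -⟩ | ⟨h0, m', rfl, u', hu', s', hs', hsn', hold⟩
    · simp only at h0; omega
    simp only at hsn' hold
    refine ⟨m', fun _ => ⟨?_, ?_, ?_⟩⟩
    · have hTu : T ≤ u' := by
        by_contra hlt
        have := (sn_le_count hs' a).trans (count_mono he (by omega : u' ≤ T) a)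
        omega
      rcases hT z with ⟨-, s₂, hs₂, hm₂⟩ | hcr
      · refine ⟨z, s₂, hs₂, ?_⟩
        -- Combine the `sent` list at time `T` with the `received` list at the time of the proposal.
        -- As `m` is pending, the oldest pending message lies in that fixed list, and the extension
        -- of `sent` does not change it.
        have hm' : m ∉ s'.received a := hrec hs'
        have hne := SimState.oldest_ne_none (s := { s₂ with received := s'.received }) hm₂ hm'
        obtain ⟨m₂, hm₂⟩ := Option.ne_none_iff_exists'.1 hne
        have h3 := SimState.oldest_of_prefix { s₂ with received := s'.received }
          (s' := s') ((later_of_le' he hTu hs₂ hs').sent a) rfl hm₂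
        obtain rfl : m₂ = m' := by simpa [hold] using h3.symm
        exact (SimState.mem_of_oldest hm₂).1
      · rw [loc_of_crashed he hTu hcr] at hs'
        have := sn_le_count hs' a
        omega
    · have := (SimState.mem_of_oldest hold).2
      rwa [(matches_simulated he hs' a).received, hsn'] at this
    · have hst : (simulated A e a (count e u a)).state ≠ none := by
        rw [← hsn₁, ← (matches_simulated he hs₁ a).state]
        intro h
        have := (threadInv he hs₁ a).state.2 h
        omega
      obtain ⟨st, hst⟩ := Option.ne_none_iff_exists'.1 hst
      rw [simulated, history_succ_msg (d := fun l => agreed e (a, l)) (agreed_eq he hs₁ hr) hst]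
      simp [History.next]
  -- These messages are distinct, each being received only after its own step, yet all lie in the
  -- finitely many lists of time `T`: a contradiction.
  choose g hg using hmsg
  have hinj : Function.Injective fun k => g (count e T j + 1 + k) := by
    intro k k' hkk'
    simp only at hkk'
    by_contra hne
    have aux : ∀ {a b}, count e T j < a → a < b → g a ≠ g b := by
      intro a b ha hab h
      have h1 := (hg a ha).2.2
      have h2 := (hg b (by omega)).2.1
      rw [h] at h1
      exact h2 ((history_received_prefix (show a + 1 ≤ b from hab)).subset h1)
    rcases lt_or_gt_of_ne hne with h | h
    · exact aux (by omega) (by omega) hkk'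
    · exact aux (by omega) (by omega) hkk'.symm
  have hfin : (⋃ z : Fin n, {a : SimMsg n' M | ∃ s, (e.cfg T).loc z = some s ∧
      a ∈ s.sent j}).Finite := by
    refine Set.finite_iUnion fun z => ?_
    cases hz : (e.cfg T).loc z with
    | none => simp
    | some s =>
      have : {a : SimMsg n' M | ∃ s', some s = some s' ∧ a ∈ s'.sent j} = {a | a ∈ s.sent j} := by
        ext a; simp
      rw [this]
      exact List.finite_toSet _
  refine Set.infinite_of_injective_forall_mem hinj (fun k => ?_) hfin
  obtain ⟨z, s, hs, ha⟩ := (hg (count e T j + 1 + k) (by omega)).1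
  exact Set.mem_iUnion.2 ⟨z, s, hs, ha⟩

end Progress

/-! ### The simulated execution -/

section Execution

variable {n n' t : ℕ} {In Out M S : Type*} [LinearOrder (SAVal n' In M)]

/-- The configuration of the simulated processes at time `σ` of the simulation, where `X` is the
set of the crashed processes. -/
def simConfig (A : Algorithm n' In Out M S) (e : SimTrace n n' In Out M S) (X : Set (Fin n'))
    (σ : ℕ) : Config n' M S where
  loc := fun j => (simulated A e j (count e σ j)).state
  chan := fun a b => (simulated A e a (count e σ a)).outs b
  got := fun a b => {r | ∃ c, (a, r, c) ∈ (simulated A e b (count e σ b)).received}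
  crashed := X

/-- The simulated step executed at time `σ` of the simulation, if any. -/
def simEvent (e : SimTrace n n' In Out M S) (σ : ℕ) : Option (Fin n' × Event n' Empty) :=
  if h : ∃ j, count e (σ + 1) j ≠ count e σ j then
    some (h.choose, match agreed e (h.choose, count e σ h.choose) with
      | some (.msg m) => .recv m.1 m.2.1
      | _ => .start)
  else none

/-- The inputs of the simulated processes; `d` is used for those that do not start. -/
def simInput (e : SimTrace n n' In Out M S) (d : Fin n' → In) (j : Fin n') : In :=
  match agreed e (j, 0) with
  | some (.input v) => v
  | _ => d j

variable {A : Algorithm n' In Out M S} {inp : Fin n → Fin n' → In} {e : SimTrace n n' In Out M S}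
  {σ τ : ℕ} {j : Fin n'}

theorem simInput_mem (he : IsExecution (simulation n A) inp t e) (i₀ : Fin n) (j : Fin n') :
    ∃ i, simInput e (inp i₀) j = inp i j := by
  unfold simInput
  cases h : agreed e (j, 0) with
  | none => exact ⟨i₀, rfl⟩
  | some v =>
    obtain ⟨i, τ, s, hs, hr⟩ := exists_of_agreed h
    rcases result_valid he hs hr with ⟨-, x, rfl⟩ | ⟨h0, -⟩
    · exact ⟨x, rfl⟩
    · omega

/-- The possible simulated steps: nothing, the start of a process with its agreed input, or the
reception of a message that is in a channel. -/
theorem simEvent_cases (he : IsExecution (simulation n A) inp t e) (σ : ℕ) :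
    (simEvent e σ = none ∧ count e (σ + 1) = count e σ) ∨
    (∃ j v, simEvent e σ = some (j, .start) ∧ count e σ j = 0 ∧
      agreed e (j, 0) = some (.input v) ∧
      count e (σ + 1) = Function.update (count e σ) j (count e σ j + 1)) ∨
    ∃ j m st, simEvent e σ = some (j, .recv m.1 m.2.1) ∧
      agreed e (j, count e σ j) = some (.msg m) ∧
      (simulated A e j (count e σ j)).state = some st ∧
      m ∉ (simulated A e j (count e σ j)).received ∧
      ((simulated A e m.1 (count e σ m.1)).outs j)[m.2.1]? = some m.2.2 ∧
      count e (σ + 1) = Function.update (count e σ) j (count e σ j + 1) := by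
  rcases count_succ_cases he σ with h | ⟨j, i, s, v, hs, hsn, hr, h⟩
  · refine .inl ⟨?_, h⟩
    rw [simEvent, dif_neg]
    simp [h]
  right
  have hex : ∃ j, count e (σ + 1) j ≠ count e σ j := ⟨j, by simp [h]⟩
  have hch : hex.choose = j := by
    by_contra hne
    exact hex.choose_spec ((congrFun h _).trans (Function.update_of_ne hne _ _))
  have hag := agreed_eq he hs hr
  have hev : simEvent e σ = some (j, match agreed e (j, count e σ j) with
      | some (.msg m) => .recv m.1 m.2.1
      | _ => .start) := by
    rw [simEvent, dif_pos hex, hch]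
  rw [hag] at hev
  rcases result_valid he hs hr with ⟨h0, x, rfl⟩ | ⟨h0, m, rfl, hm1, hm2⟩
  · exact .inl ⟨j, inp x j, hev, h0, h0 ▸ hag, h⟩
  · right
    have hst : (simulated A e j (count e σ j)).state ≠ none := by
      rw [← hsn, ← (matches_simulated he hs j).state]
      intro h
      have := (threadInv he hs j).state.2 h
      omega
    obtain ⟨st, hst⟩ := Option.ne_none_iff_exists'.1 hst
    exact ⟨j, m, st, hev, hag, hst, hm1, hm2, h⟩

/-- The messages received in the simulated execution were sent in it. -/
theorem received_mem_chan (he : IsExecution (simulation n A) inp t e) {m : SimMsg n' M}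
    (hm : m ∈ (simulated A e j (count e σ j)).received) :
    ((simulated A e m.1 (count e σ m.1)).outs j)[m.2.1]? = some m.2.2 := by
  induction σ with
  | zero => simp [count_zero he, simulated, history] at hm
  | succ σ ih =>
    refine getElem?_of_prefix
      (history_outs_prefix (count_mono he (Nat.le_succ σ) m.1) j) ?_
    rcases simEvent_cases he σ with ⟨-, h⟩ | ⟨a, v, -, h1, h2, h⟩ | ⟨a, m', st, -, h1, h2, -, h4, h⟩
    · rw [h] at hm; exact ih hm
    · rw [h] at hm
      by_cases ha : j = a
      · subst ha
        rw [Function.update_self, h1, simulated,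
          history_succ_input (d := fun l => agreed e (j, l)) h2] at hm
        simp [History.next, history] at hm
      · rw [Function.update_of_ne ha] at hm; exact ih hm
    · rw [h] at hm
      by_cases ha : j = a
      · subst ha
        rw [Function.update_self, simulated,
          history_succ_msg (d := fun l => agreed e (j, l)) h1 h2] at hm
        simp only [History.next, List.mem_append, List.mem_singleton] at hm
        rcases hm with hm | rfl
        · exact ih hm
        · exact h4
      · rw [Function.update_of_ne ha] at hm; exact ih hm

/-- The crashed set is a parameter, constant during the step; it only has to avoid the process that
moves. -/
theorem simConfig_step (he : IsExecution (simulation n A) inp t e) {d : Fin n' → In}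
    {X : Set (Fin n')} (hX : ∀ j, count e (σ + 1) j ≠ count e σ j → j ∉ X) :
    Step A.toProtocol (simInput e d) (simConfig A e X σ) (simEvent e σ)
      (simConfig A e X (σ + 1)) := by
  rcases simEvent_cases he σ with ⟨h0, h⟩ | ⟨j, v, h0, h1, h2, h⟩ | ⟨j, m, st, h0, h1, h2, h3, h4, h⟩
  · have : simConfig A e X (σ + 1) = simConfig A e X σ := by simp [simConfig, h]
    rw [h0, this]
    exact .idle _
  · have hin : simInput e d j = v := by simp [simInput, h2]
    have hnext := history_succ_input (A := A) (j := j) (d := fun l => agreed e (j, l)) h2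
    have hst := Step.run (P := A.toProtocol) (inp := simInput e d) (simConfig A e X σ) j .start
      (A.δ j (A.init j v) none).1 (A.δ j (A.init j v) none).2 (hX j (by simp [h]))
      (by simp [Protocol.effect, simConfig, h1, simulated, history, Algorithm.toProtocol, hin])
    rw [h0]
    convert hst using 1
    simp only [simConfig, Config.send, Config.mark, Config.mk.injEq, and_true]
    refine ⟨?_, ?_, ?_⟩
    · funext a
      by_cases ha : a = j
      · subst ha; simp [h, h1, simulated, hnext, History.next]
      · simp [h, ha]
    · funext a b
      by_cases ha : a = j
      · subst ha; simp [h, h1, simulated, hnext, History.next]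
      · simp [h, ha]
    · funext a b
      by_cases hb : b = j
      · subst hb; simp [h, h1, simulated, hnext, History.next]
      · simp [h, hb]
  · have hnext := history_succ_msg (A := A) (j := j) (d := fun l => agreed e (j, l)) h1 h2
    -- A previous reception with this sender and rank would have had the content found at that
    -- position of the channel, so it would have been `m` itself.
    have hgot : m.2.1 ∉ (simConfig A e X σ).got m.1 j := by
      rintro ⟨c, hc⟩
      have h5 := received_mem_chan he hc
      simp only [h4] at h5
      exact h3 (by rwa [← Option.some.inj h5] at hc)
    have hst := Step.run (P := A.toProtocol) (inp := simInput e d) (simConfig A e X σ) j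
      (.recv m.1 m.2.1) (A.δ j st (some (m.1, m.2.2))).1 (A.δ j st (some (m.1, m.2.2))).2
      (hX j (by simp [h]))
      (by
        simp only [Protocol.effect, hgot, if_false]
        simp [simConfig, h2, h4, Algorithm.toProtocol])
    rw [h0]
    convert hst using 1
    simp only [simConfig, Config.send, Config.mark, Config.mk.injEq, and_true]
    refine ⟨?_, ?_, ?_⟩
    · funext a
      by_cases ha : a = j
      · subst ha; simp [h, simulated, hnext, History.next]
      · simp [h, ha]
    · funext a b
      by_cases ha : a = j
      · subst ha; simp [h, simulated, hnext, History.next]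
      · simp [h, ha]
    · funext a b
      by_cases hb : b = j
      · subst hb
        by_cases ha : a = m.1
        · subst ha
          ext r
          simp only [h, Function.update_self, simulated, hnext, History.next, List.mem_append,
            List.mem_singleton, Set.mem_ofPred_eq, and_self, if_true, Set.mem_insert_iff]
          constructor
          · rintro ⟨c, hc | hc⟩
            · exact .inr ⟨c, hc⟩
            · exact .inl (congrArg (fun a => a.2.1) hc)
          · rintro (rfl | ⟨c, hc⟩)
            · exact ⟨m.2.2, .inr rfl⟩
            · exact ⟨c, .inl hc⟩
        · ext r
          have : ∀ c, (a, r, c) ≠ m := fun c hc => ha (congrArg Prod.fst hc)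
          simp [h, simulated, hnext, History.next, ha, this]
      · simp [h, hb]

/-- The set of the simulated processes that are blocked at some correct simulator. -/
def blockedSet (e : SimTrace n n' In Out M S) : Set (Fin n') :=
  {j | ∃ i, e.Correct i ∧ Blocked e i j}

/-- The simulated execution.  Its even steps are those of the simulation; its odd steps are used,
after the time `2 * T`, for the crashes of the blocked processes. -/
def simTrace (A : Algorithm n' In Out M S) (e : SimTrace n n' In Out M S) (T : ℕ) :
    Trace n' M S Empty where
  cfg := fun τ => simConfig A e {j | j ∈ blockedSet e ∧ 2 * (T + j) + 1 < τ} ((τ + 1) / 2)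
  act := fun τ => if τ % 2 = 0 then simEvent e (τ / 2) else none

theorem simTrace_correct_iff {T : ℕ} : (simTrace A e T).Correct j ↔ j ∉ blockedSet e := by
  constructor
  · intro h hj
    exact h (2 * (T + j) + 2) ⟨hj, by omega⟩
  · intro h τ hτ
    exact h hτ.1

theorem simTrace_received (he : IsExecution (simulation n A) inp t e) {T : ℕ} (j : Fin n') (τ : ℕ) :
    (simTrace A e T).received j τ = (simulated A e j (count e ((τ + 1) / 2) j)).received := by
  induction τ with
  | zero => simp [Trace.received, count_zero he, simulated, history]
  | succ τ ih =>
    rw [Trace.received, List.range_succ, List.filterMap_append]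
    rw [Trace.received] at ih
    rw [ih]
    rcases Nat.mod_two_eq_zero_or_one τ with hτ | hτ
    · have e1 : (τ + 1) / 2 = τ / 2 := by omega
      have e2 : (τ + 1 + 1) / 2 = τ / 2 + 1 := by omega
      have hact : (simTrace A e T).act τ = simEvent e (τ / 2) := by simp [simTrace, hτ]
      rw [e1, e2]
      rcases simEvent_cases he (τ / 2) with ⟨h0, h⟩ | ⟨a, v, h0, h1, h2, h⟩ |
        ⟨a, m, st, h0, h1, h2, h3, h4, h⟩
      · rw [h]; simp [hact, h0]
      · rw [h]
        simp only [List.filterMap_cons, hact, h0, List.filterMap_nil, List.append_nil]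
        by_cases ha : j = a
        · subst ha
          rw [Function.update_self, h1, simulated, simulated,
            history_succ_input (d := fun l => agreed e (j, l)) h2]
          rfl
        · rw [Function.update_of_ne ha]
      · rw [h]
        simp only [List.filterMap_cons, hact, h0, List.filterMap_nil]
        by_cases ha : j = a
        · subst ha
          have h5 : ((simTrace A e T).cfg τ).chan m.1 j =
              (simulated A e m.1 (count e (τ / 2) m.1)).outs j := by
            simp [simTrace, simConfig, e1]
          rw [Function.update_self, h5, if_pos rfl, h4]
          conv_rhs => rw [simulated, history_succ_msg (d := fun l => agreed e (j, l)) h1 h2]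
          rfl
        · rw [Function.update_of_ne ha, if_neg (Ne.symm ha)]
          simp
    · have e1 : (τ + 1 + 1) / 2 = (τ + 1) / 2 := by omega
      have hact : (simTrace A e T).act τ = none := by simp [simTrace, hτ]
      rw [e1]
      simp [hact]

/-- A bounded monotone counter is eventually constant, and finitely many processes have a common
threshold. -/
theorem blockedSet_eventually (he : IsExecution (simulation n A) inp t e) (htn : 2 * t < n) :
    ∃ T, ∀ σ ≥ T, ∀ j ∈ blockedSet e, count e (σ + 1) j = count e σ j := by
  have : ∀ᶠ σ in Filter.atTop, ∀ j, j ∈ blockedSet e → count e (σ + 1) j = count e σ j := by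
    refine Filter.eventually_all.2 fun j => ?_
    by_cases hj : j ∈ blockedSet e
    swap
    · simp [hj]
    obtain ⟨i, hi, hb⟩ := hj
    have hbd := hb.count_bounded he htn hi
    have hmin := Nat.find_spec hbd
    -- The least upper bound is attained, since otherwise its predecessor would also be a bound.
    obtain ⟨T, hT⟩ : ∃ T, Nat.find hbd ≤ count e T j := by
      by_contra! hc
      rcases Nat.eq_zero_or_pos (Nat.find hbd) with h0 | h0
      · have := hc 0; omega
      · exact Nat.find_min hbd (Nat.sub_lt h0 Nat.one_pos)
          (fun τ => by have := hc τ; omega)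
    filter_upwards [Filter.eventually_ge_atTop T] with σ hσ _
    have h1 := count_mono he hσ j
    have h2 : count e σ j ≤ count e (σ + 1) j := count_mono he (Nat.le_succ σ) j
    have h3 := hmin (σ + 1)
    omega
  obtain ⟨T, hT⟩ := Filter.eventually_atTop.1 this
  exact ⟨T, hT⟩

theorem simTrace_step (he : IsExecution (simulation n A) inp t e) {d : Fin n' → In} {T : ℕ}
    (hT : ∀ σ ≥ T, ∀ j ∈ blockedSet e, count e (σ + 1) j = count e σ j) (τ : ℕ) :
    Step A.toProtocol (simInput e d) ((simTrace A e T).cfg τ) ((simTrace A e T).act τ)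
      ((simTrace A e T).cfg (τ + 1)) := by
  rcases Nat.mod_two_eq_zero_or_one τ with hτ | hτ
  · have e1 : (τ + 1) / 2 = τ / 2 := by omega
    have e2 : (τ + 1 + 1) / 2 = τ / 2 + 1 := by omega
    have e3 : {j | j ∈ blockedSet e ∧ 2 * (T + j) + 1 < τ + 1} =
        {j | j ∈ blockedSet e ∧ 2 * (T + j) + 1 < τ} := by
      ext j
      simp only [Set.mem_ofPred_eq, and_congr_right_iff]
      intro _; omega
    simp only [simTrace, hτ, if_true, e1, e2, e3]
    -- A process already in the crashed set is blocked and past the threshold `T`, so its counter no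
    -- longer moves.
    refine simConfig_step he fun j hj hjX => hj (hT _ ?_ j hjX.1)
    have := hjX.2
    omega
  · have e1 : (τ + 1 + 1) / 2 = (τ + 1) / 2 := by omega
    have hact : (simTrace A e T).act τ = none := by simp [simTrace, hτ]
    rw [hact]
    -- Distinct processes have distinct odd crash times, so each odd step crashes at most one
    -- process.
    by_cases hj : ∃ j : Fin n', j ∈ blockedSet e ∧ 2 * (T + j) + 1 = τ
    · obtain ⟨j, hj, hjτ⟩ := hj
      have hst := Step.crash (P := A.toProtocol) (inp := simInput e d) ((simTrace A e T).cfg τ) j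
        (fun h => by have := h.2; omega)
      convert hst using 1
      simp only [simTrace, e1, simConfig, Config.mk.injEq, true_and]
      ext a
      simp only [Set.mem_ofPred_eq, Set.mem_insert_iff]
      constructor
      · rintro ⟨h1, h2⟩
        by_cases h3 : 2 * (T + a) + 1 < τ
        · exact .inr ⟨h1, h3⟩
        · exact .inl (Fin.ext (by omega))
      · rintro (rfl | ⟨h1, h2⟩)
        · exact ⟨hj, by omega⟩
        · exact ⟨h1, by omega⟩
    · have : (simTrace A e T).cfg (τ + 1) = (simTrace A e T).cfg τ := by
        simp only [simTrace, e1, simConfig, Config.mk.injEq, true_and]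
        ext a
        simp only [Set.mem_ofPred_eq, and_congr_right_iff]
        intro h1
        have : 2 * (T + (a : ℕ)) + 1 ≠ τ := fun h => hj ⟨a, h1, h⟩
        omega
      rw [this]
      exact .idle _

/-- A sequence of natural numbers that starts at `0` and increases by at most one at each
step takes all the values below any of its values. -/
theorem exists_eq_of_le_of_succ_le {f : ℕ → ℕ} (h0 : f 0 = 0) (hf : ∀ u, f (u + 1) ≤ f u + 1)
    {k u : ℕ} (hk : k ≤ f u) : ∃ u' ≤ u, f u' = k := by
  induction u with
  | zero => exact ⟨0, le_rfl, by omega⟩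
  | succ u ih =>
    rcases hk.lt_or_eq with h | h
    · obtain ⟨u', hu', h'⟩ := ih (by have := hf u; omega)
      exact ⟨u', by omega, h'⟩
    · exact ⟨u + 1, le_rfl, h.symm⟩

/-- Local simulators may lag behind the maximum; this discrete intermediate value argument finds the
time at which the global history had the length that they see now. -/
theorem exists_count_eq (he : IsExecution (simulation n A) inp t e) {k : ℕ}
    (hk : k ≤ count e σ j) : ∃ u, count e u j = k := by
  have hsucc : ∀ u, count e (u + 1) j ≤ count e u j + 1 := by
    intro u
    rcases count_succ_cases he u with h | ⟨a, -, -, -, -, -, -, h⟩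
    · simp [h]
    · by_cases ha : j = a
      · subst ha; simp [h]
      · simp [h, ha]
  obtain ⟨u, -, h⟩ := exists_eq_of_le_of_succ_le (f := fun u => count e u j)
    (count_zero he j) hsucc hk
  exact ⟨u, h⟩

theorem exists_sn_eq (he : IsExecution (simulation n A) inp t e) (htn : 2 * t < n) {i : Fin n}
    (hi : e.Correct i) (σ : ℕ) (j : Fin n') :
    ∃ u s, (e.cfg u).loc i = some s ∧ s.sn j = count e σ j := by
  obtain ⟨u, s, hs, hle⟩ := complete_sn he htn hi σ j
  -- The value 0 needs its own argument: the extended counter is 0 even before the simulator has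
  -- started, whereas an actual local state is required.
  by_cases h0 : count e σ j = 0
  · have hex : ∃ u s, (e.cfg u).loc i = some s := ⟨u, s, hs⟩
    obtain ⟨s₁, hs₁⟩ := Nat.find_spec hex
    have hmin := fun u (hu : u < Nat.find hex) => Nat.find_min hex hu
    generalize Nat.find hex = N at *
    cases N with
    | zero => simp [he.init, Config.initial] at hs₁
    | succ N =>
      have hnone : (e.cfg N).loc i = none := by
        by_contra h
        obtain ⟨s₂, hs₂⟩ := Option.ne_none_iff_exists'.1 h
        exact hmin N (Nat.lt_succ_self N) ⟨s₂, hs₂⟩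
      rcases loc_step he N i with h | ⟨-, h⟩ | ⟨a, b, out, h, -⟩
      · rw [h, hnone] at hs₁; simp at hs₁
      · exact ⟨N + 1, _, h, by rw [h0]; rfl⟩
      · rw [hnone] at h; simp at h
  · have hsucc : ∀ u, ((e.cfg (u + 1)).loc i).elim 0 (fun s => s.sn j) ≤
        ((e.cfg u).loc i).elim 0 (fun s => s.sn j) + 1 := by
      intro u
      rcases loc_step he u i with h | ⟨-, h⟩ | ⟨a, b, out, h1, h2, h3, -⟩
      · simp [h]
      · simp [h, SimState.initial]
      · simpa [h1, h2] using h3.sn_le_succ j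
    obtain ⟨u', -, h⟩ := exists_eq_of_le_of_succ_le
      (f := fun u => ((e.cfg u).loc i).elim 0 fun s => s.sn j) (k := count e σ j) (u := u)
      (by simp [he.init, Config.initial]) hsucc (by simpa [hs] using hle)
    cases hl : (e.cfg u').loc i with
    | none => simp [hl] at h; omega
    | some s' => exact ⟨u', s', hl, by simpa [hl] using h⟩

/-- Each blocked process is blocked by the crash of a simulator, which blocks no other one. -/
theorem exists_blocking (he : IsExecution (simulation n A) inp t e) (htn : 2 * t < n)
    (j₀ : Fin n') :
    ∃ f : Fin n → Fin n', ∀ i j, e.Correct i → Blocked e i j → ∃ k, ¬ e.Correct k ∧ f k = j := by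
  refine ⟨fun k => if h : ∃ j, CrashedIn e k j then h.choose else j₀, fun i j hi hb => ?_⟩
  obtain ⟨x, hx⟩ := hb.crashedIn he htn hi
  refine ⟨x, ?_, ?_⟩
  · obtain ⟨τ, s, h, -⟩ := hx
    exact fun hc => hc τ h
  · have hex : ∃ j, CrashedIn e x j := ⟨j, hx⟩
    simp only [dif_pos hex]
    exact hex.choose_spec.unique he hx

/-- At most `t` simulated processes are blocked. -/
theorem blockedSet_ncard (he : IsExecution (simulation n A) inp t e) (htn : 2 * t < n)
    (j₀ : Fin n') : (blockedSet e).ncard ≤ t := by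
  obtain ⟨f, hf⟩ := exists_blocking he htn j₀
  have hsub : blockedSet e ⊆ f '' {k | ¬ e.Correct k} := by
    rintro j ⟨i, hi, hb⟩
    obtain ⟨k, hk, h⟩ := hf i j hi hb
    exact ⟨k, hk, h⟩
  exact (Set.ncard_le_ncard hsub (Set.toFinite _)).trans
    ((Set.ncard_image_le (Set.toFinite _)).trans he.resilient)

/-- A process blocked nowhere is seen in `waitMsg`, where its counter is positive, hence it has
started; its messages arrive by `eventually_received`. -/
theorem simTrace_isExecution (he : IsExecution (simulation n A) inp t e) (htn : 2 * t < n)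
    (j₀ : Fin n') (d : Fin n' → In) {T : ℕ}
    (hT : ∀ σ ≥ T, ∀ j ∈ blockedSet e, count e (σ + 1) j = count e σ j) :
    IsExecution A.toProtocol (simInput e d) t (simTrace A e T) where
  init := by
    simp [simTrace, simConfig, Config.initial, count_zero he, simulated, history]
  step := simTrace_step he hT
  resilient := by
    have : {p | ¬ (simTrace A e T).Correct p} = blockedSet e := by
      ext p; simp [simTrace_correct_iff]
    rw [this]
    exact blockedSet_ncard he htn j₀
  starts := by
    intro j hj
    rw [simTrace_correct_iff] at hj
    obtain ⟨i, hi⟩ := exists_correct he htn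
    obtain ⟨τ, -, s, hs, hpc⟩ := not_blocked (fun hb => hj ⟨i, hi, hb⟩) 0
    have hpos := (threadInv he hs j).waitMsg hpc
    obtain ⟨u, hu⟩ := exists_count_eq he (sn_le_count hs j)
    refine ⟨2 * u, ?_⟩
    have e1 : (2 * u + 1) / 2 = u := by omega
    simp only [simTrace, simConfig, e1, hu]
    rw [← (matches_simulated he hs j).state]
    intro h
    have := (threadInv he hs j).state.2 h
    omega
  delivers := by
    intro j hj q τ r hr
    rw [simTrace_correct_iff] at hj
    simp only [simTrace, simConfig] at hr
    obtain ⟨u, hu⟩ := eventually_received (m := (q, r, _)) he htn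
      (fun i hi hb => hj ⟨i, hi, hb⟩) (List.getElem?_eq_getElem hr)
    refine ⟨2 * u, ?_⟩
    have e1 : (2 * u + 1) / 2 = u := by omega
    simp only [simTrace, simConfig, e1]
    exact ⟨_, hu⟩
  fair := fun _ _ θ => θ.elim

theorem simTrace_simulates (he : IsExecution (simulation n A) inp t e) (htn : 2 * t < n)
    (j₀ : Fin n') (i₀ : Fin n) {T : ℕ}
    (hT : ∀ σ ≥ T, ∀ j ∈ blockedSet e, count e (σ + 1) j = count e σ j) :
    Simulates A t inp e (simInput e (inp i₀)) (simTrace A e T) where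
  input := simInput_mem he i₀
  execution := simTrace_isExecution he htn j₀ _ hT
  sound := by
    rintro i s ⟨τ, hs⟩ j
    obtain ⟨u, hu⟩ := exists_count_eq he (sn_le_count hs j)
    have e1 : (2 * u + 1) / 2 = u := by omega
    refine ⟨2 * u, ?_, ?_⟩
    · simp only [simTrace, simConfig, e1, hu, (matches_simulated he hs j).state]
    · rw [simTrace_received he, e1, hu, (matches_simulated he hs j).received]
  complete := by
    intro i hi j τ
    obtain ⟨u, s, hs, hsn⟩ := exists_sn_eq he htn hi ((τ + 1) / 2) j
    refine ⟨s, ⟨u, hs⟩, ?_, ?_⟩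
    · rw [(matches_simulated he hs j).state, hsn]; rfl
    · rw [simTrace_received he, (matches_simulated he hs j).received, hsn]
  crash := by
    intro j
    rw [simTrace_correct_iff, not_not]
    rfl
  decision := by
    rintro i j v ⟨s, ⟨τ, hs⟩, hv⟩
    rw [(matches_simulated he hs j).decided] at hv
    obtain ⟨k, hk, h1, h2⟩ := history_decided hv
    obtain ⟨u, hu⟩ := exists_count_eq he (hk.trans (sn_le_count hs j))
    -- At the first time with counter `k`, all earlier counters are smaller, so no earlier state
    -- allows a decision.
    have hex : ∃ τ, count e ((τ + 1) / 2) j = k :=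
      ⟨2 * u, by rw [show (2 * u + 1) / 2 = u by omega, hu]⟩
    refine ⟨Nat.find hex, ?_, fun τ' hτ' => ?_⟩
    · simp only [simTrace, simConfig, Nat.find_spec hex]
      exact h1
    · refine h2 _ (lt_of_le_of_ne ?_ (Nat.find_min hex hτ'))
      calc count e ((τ' + 1) / 2) j ≤ count e ((Nat.find hex + 1) / 2) j :=
            count_mono he (by omega) j
        _ = k := Nat.find_spec hex

end Execution

end BG

end

/-! ### Assembly of the four claims. -/

theorem mainTheorem3 {n n' t : ℕ} {In Out M S : Type*} [LinearOrder (BG.SAVal n' In M)]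
    (htn : 2 * t < n) (htn' : t < n')
    (T : BG.Task n' In Out) (A : BG.Algorithm n' In Out M S) (hA : A.Solves T t)
    (inp : Fin n → Fin n' → In)
    (hinp : ∀ I : Fin n' → In, (∀ j, ∃ i, I j = inp i j) → I ∈ T.inputs)
    (e : BG.SimTrace n n' In Out M S)
    (he : BG.IsExecution (BG.simulation n A) inp t e) :
    -- the simulators simulate an execution of `A` with at most `t` crashes
    (∃ I e', BG.Simulates A t inp e I e' ∧
      ∃ O, T.rel I O ∧ ∀ i j v, BG.Computes e i j v → O j = v) ∧
    -- the crash of a simulator blocks at most one simulated process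
    (∃ f : Fin n → Fin n', ∀ i j, e.Correct i → BG.Blocked e i j →
      ∃ k, ¬ e.Correct k ∧ f k = j) ∧
    -- all simulators see the same sequences of received messages
    (∀ i₁ i₂ s₁ s₂, BG.Reaches e i₁ s₁ → BG.Reaches e i₂ s₂ → ∀ (j : Fin n') (k : ℕ) m₁ m₂,
      (s₁.received j)[k]? = some m₁ → (s₂.received j)[k]? = some m₂ → m₁ = m₂) ∧
    -- each correct simulator computes the decisions of at least `n' - t` simulated processes
    (∀ i, e.Correct i → n' - t ≤ {j | ∃ v, BG.Computes e i j v}.ncard) := by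
  -- Default values: `j₀` for simulators that crashed without owning a lock or did not crash, `i₀`
  -- for the inputs of processes with no agreed input.
  have j₀ : Fin n' := ⟨t, htn'⟩
  have i₀ : Fin n := ⟨t, by omega⟩
  obtain ⟨T₀, hT₀⟩ := BG.blockedSet_eventually he htn
  have hsim := BG.simTrace_simulates he htn j₀ i₀ hT₀
  obtain ⟨hdec, O, hO, hOv⟩ := hA _ (hinp _ hsim.input) _ hsim.execution
  refine ⟨⟨_, _, hsim, O, hO, fun i j v h => hOv j v (hsim.decision i j v h)⟩,
    BG.exists_blocking he htn j₀, ?_, ?_⟩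
  · rintro i₁ i₂ s₁ s₂ ⟨τ₁, h₁⟩ ⟨τ₂, h₂⟩ j k m₁ m₂ hm₁ hm₂
    rw [(BG.matches_simulated he h₁ j).received] at hm₁
    rw [(BG.matches_simulated he h₂ j).received] at hm₂
    have e₁ := BG.getElem?_of_prefix
      (BG.history_received_prefix (le_max_left (s₁.sn j) (s₂.sn j))) hm₁
    have e₂ := BG.getElem?_of_prefix
      (BG.history_received_prefix (le_max_right (s₁.sn j) (s₂.sn j))) hm₂
    rw [e₁] at e₂
    exact Option.some.inj e₂
  · intro i hi
    -- An unblocked process is correct in the simulated execution, so it decides there; simulator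
    -- `i` reaches its deciding state and has then recorded a decision.
    have hsub : (BG.blockedSet e)ᶜ ⊆ {j | ∃ v, BG.Computes e i j v} := by
      intro j hj
      obtain ⟨v, τ, hv, -⟩ := hdec j (BG.simTrace_correct_iff.2 hj)
      obtain ⟨s, ⟨u, hs⟩, hst, -⟩ := hsim.complete i hi j τ
      rw [← hst, (BG.matches_simulated he hs j).state] at hv
      obtain ⟨v', hv'⟩ := Option.ne_none_iff_exists'.1
        (BG.history_decided_ne_none (A := A) (j := j) (by rw [BG.simulated] at hv; rw [hv]; simp))
      exact ⟨v', s, ⟨u, hs⟩, (BG.matches_simulated he hs j).decided.trans hv'⟩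
    have h1 := Set.ncard_le_ncard hsub (Set.toFinite _)
    have h2 := Set.ncard_add_ncard_compl (BG.blockedSet e) (Set.toFinite _) (Set.toFinite _)
    have h3 := BG.blockedSet_ncard he htn j₀
    rw [Nat.card_fin] at h2
    omega
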